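/- Let $\mathsf A$ be an abelian category with a torsion pair $(\mathcal T,\mathcal F)$: two classes of objects, closed under isomorphism, such that $\operatorname{Hom}(T,F)=0$ for $T\in\mathcal T$, $F\in\mathcal F$, and every object $X$ fits in a short exact sequence $0\to T\to X\to F\to 0$ with $T\in\mathcal T$, $F\in\mathcal F$. **The category $\mathsf B$.** Objects are the two-term complexes $\mathbb X=[d\colon X^{-1}\to X^0]$ in $\mathsf A$ with $\ker d\in\mathcal F$ and $\operatorname{coker} d\in\mathcal T$. A morphism $\mathbb X\to\mathbb Y$ is an isomorphism class of butterflies, that is, of objects $E$ with maps $\kappa\colon X^{-1}\to E$, $\iota\colon Y^{-1}\to E$, $\sigma\colon E\to X^0$, $\rho\colon E\to Y^0$ such that $\sigma\kappa=d_X$, $\rho\iota=d_Y$, $\rho\kappa=0$ and $0\to Y^{-1}\xrightarrow{\iota}E\xrightarrow{\sigma}X^0\to 0$ is exact. The composite of $E\colon\mathbb X\to\mathbb Y$ and $F\colon\mathbb Y\to\mathbb Z$ is $\operatorname{coker}\bigl((\iota,\kappa')\colon Y^{-1}\to E\times_{Y^0}F\bigr)$ with the evident maps. The category $\mathsf B$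 is abelian. A morphism of complexes $f=(f^{-1},f^0)\colon\mathbb X\to\mathbb Y$ gives a (strict) morphism of $\mathsf B$, with $E=X^0\oplus Y^{-1}$, $\kappa=(d_X,-f^{-1})$, $\iota$ and $\sigma$ the inclusion and the projection, and $\rho=f^0+d_Y$. Let $\mathsf{Ch}(\mathsf B)$ be the category of (unbounded) cochain complexes in $\mathsf B$ and $\mathcal D(\mathsf B)$ its derived category. Let $\mathsf{Ch}^{st}(\mathsf B)$ be the category with the same objects as $\mathsf{Ch}(\mathsf B)$, in which a morphism $\mathbf X\to\mathbf Y$ is a family of morphisms of two-term complexes $f_n=(f_n^{-1},f_n^0)\colon{}^n\mathbb X\to{}^n\mathbb Y$, $n\in\mathbb Z$, whose classes in $\mathsf B$ commute with the differentials; there is an evident functor $I\colon\mathsf{Ch}^{st}(\mathsf B)\to\mathsf{Ch}(\mathsf B)$. **Decorated complexes.** Let $\mathsf{Ch}(\mathsf A,\mathcal T,\mathcal F)$ be the category of pairs $(E^\bullet,M^\bullet)$ of a cochain complex $(E^\bullet,\delta)$ in $\mathsf A$ and subobjects $M^n\subseteq E^n$, $n\in\mathbb Z$, such that for every $n$ the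 map $M^n\to E^{n+1}/M^{n+1}$ induced by $\delta$ has its kernel $H^{-1,n}$ in $\mathcal F$ and its cokernel $H^{0,n}$ in $\mathcal T$; a morphism $(E^\bullet,M^\bullet)\to(F^\bullet,N^\bullet)$ is a chain map $f\colon E^\bullet\to F^\bullet$ with $f(M^n)\subseteq N^n$ for all $n$. Let $\mathcal S_{sis}$ be the class of morphisms that induce isomorphisms on all $H^{-1,n}$ and all $H^{0,n}$, and $\mathcal S_{qis}$ the class of morphisms that induce isomorphisms on all cohomology objects $H^n(E^\bullet)$. **The functor $\operatorname{Tot}\colon\mathsf{Ch}^{st}(\mathsf B)\to\mathsf{Ch}(\mathsf A,\mathcal T,\mathcal F)$.** For a complex $\mathbf X$ in $\mathsf B$ choose, for each $n$, a butterfly $(E^n;\kappa_n,\iota_n,\sigma_n,\rho_n)$ representing the differential ${}^{n-1}\mathbb X\to{}^n\mathbb X$. There are unique maps $\delta\colon E^n\to E^{n+1}$ with $\delta\kappa_n=0$, $\delta\iota_n=\kappa_{n+1}$, $\sigma_{n+1}\delta=\rho_n$, $\rho_{n+1}\delta=0$; they satisfy $\delta^2=0$, and $\operatorname{Tot}(\mathbf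 X)=(E^\bullet,M^\bullet)$ with $M^n=\iota_n({}^nX^{-1})$. A morphism $(f_n)\colon\mathbf X\to\mathbf Y$ in $\mathsf{Ch}^{st}(\mathsf B)$, with $\operatorname{Tot}(\mathbf Y)=(F^\bullet,N^\bullet)$ built from butterflies $(F^n;\kappa'_n,\iota'_n,\sigma'_n,\rho'_n)$, is sent to the chain map formed by the unique maps $s_n\colon E^n\to F^n$ with $s_n\kappa_n=\kappa'_nf_{n-1}^{-1}$, $s_n\iota_n=\iota'_nf_n^{-1}$, $\sigma'_ns_n=f_{n-1}^0\sigma_n$, $\rho'_ns_n=f_n^0\rho_n$. **Statement.** $\operatorname{Tot}$ induces equivalences of categories $$\Phi\colon\mathsf{Ch}(\mathsf B)\xrightarrow{\ \sim\ }\mathcal S_{sis}^{-1}\mathsf{Ch}(\mathsf A,\mathcal T,\mathcal F),\qquad \Psi\colon\mathcal D(\mathsf B)\xrightarrow{\ \sim\ }\mathcal S_{qis}^{-1}\mathsf{Ch}(\mathsf A,\mathcal T,\mathcal F).$$ That is, there are equivalences $\Phi$ and $\Psi$ such that $\Phi\circ I$ is isomorphic to $\operatorname{Tot}$ followed by the localization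 functor of $\mathcal S_{sis}$, and $\Psi\circ L\circ I$ is isomorphic to $\operatorname{Tot}$ followed by the localization functor of $\mathcal S_{qis}$, where $L\colon\mathsf{Ch}(\mathsf B)\to\mathcal D(\mathsf B)$ is the localization functor. -/

import Mathlib

open CategoryTheory CategoryTheory.Limits

attribute [-instance] CategoryTheory.catToReflQuiver

universe w v u

namespace HRS

noncomputable section

variable {A : Type u} [Category.{v} A] [Abelian A]

/-- A diagram ("butterfly") from the two-term complex `X = [X⁻¹ ⟶ X⁰]` to `Y = [Y⁻¹ ⟶ Y⁰]`.
A two-term complex is an object of `Arrow A`; `X⁻¹` is `X.left` and `X⁰` is `X.right`. -/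
structure Butterfly (X Y : Arrow A) where
  /-- the central object -/
  E : A
  κ : X.left ⟶ E
  ι : Y.left ⟶ E
  σ : E ⟶ X.right
  ρ : E ⟶ Y.right
  κ_σ : κ ≫ σ = X.hom
  ι_ρ : ι ≫ ρ = Y.hom
  κ_ρ : κ ≫ ρ = 0
  ι_σ : ι ≫ σ = 0
  shortExact : (ShortComplex.mk ι σ ι_σ).ShortExact

attribute [local simp] pullback.lift_fst pullback.lift_snd pullback.lift_fst_assoc
  pullback.lift_snd_assoc pushout.inl_desc pushout.inr_desc pushout.inl_desc_assoc
  pushout.inr_desc_assoc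

namespace Butterfly

attribute [simp] κ_σ ι_ρ κ_ρ ι_σ

variable {X Y Z W : Arrow A}

instance (P : Butterfly X Y) : Mono P.ι := P.shortExact.mono_f
instance (P : Butterfly X Y) : Epi P.σ := P.shortExact.epi_g

@[simp] lemma κ_σ' (P : Butterfly X Y) {T : A} (f : X.right ⟶ T) :
    P.κ ≫ P.σ ≫ f = X.hom ≫ f := by rw [← Category.assoc, P.κ_σ]
@[simp] lemma ι_ρ' (P : Butterfly X Y) {T : A} (f : Y.right ⟶ T) :
    P.ι ≫ P.ρ ≫ f = Y.hom ≫ f := by rw [← Category.assoc, P.ι_ρ]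
@[simp] lemma κ_ρ' (P : Butterfly X Y) {T : A} (f : Y.right ⟶ T) :
    P.κ ≫ P.ρ ≫ f = 0 := by rw [← Category.assoc, P.κ_ρ, zero_comp]
@[simp] lemma ι_σ' (P : Butterfly X Y) {T : A} (f : X.right ⟶ T) :
    P.ι ≫ P.σ ≫ f = 0 := by rw [← Category.assoc, P.ι_σ, zero_comp]

lemma exists_lift (P : Butterfly X Y) {T : A} (f : T ⟶ P.E) (hf : f ≫ P.σ = 0) :
    ∃ g : T ⟶ Y.left, g ≫ P.ι = f :=
  ⟨P.shortExact.exact.lift f hf, P.shortExact.exact.lift_f f hf⟩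

lemma exists_desc (P : Butterfly X Y) {T : A} (f : P.E ⟶ T) (hf : P.ι ≫ f = 0) :
    ∃ g : X.right ⟶ T, P.σ ≫ g = f :=
  ⟨P.shortExact.exact.desc f hf, P.shortExact.exact.g_desc f hf⟩

/-- `φ` commutes with the four arrows of the butterflies `P` and `Q`. -/
structure IsHom (P Q : Butterfly X Y) (φ : P.E ⟶ Q.E) : Prop where
  κ : P.κ ≫ φ = Q.κ
  ι : P.ι ≫ φ = Q.ι
  σ : φ ≫ Q.σ = P.σ
  ρ : φ ≫ Q.ρ = P.ρ

/-- Isomorphism of butterflies. -/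
instance setoid (X Y : Arrow A) : Setoid (Butterfly X Y) where
  r P Q := ∃ e : P.E ≅ Q.E, IsHom P Q e.hom
  iseqv :=
    { refl := fun P => ⟨Iso.refl _, by simp, by simp, by simp, by simp⟩
      symm := by
        rintro P Q ⟨e, h⟩
        refine ⟨e.symm, ?_, ?_, ?_, ?_⟩
        · simp [← h.κ]
        · simp [← h.ι]
        · simp [← h.σ]
        · simp [← h.ρ]
      trans := by
        rintro P Q R ⟨e, h⟩ ⟨e', h'⟩
        refine ⟨e ≪≫ e', ?_, ?_, ?_, ?_⟩
        · rw [Iso.trans_hom, ← Category.assoc, h.κ, h'.κ]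
        · rw [Iso.trans_hom, ← Category.assoc, h.ι, h'.ι]
        · rw [Iso.trans_hom, Category.assoc, h'.σ, h.σ]
        · rw [Iso.trans_hom, Category.assoc, h'.ρ, h.ρ] }

/-- Any map of butterflies is an isomorphism. -/
lemma equiv_of_isHom {P Q : Butterfly X Y} {φ : P.E ⟶ Q.E} (h : IsHom P Q φ) : P ≈ Q := by
  let F : ShortComplex.mk P.ι P.σ P.ι_σ ⟶ ShortComplex.mk Q.ι Q.σ Q.ι_σ :=
    { τ₁ := 𝟙 _
      τ₂ := φ
      τ₃ := 𝟙 _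
      comm₁₂ := by simp [h.ι]
      comm₂₃ := by simp [h.σ] }
  have : IsIso F.τ₁ := inferInstanceAs (IsIso (𝟙 _))
  have : IsIso F.τ₃ := inferInstanceAs (IsIso (𝟙 _))
  have : IsIso φ := ShortComplex.isIso₂_of_shortExact_of_isIso₁₃ F P.shortExact Q.shortExact
  exact ⟨asIso φ, h⟩

/-- The butterfly of an actual morphism of two-term complexes. -/
abbrev strict (f : X ⟶ Y) : Butterfly X Y where
  E := X.right ⊞ Y.left
  κ := biprod.lift X.hom (-f.left)
  ι := biprod.inr
  σ := biprod.fst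
  ρ := biprod.desc f.right Y.hom
  κ_σ := by simp
  ι_ρ := by simp
  κ_ρ := by simp [biprod.lift_desc]
  ι_σ := by simp
  shortExact := (ShortComplex.Splitting.mk (S := ShortComplex.mk (biprod.inr : Y.left ⟶ X.right ⊞ Y.left)
    biprod.fst (by simp)) biprod.snd biprod.inl (by simp) (by simp)
    (by simp [add_comm (biprod.snd ≫ biprod.inr), biprod.total])).shortExact

/-- The map `(ι, κ') : Y⁻¹ ⟶ E ×_{Y⁰} F`. -/
abbrev compι (P : Butterfly X Y) (Q : Butterfly Y Z) : Y.left ⟶ pullback P.ρ Q.σ :=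
  pullback.lift P.ι Q.κ (by simp)

lemma comp_refine (P : Butterfly X Y) (Q : Butterfly Y Z) {T : A} (x : T ⟶ pullback P.ρ Q.σ)
    (hx : x ≫ cokernel.π (compι P Q) = 0) :
    ∃ (T' : A) (p : T' ⟶ T) (_ : Epi p) (y : T' ⟶ Y.left), p ≫ x = y ≫ compι P Q :=
  (CokernelCofork.IsColimit.comp_π_eq_zero_iff_up_to_refinements
    (cokernelIsCokernel (compι P Q)) x).1 hx

/-- The composition of butterflies: the central object is the cokernel of
`(ι, κ') : Y⁻¹ ⟶ E ×_{Y⁰} F`. -/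
abbrev comp (P : Butterfly X Y) (Q : Butterfly Y Z) : Butterfly X Z where
  E := cokernel (compι P Q)
  κ := pullback.lift P.κ 0 (by simp) ≫ cokernel.π _
  ι := pullback.lift 0 Q.ι (by simp) ≫ cokernel.π _
  σ := cokernel.desc _ (pullback.fst _ _ ≫ P.σ) (by simp)
  ρ := cokernel.desc _ (pullback.snd _ _ ≫ Q.ρ) (by simp)
  κ_σ := by simp
  ι_ρ := by simp
  κ_ρ := by simp
  ι_σ := by simp
  shortExact := by
    have hm : Mono (pullback.lift 0 Q.ι (by simp) ≫ cokernel.π (compι P Q)) := by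
      rw [Preadditive.mono_iff_cancel_zero]
      intro T z hz
      rw [← Category.assoc] at hz
      obtain ⟨T', p, _, y, hy⟩ := comp_refine P Q _ hz
      have h1 := hy =≫ pullback.fst _ _
      have h2 := hy =≫ pullback.snd _ _
      simp only [Category.assoc, pullback.lift_fst, comp_zero] at h1
      simp only [Category.assoc, pullback.lift_snd] at h2
      have hy0 : y = 0 := by
        rw [← cancel_mono P.ι, ← h1, zero_comp]
      rw [← cancel_epi p, ← cancel_mono Q.ι, Category.assoc, h2, hy0]
      simp
    have he : Epi (cokernel.desc (compι P Q) (pullback.fst _ _ ≫ P.σ) (by simp)) := by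
      have : Epi (cokernel.π (compι P Q) ≫
        cokernel.desc (compι P Q) (pullback.fst _ _ ≫ P.σ) (by simp)) := by
        rw [cokernel.π_desc]
        infer_instance
      exact epi_of_epi (cokernel.π (compι P Q)) _
    refine ShortComplex.ShortExact.mk' ?_ hm he
    rw [ShortComplex.exact_iff_exact_up_to_refinements]
    intro T x hx
    obtain ⟨T₁, p₁, _, l, hl⟩ := surjective_up_to_refinements_of_epi (cokernel.π (compι P Q)) x
    have h0 : (l ≫ pullback.fst _ _) ≫ P.σ = 0 := by
      have h2 : p₁ ≫ x ≫ cokernel.desc (compι P Q) (pullback.fst _ _ ≫ P.σ) (by simp) = 0 := by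
        rw [show x ≫ cokernel.desc (compι P Q) (pullback.fst _ _ ≫ P.σ) (by simp) = 0 from hx,
          Limits.comp_zero]
      rw [← Category.assoc, hl] at h2
      simpa using h2
    obtain ⟨y, hy⟩ := P.exists_lift _ h0
    have h1 : (l ≫ pullback.snd _ _ - y ≫ Q.κ) ≫ Q.σ = 0 := by
      have : l ≫ pullback.snd P.ρ Q.σ ≫ Q.σ = y ≫ Y.hom := by
        rw [← pullback.condition, ← Category.assoc, ← hy]; simp
      simp [Preadditive.sub_comp, this]
    obtain ⟨z, hz⟩ := Q.exists_lift _ h1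
    refine ⟨T₁, p₁, inferInstance, z, ?_⟩
    change p₁ ≫ x = z ≫ pullback.lift 0 Q.ι _ ≫ cokernel.π _
    have : l = z ≫ pullback.lift 0 Q.ι (by simp) + y ≫ compι P Q := by
      apply pullback.hom_ext
      · simp [hy]
      · simp [hz]
    rw [hl, this]
    simp

/-- A criterion for `R` to be (isomorphic to) a composition. -/
lemma comp_equiv {P : Butterfly X Y} {Q : Butterfly Y Z} {R : Butterfly X Z}
    (t : pullback P.ρ Q.σ ⟶ R.E) (h : compι P Q ≫ t = 0)
    (hκ : pullback.lift P.κ 0 (by simp) ≫ t = R.κ)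
    (hι : pullback.lift 0 Q.ι (by simp) ≫ t = R.ι)
    (hσ : t ≫ R.σ = pullback.fst _ _ ≫ P.σ)
    (hρ : t ≫ R.ρ = pullback.snd _ _ ≫ Q.ρ) : P.comp Q ≈ R := by
  apply equiv_of_isHom (φ := cokernel.desc _ t h)
  constructor
  · simp [comp, hκ]
  · simp [comp, hι]
  · ext; simp [comp, hσ]
  · ext; simp [comp, hρ]

lemma exists_of_comp_equiv {P : Butterfly X Y} {Q : Butterfly Y Z} {R : Butterfly X Z}
    (h : P.comp Q ≈ R) :
    ∃ t : pullback P.ρ Q.σ ⟶ R.E, compι P Q ≫ t = 0 ∧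
      pullback.lift P.κ 0 (by simp) ≫ t = R.κ ∧
      pullback.lift 0 Q.ι (by simp) ≫ t = R.ι ∧
      t ≫ R.σ = pullback.fst _ _ ≫ P.σ ∧ t ≫ R.ρ = pullback.snd _ _ ≫ Q.ρ := by
  obtain ⟨e, he⟩ := h
  refine ⟨cokernel.π _ ≫ e.hom, ?_, ?_, ?_, ?_, ?_⟩
  · simp
  · rw [← Category.assoc]; exact he.κ
  · rw [← Category.assoc]; exact he.ι
  · rw [Category.assoc, he.σ]; simp [comp]
  · rw [Category.assoc, he.ρ]; simp [comp]

lemma comp_congr {P P' : Butterfly X Y} {Q Q' : Butterfly Y Z} (h : P ≈ P') (h' : Q ≈ Q') :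
    P.comp Q ≈ P'.comp Q' := by
  obtain ⟨e, he⟩ := h
  obtain ⟨e', he'⟩ := h'
  let m : pullback P.ρ Q.σ ⟶ pullback P'.ρ Q'.σ :=
    pullback.lift (pullback.fst _ _ ≫ e.hom) (pullback.snd _ _ ≫ e'.hom)
      (by simp [he.ρ, he'.σ, pullback.condition])
  apply comp_equiv (m ≫ cokernel.π _)
  · have : compι P Q ≫ m = compι P' Q' := by
      apply pullback.hom_ext
      · simp [m, he.ι]
      · simp [m, he'.κ]
    rw [← Category.assoc, this, cokernel.condition]
  · have : pullback.lift P.κ 0 (by simp) ≫ m = pullback.lift P'.κ 0 (by simp) := by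
      apply pullback.hom_ext
      · simp [m, he.κ]
      · simp [m]
    rw [← Category.assoc, this]
  · have : pullback.lift 0 Q.ι (by simp) ≫ m = pullback.lift 0 Q'.ι (by simp) := by
      apply pullback.hom_ext
      · simp [m]
      · simp [m, he'.ι]
    rw [← Category.assoc, this]
  · simp [comp, m, he.σ]
  · simp [comp, m, he'.ρ]

lemma comp_assoc (P : Butterfly X Y) (Q : Butterfly Y Z) (S : Butterfly Z W) :
    (P.comp Q).comp S ≈ P.comp (Q.comp S) := by
  obtain ⟨V, a, b, hab, hb, hV⟩ : ∃ (V : A) (a : V ⟶ pullback P.ρ Q.σ)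
      (b : V ⟶ pullback (P.comp Q).ρ S.σ),
      a ≫ cokernel.π (compι P Q) = b ≫ pullback.fst _ _ ∧ Epi b ∧
      ∀ {T : A} (l : T ⟶ pullback P.ρ Q.σ) (r : T ⟶ pullback (P.comp Q).ρ S.σ)
        (_ : l ≫ cokernel.π (compι P Q) = r ≫ pullback.fst _ _),
        ∃ x : T ⟶ V, x ≫ a = l ∧ x ≫ b = r :=
    ⟨pullback (cokernel.π (compι P Q)) (pullback.fst (P.comp Q).ρ S.σ), pullback.fst _ _,
      pullback.snd _ _, pullback.condition, inferInstance,
      fun l r h => ⟨pullback.lift l r h, pullback.lift_fst _ _ _, pullback.lift_snd _ _ _⟩⟩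
  have hFG : (a ≫ pullback.snd P.ρ Q.σ) ≫ Q.ρ = (b ≫ pullback.snd _ _) ≫ S.σ := by
    have h1 : (b ≫ pullback.fst _ _) ≫ (P.comp Q).ρ = (b ≫ pullback.snd _ _) ≫ S.σ := by
      rw [Category.assoc, pullback.condition, Category.assoc]
    rw [← h1, ← hab]
    simp
  obtain ⟨c, hc1, hc2⟩ : ∃ c : V ⟶ pullback Q.ρ S.σ,
      c ≫ pullback.fst _ _ = a ≫ pullback.snd P.ρ Q.σ ∧
      c ≫ pullback.snd _ _ = b ≫ pullback.snd _ _ :=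
    ⟨pullback.lift _ _ hFG, pullback.lift_fst _ _ _, pullback.lift_snd _ _ _⟩
  have hEM : (a ≫ pullback.fst _ _) ≫ P.ρ = (c ≫ cokernel.π (compι Q S)) ≫ (Q.comp S).σ := by
    simp only [Category.assoc, cokernel.π_desc]
    rw [← Category.assoc c, hc1, pullback.condition, Category.assoc]
  obtain ⟨d, hd1, hd2⟩ : ∃ d : V ⟶ pullback P.ρ (Q.comp S).σ,
      d ≫ pullback.fst _ _ = a ≫ pullback.fst _ _ ∧
      d ≫ pullback.snd _ _ = c ≫ cokernel.π (compι Q S) :=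
    ⟨pullback.lift _ _ hEM, pullback.lift_fst _ _ _, pullback.lift_snd _ _ _⟩
  obtain ⟨e, he⟩ : ∃ e : V ⟶ (P.comp (Q.comp S)).E, e = d ≫ cokernel.π _ := ⟨_, rfl⟩
  have key : ∀ {T : A} (x : T ⟶ V) (y : T ⟶ Y.left) (z : T ⟶ Z.left)
      (_ : x ≫ a = y ≫ compι P Q + z ≫ pullback.lift 0 Q.ι (by simp))
      (_ : x ≫ b ≫ pullback.snd _ _ = z ≫ S.κ), x ≫ e = 0 := by
    intro T x y z h1 h2
    have hc : x ≫ c = y ≫ pullback.lift Q.κ 0 (by simp) + z ≫ compι Q S := by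
      apply pullback.hom_ext
      · have := h1 =≫ pullback.snd _ _
        rw [Category.assoc, hc1, ← Category.assoc, h1]
        simp
      · rw [Category.assoc, hc2, h2]
        simp
    have : x ≫ d = y ≫ compι P (Q.comp S) := by
      apply pullback.hom_ext
      · rw [Category.assoc, hd1, ← Category.assoc, h1]
        simp
      · rw [Category.assoc, hd2, ← Category.assoc, hc]
        simp
    rw [he, ← Category.assoc, this, Category.assoc, cokernel.condition, Limits.comp_zero]
  have hker : kernel.ι b ≫ e = 0 := by
    have hx : (kernel.ι b ≫ a) ≫ cokernel.π (compι P Q) = 0 := by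
      rw [Category.assoc, hab, kernel.condition_assoc, Limits.zero_comp]
    obtain ⟨T', p, _, y, hy⟩ := comp_refine P Q _ hx
    rw [← cancel_epi p, Limits.comp_zero, ← Category.assoc]
    apply key _ y 0
    · simpa using hy
    · simp
  obtain ⟨t, hbt⟩ : ∃ t, b ≫ t = e := ⟨_, Abelian.comp_epiDesc b e hker⟩
  apply comp_equiv t
  · obtain ⟨x, hx1, hx2⟩ := hV (pullback.lift 0 Q.ι (by simp)) (compι (P.comp Q) S) (by simp)
    rw [← hx2, Category.assoc, hbt]
    apply key _ 0 (𝟙 _)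
    · simp [hx1]
    · rw [← Category.assoc, hx2]; simp
  · obtain ⟨x, hx1, hx2⟩ := hV (pullback.lift P.κ 0 (by simp))
      (pullback.lift (P.comp Q).κ 0 (by simp)) (by simp)
    rw [← hx2, Category.assoc, hbt, he, ← Category.assoc]
    have hxc : x ≫ c = 0 := by
      apply pullback.hom_ext
      · rw [Category.assoc, hc1, ← Category.assoc, hx1]; simp
      · rw [Category.assoc, hc2, ← Category.assoc, hx2]; simp
    have : x ≫ d = pullback.lift P.κ 0 (by simp) := by
      apply pullback.hom_ext
      · rw [Category.assoc, hd1, ← Category.assoc, hx1]; simp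
      · rw [Category.assoc, hd2, ← Category.assoc, hxc]; simp
    rw [this]
  · obtain ⟨x, hx1, hx2⟩ := hV (0 : W.left ⟶ _) (pullback.lift 0 S.ι (by simp)) (by simp)
    rw [← hx2, Category.assoc, hbt, he, ← Category.assoc]
    have hxc : x ≫ c = pullback.lift 0 S.ι (by simp) := by
      apply pullback.hom_ext
      · rw [Category.assoc, hc1, ← Category.assoc, hx1]; simp
      · rw [Category.assoc, hc2, ← Category.assoc, hx2]; simp
    have : x ≫ d = pullback.lift 0 (Q.comp S).ι (by simp) := by
      apply pullback.hom_ext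
      · rw [Category.assoc, hd1, ← Category.assoc, hx1]; simp
      · rw [Category.assoc, hd2, ← Category.assoc, hxc]; simp
    rw [this]
  · rw [← cancel_epi b, ← Category.assoc, hbt, ← Category.assoc b, ← hab, he]
    simp only [Category.assoc, cokernel.π_desc]
    rw [← Category.assoc d, hd1, Category.assoc]
  · rw [← cancel_epi b, ← Category.assoc, hbt, he]
    simp only [Category.assoc, cokernel.π_desc]
    rw [← Category.assoc d, hd2, Category.assoc, cokernel.π_desc, ← Category.assoc, hc2,
      Category.assoc]

lemma comp_strict_iff {P : Butterfly X Y} {g : Y ⟶ Z} {R : Butterfly X Z} :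
    P.comp (strict g) ≈ R ↔ ∃ t : P.E ⟶ R.E, P.κ ≫ t = R.κ ∧ P.ι ≫ t = g.left ≫ R.ι ∧
      t ≫ R.σ = P.σ ∧ t ≫ R.ρ = P.ρ ≫ g.right := by
  constructor
  · intro h
    obtain ⟨s, h0, hκ, hι, hσ, hρ⟩ := exists_of_comp_equiv h
    refine ⟨pullback.lift (𝟙 _) (P.ρ ≫ biprod.inl) (by simp [strict]) ≫ s, ?_, ?_, ?_, ?_⟩
    · rw [← hκ, ← Category.assoc]
      congr 1
      apply pullback.hom_ext <;> simp
    · rw [← hι, ← Category.assoc P.ι, ← Category.assoc g.left]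
      have : P.ι ≫ pullback.lift (𝟙 _) (P.ρ ≫ biprod.inl) (by simp [strict]) =
        compι P (strict g) + g.left ≫ pullback.lift 0 (strict g).ι (by simp) := by
        apply pullback.hom_ext
        · simp
        · apply biprod.hom_ext <;> simp [strict]
      rw [this, Preadditive.add_comp, h0, zero_add]
    · rw [Category.assoc, hσ]; simp
    · rw [Category.assoc, hρ]; simp [strict]
  · rintro ⟨t, hκ, hι, hσ, hρ⟩
    let u : pullback P.ρ (strict g).σ ⟶ Y.right ⊞ Z.left := pullback.snd _ _
    have hu : u ≫ biprod.fst = pullback.fst _ _ ≫ P.ρ := pullback.condition.symm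
    apply comp_equiv (pullback.fst _ _ ≫ t + u ≫ biprod.snd ≫ R.ι)
    · simp [u, hι, strict]
    · simp [u, hκ]
    · simp [u, strict]
    · simp [hσ]
    · have : pullback.snd _ _ ≫ (strict g).ρ = u ≫ (biprod.fst ≫ g.right + biprod.snd ≫ Z.hom) := by
        simp [u, strict, biprod.desc_eq]
      rw [this, Preadditive.comp_add, ← Category.assoc u biprod.fst, hu]
      simp [hρ]

lemma strict_comp_iff {f : X ⟶ Y} {P : Butterfly Y Z} {R : Butterfly X Z} :
    (strict f).comp P ≈ R ↔ ∃ t : R.E ⟶ P.E, R.κ ≫ t = f.left ≫ P.κ ∧ R.ι ≫ t = P.ι ∧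
      t ≫ P.σ = R.σ ≫ f.right ∧ t ≫ P.ρ = R.ρ := by
  constructor
  · rintro h
    obtain ⟨e, he⟩ := Setoid.symm h
    let u : pullback (strict f).ρ P.σ ⟶ X.right ⊞ Y.left := pullback.fst _ _
    have hu : u ≫ biprod.desc f.right Y.hom = pullback.snd _ _ ≫ P.σ := pullback.condition
    let s : pullback (strict f).ρ P.σ ⟶ P.E := pullback.snd _ _ - u ≫ biprod.snd ≫ P.κ
    have hs : compι (strict f) P ≫ s = 0 := by simp [s, u, strict]
    refine ⟨e.hom ≫ cokernel.desc _ s hs, ?_, ?_, ?_, ?_⟩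
    · rw [← Category.assoc, he.κ]
      simp [comp, s, u, strict]
    · rw [← Category.assoc, he.ι]
      simp [comp, s, u]
    · rw [← he.σ, Category.assoc, Category.assoc]
      congr 1
      ext
      simp only [cokernel.π_desc_assoc, comp, s, Preadditive.sub_comp, Category.assoc, κ_σ]
      rw [← hu]
      simp [biprod.desc_eq, u, strict]
    · rw [← he.ρ, Category.assoc]
      congr 1
      ext
      simp [comp, s]
  · rintro ⟨t, hκ, hι, hσ, hρ⟩
    apply Setoid.symm
    apply equiv_of_isHom
      (φ := pullback.lift (R.σ ≫ biprod.inl) t (by simp [strict, hσ]) ≫ cokernel.π _)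
    constructor
    · have : R.κ ≫ pullback.lift (R.σ ≫ biprod.inl) t (by simp [strict, hσ]) =
          pullback.lift (strict f).κ 0 (by simp) + f.left ≫ compι (strict f) P := by
        apply pullback.hom_ext
        · apply biprod.hom_ext <;> simp [strict]
        · simp [hκ]
      rw [← Category.assoc, this]
      simp [comp]
    · simp only [comp]
      rw [← Category.assoc]
      congr 1
      apply pullback.hom_ext <;> simp [hι]
    · simp [comp, strict]
    · simp [comp, hρ]

lemma strict_comp_strict (f : X ⟶ Y) (g : Y ⟶ Z) :
    (strict f).comp (strict g) ≈ strict (f ≫ g) := by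
  rw [comp_strict_iff]
  refine ⟨biprod.map (𝟙 _) g.left, ?_, ?_, ?_, ?_⟩
  · simp only [strict]
    apply biprod.hom_ext <;> simp
  · simp [strict]
  · simp [strict]
  · simp only [strict]
    apply biprod.hom_ext' <;> simp

lemma comp_id (P : Butterfly X Y) : P.comp (strict (𝟙 Y)) ≈ P := by
  rw [comp_strict_iff]
  exact ⟨𝟙 _, by simp⟩

lemma id_comp (P : Butterfly X Y) : (strict (𝟙 X)).comp P ≈ P := by
  rw [strict_comp_iff]
  exact ⟨𝟙 _, by simp⟩

lemma comp_zero (P : Butterfly X Y) (Z : Arrow A) :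
    P.comp (strict (Arrow.homMk 0 0 : Y ⟶ Z)) ≈ strict (Arrow.homMk 0 0) := by
  rw [comp_strict_iff]
  refine ⟨P.σ ≫ biprod.inl, ?_, ?_, ?_, ?_⟩
  · simp only [strict]
    apply biprod.hom_ext <;> simp
  · simp
  · simp [strict]
  · simp [strict]

lemma zero_comp (X : Arrow A) (P : Butterfly Y Z) :
    (strict (Arrow.homMk 0 0 : X ⟶ Y)).comp P ≈ strict (Arrow.homMk 0 0) := by
  rw [strict_comp_iff]
  refine ⟨biprod.snd ≫ P.ι, ?_, ?_, ?_, ?_⟩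
  · simp [strict]
  · simp [strict]
  · simp [strict]
  · simp only [strict]
    apply biprod.hom_ext' <;> simp

end Butterfly
/-- A torsion pair (torsion theory) `(T, F)` in an abelian category. -/
structure TorsionPair (A : Type u) [Category.{v} A] [Abelian A] where
  T : ObjectProperty A
  F : ObjectProperty A
  T_iso : ∀ {X Y : A}, (X ≅ Y) → T X → T Y
  F_iso : ∀ {X Y : A}, (X ≅ Y) → F X → F Y
  hom_eq_zero : ∀ {X Y : A}, T X → F Y → ∀ f : X ⟶ Y, f = 0
  exists_seq : ∀ X : A, ∃ (M N : A) (i : M ⟶ X) (p : X ⟶ N) (w : i ≫ p = 0),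
    (ShortComplex.mk i p w).ShortExact ∧ T M ∧ F N

namespace TorsionPair

variable (t : TorsionPair A)

lemma F_of_hom {X : A} (h : ∀ {M : A}, t.T M → ∀ f : M ⟶ X, f = 0) : t.F X := by
  obtain ⟨M, N, i, p, w, hS, hM, hN⟩ := t.exists_seq X
  have := hS.mono_f
  have := hS.epi_g
  have hp : Mono p := hS.exact.mono_g (h hM i)
  have : Epi p := hS.epi_g
  have : IsIso p := isIso_of_mono_of_epi p
  exact t.F_iso (asIso p).symm hN

lemma T_of_hom {X : A} (h : ∀ {N : A}, t.F N → ∀ f : X ⟶ N, f = 0) : t.T X := by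
  obtain ⟨M, N, i, p, w, hS, hM, hN⟩ := t.exists_seq X
  have hi : Epi i := hS.exact.epi_f (h hN p)
  have : Mono i := hS.mono_f
  have : IsIso i := isIso_of_mono_of_epi i
  exact t.T_iso (asIso i) hM

lemma F_of_mono {X Y : A} (m : X ⟶ Y) [Mono m] (hY : t.F Y) : t.F X :=
  t.F_of_hom fun hM f => by
    rw [← cancel_mono m, zero_comp]
    exact t.hom_eq_zero hM hY _

lemma T_of_epi {X Y : A} (p : X ⟶ Y) [Epi p] (hX : t.T X) : t.T Y :=
  t.T_of_hom fun hN f => by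
    rw [← cancel_epi p, comp_zero]
    exact t.hom_eq_zero hX hN _

lemma F_kernel_of_comp {X Y Z : A} (f : X ⟶ Y) (g : Y ⟶ Z) (h : X ⟶ Z) (e : f ≫ g = h)
    (hF : t.F (kernel h)) : t.F (kernel f) := by
  have w : kernel.ι f ≫ h = 0 := by rw [← e, ← Category.assoc, kernel.condition, zero_comp]
  have : Mono (kernel.lift h (kernel.ι f) w) := mono_of_mono_fac (kernel.lift_ι _ _ w)
  exact t.F_of_mono (kernel.lift h (kernel.ι f) w) hF

lemma T_cokernel_of_comp {X Y Z : A} (f : X ⟶ Y) (g : Y ⟶ Z) (h : X ⟶ Z) (e : f ≫ g = h)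
    (hT : t.T (cokernel h)) : t.T (cokernel g) := by
  have w : h ≫ cokernel.π g = 0 := by rw [← e, Category.assoc, cokernel.condition, comp_zero]
  have : Epi (cokernel.desc h (cokernel.π g) w) := epi_of_epi_fac (cokernel.π_desc _ _ w)
  exact t.T_of_epi (cokernel.desc h (cokernel.π g) w) hT

/-- For a complex `X ⟶ E ⟶ Y` with torsion part `M` of the middle cohomology, there is a
subobject `S` of `E` with `S / im κ ≅ M`. -/
lemma exists_factor {X E Y : A} (κ : X ⟶ E) (ρ : E ⟶ Y) (w : κ ≫ ρ = 0) :
    ∃ (S : A) (a : S ⟶ E) (k : X ⟶ S) (_ : Mono a) (ha : a ≫ ρ = 0), k ≫ a = κ ∧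
      t.T (cokernel k) ∧ t.F (kernel (cokernel.desc a ρ ha)) := by
  let q := cokernel.π (kernel.lift ρ κ w)
  obtain ⟨M, N, i, p, wip, hS, hM, hN⟩ := t.exists_seq (cokernel (kernel.lift ρ κ w))
  have hi : Mono i := hS.mono_f
  have hp : Epi p := hS.epi_g
  have hk0 : kernel.lift ρ κ w ≫ q ≫ p = 0 := by
    rw [← Category.assoc, cokernel.condition, zero_comp]
  refine ⟨kernel (q ≫ p), kernel.ι (q ≫ p) ≫ kernel.ι ρ, kernel.lift _ _ hk0, inferInstance,
    by simp, by simp, ?_, ?_⟩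
  · -- `S ⟶ M` is an epimorphism whose kernel is the image of `k`
    have h0 : (kernel.ι (q ≫ p) ≫ q) ≫ p = 0 := by
      rw [Category.assoc, kernel.condition]
    obtain ⟨f, hf⟩ : ∃ f : kernel (q ≫ p) ⟶ M, f ≫ i = kernel.ι (q ≫ p) ≫ q :=
      ⟨hS.exact.lift _ h0, hS.exact.lift_f _ h0⟩
    have hfe : Epi f := by
      rw [epi_iff_surjective_up_to_refinements]
      intro T x
      obtain ⟨T', π, hπ, y, hy⟩ := surjective_up_to_refinements_of_epi q (x ≫ i)
      refine ⟨T', π, hπ, kernel.lift _ y ?_, ?_⟩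
      · rw [← Category.assoc, ← hy]; simp [wip]
      · rw [← cancel_mono i, Category.assoc, Category.assoc]
        refine hy.trans ?_
        rw [hf, ← Category.assoc, kernel.lift_ι]
    have hker : kernel.ι f ≫ cokernel.π (kernel.lift _ _ hk0) = 0 := by
      have h1 : (kernel.ι f ≫ kernel.ι (q ≫ p)) ≫ q = 0 := by
        rw [Category.assoc, ← hf, ← Category.assoc, kernel.condition, zero_comp]
      obtain ⟨T', π, hπ, y, hy⟩ :=
        (CokernelCofork.IsColimit.comp_π_eq_zero_iff_up_to_refinements
          (cokernelIsCokernel (kernel.lift ρ κ w)) _).1 h1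
      rw [← cancel_epi π, comp_zero]
      have : π ≫ kernel.ι f = y ≫ kernel.lift _ _ hk0 := by
        rw [← cancel_mono (kernel.ι (q ≫ p))]
        simpa using hy
      rw [← Category.assoc, this, Category.assoc, cokernel.condition, comp_zero]
    have h2 := Abelian.comp_epiDesc f _ hker
    have : Epi (Abelian.epiDesc f _ hker) := by
      have : Epi (f ≫ Abelian.epiDesc f _ hker) := by rw [h2]; infer_instance
      exact epi_of_epi f _
    exact t.T_of_epi (Abelian.epiDesc f _ hker) hM
  · set a := kernel.ι (q ≫ p) ≫ kernel.ι ρ with ha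
    have haρ : a ≫ ρ = 0 := by simp [ha]
    obtain ⟨e, he⟩ : ∃ e : kernel ρ ⟶ kernel (cokernel.desc a ρ haρ),
        e ≫ kernel.ι _ = kernel.ι ρ ≫ cokernel.π a :=
      ⟨kernel.lift _ (kernel.ι ρ ≫ cokernel.π a) (by simp), by simp⟩
    have hee : Epi e := by
      rw [epi_iff_surjective_up_to_refinements]
      intro T x
      obtain ⟨T', π, hπ, y, hy⟩ := surjective_up_to_refinements_of_epi (cokernel.π a)
        (x ≫ kernel.ι _)
      refine ⟨T', π, hπ, kernel.lift _ y ?_, ?_⟩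
      · have := hy =≫ cokernel.desc a ρ haρ
        simpa using this.symm
      · rw [← cancel_mono (kernel.ι _), Category.assoc, Category.assoc]
        refine hy.trans ?_
        rw [he, ← Category.assoc, kernel.lift_ι]
    have hker : kernel.ι e ≫ q ≫ p = 0 := by
      have h1 : (kernel.ι e ≫ kernel.ι ρ) ≫ cokernel.π a = 0 := by
        rw [Category.assoc, ← he, ← Category.assoc, kernel.condition, zero_comp]
      have h2 := Abelian.monoLift_comp a _ h1
      have h3 : kernel.ι e = Abelian.monoLift a _ h1 ≫ kernel.ι (q ≫ p) := by
        rw [← cancel_mono (kernel.ι ρ), Category.assoc, ← ha, h2]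
      rw [h3, Category.assoc, kernel.condition, comp_zero]
    have hm := Abelian.comp_epiDesc e _ hker
    have : Mono (Abelian.epiDesc e _ hker) := by
      rw [Preadditive.mono_iff_cancel_zero]
      intro T x hx
      obtain ⟨T', π, hπ, y, hy⟩ := surjective_up_to_refinements_of_epi e x
      have h1 : y ≫ q ≫ p = 0 := by
        rw [← hm, ← Category.assoc, ← hy, Category.assoc, hx, comp_zero]
      have h2 : y ≫ e = 0 := by
        rw [← cancel_mono (kernel.ι _), Category.assoc, he, zero_comp,
          ← kernel.lift_ι (q ≫ p) y h1, Category.assoc, ← Category.assoc (kernel.ι (q ≫ p)), ← ha,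
          cokernel.condition, comp_zero]
      rw [← cancel_epi π, hy, h2, comp_zero]
    exact t.F_of_mono (Abelian.epiDesc e _ hker) hN

end TorsionPair

/-- The objects of the tilted category `B`: two-term complexes `d : X⁻¹ ⟶ X⁰` with
`ker d` in `F` and `coker d` in `T`. -/
structure Tilt (t : TorsionPair A) where
  arrow : Arrow A
  ker_mem : t.F (kernel arrow.hom)
  coker_mem : t.T (cokernel arrow.hom)

namespace Tilt

variable {t : TorsionPair A} {X Y Z W : Tilt t}

/-- Morphisms of `B` are isomorphism classes of butterflies. -/
instance : Category.{max u v} (Tilt t) where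
  Hom X Y := Quotient (Butterfly.setoid X.arrow Y.arrow)
  id X := ⟦Butterfly.strict (𝟙 X.arrow)⟧
  comp := Quotient.map₂ Butterfly.comp fun _ _ h _ _ h' => Butterfly.comp_congr h h'
  id_comp := by rintro _ _ ⟨P⟩; exact Quotient.sound (Butterfly.id_comp P)
  comp_id := by rintro _ _ ⟨P⟩; exact Quotient.sound (Butterfly.comp_id P)
  assoc := by
    rintro _ _ _ _ ⟨P⟩ ⟨Q⟩ ⟨R⟩
    exact Quotient.sound (Butterfly.comp_assoc P Q R)

/-- The class of a butterfly. -/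
def toHom (P : Butterfly X.arrow Y.arrow) : X ⟶ Y := Quotient.mk _ P

/-- A chosen butterfly representing a morphism of `B`. -/
def out (f : X ⟶ Y) : Butterfly X.arrow Y.arrow := Quotient.out f

/-- The strict morphism given by a morphism of two-term complexes. -/
def strictHom (f : X.arrow ⟶ Y.arrow) : X ⟶ Y := toHom (Butterfly.strict f)

@[simp] lemma toHom_out (f : X ⟶ Y) : toHom (out f) = f := Quotient.out_eq f

lemma toHom_eq_iff {P Q : Butterfly X.arrow Y.arrow} : toHom P = toHom Q ↔ P ≈ Q :=
  Quotient.eq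

lemma toHom_comp (P : Butterfly X.arrow Y.arrow) (Q : Butterfly Y.arrow Z.arrow) :
    toHom P ≫ toHom Q = toHom (P.comp Q) := rfl

lemma exists_rep (f : X ⟶ Y) : ∃ P, toHom P = f := ⟨out f, toHom_out f⟩

lemma strictHom_id (X : Tilt t) : strictHom (𝟙 X.arrow) = 𝟙 X := rfl

lemma strictHom_comp (f : X.arrow ⟶ Y.arrow) (g : Y.arrow ⟶ Z.arrow) :
    (strictHom f : X ⟶ Y) ≫ (strictHom g : Y ⟶ Z) = strictHom (f ≫ g) :=
  toHom_eq_iff.2 (Butterfly.strict_comp_strict f g)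

lemma comp_strictHom_eq {P : Butterfly X.arrow Y.arrow} {g : Y.arrow ⟶ Z.arrow}
    {R : Butterfly X.arrow Z.arrow} :
    toHom P ≫ strictHom g = toHom R ↔ ∃ t : P.E ⟶ R.E, P.κ ≫ t = R.κ ∧
      P.ι ≫ t = g.left ≫ R.ι ∧ t ≫ R.σ = P.σ ∧ t ≫ R.ρ = P.ρ ≫ g.right := by
  unfold strictHom
  rw [toHom_comp, toHom_eq_iff, Butterfly.comp_strict_iff]

lemma strictHom_comp_eq {f : X.arrow ⟶ Y.arrow} {P : Butterfly Y.arrow Z.arrow}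
    {R : Butterfly X.arrow Z.arrow} :
    strictHom f ≫ toHom P = toHom R ↔ ∃ t : R.E ⟶ P.E, R.κ ≫ t = f.left ≫ P.κ ∧
      R.ι ≫ t = P.ι ∧ t ≫ P.σ = R.σ ≫ f.right ∧ t ≫ P.ρ = R.ρ := by
  unfold strictHom
  rw [toHom_comp, toHom_eq_iff, Butterfly.strict_comp_iff]

/-- The zero butterfly. -/
abbrev zeroB (X Y : Tilt t) : Butterfly X.arrow Y.arrow := Butterfly.strict (Arrow.homMk 0 0)

instance (X Y : Tilt t) : Zero (X ⟶ Y) := ⟨toHom (zeroB X Y)⟩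

lemma zero_def (X Y : Tilt t) : (0 : X ⟶ Y) = toHom (zeroB X Y) := rfl

/-- The zero morphisms of `B`. -/
abbrev hasZeroMorphisms (t : TorsionPair A) : HasZeroMorphisms (Tilt t) where
  comp_zero := by
    intro X Y f Z
    obtain ⟨P, rfl⟩ := exists_rep f
    exact toHom_eq_iff.2 (Butterfly.comp_zero P Z.arrow)
  zero_comp := by
    intro X Y Z f
    obtain ⟨P, rfl⟩ := exists_rep f
    exact toHom_eq_iff.2 (Butterfly.zero_comp X.arrow P)

lemma factor_coker (P : Butterfly X.arrow Y.arrow) {V : A} (h : P.E ⟶ V) (hκ : P.κ ≫ h = 0)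
    (hι : P.ι ≫ h = 0) :
    ∃ g : cokernel X.arrow.hom ⟶ V, P.σ ≫ cokernel.π X.arrow.hom ≫ g = h := by
  obtain ⟨g, hg⟩ := P.exists_desc h hι
  have : X.arrow.hom ≫ g = 0 := by rw [← P.κ_σ, Category.assoc, hg, hκ]
  exact ⟨cokernel.desc _ g this, by rw [cokernel.π_desc, hg]⟩

lemma factor_ker (P : Butterfly X.arrow Y.arrow) {V : A} (h : V ⟶ P.E) (hσ : h ≫ P.σ = 0)
    (hρ : h ≫ P.ρ = 0) :
    ∃ g : V ⟶ kernel Y.arrow.hom, g ≫ kernel.ι Y.arrow.hom ≫ P.ι = h := by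
  obtain ⟨g, hg⟩ := P.exists_lift h hσ
  have : g ≫ Y.arrow.hom = 0 := by rw [← P.ι_ρ, ← Category.assoc, hg, hρ]
  exact ⟨kernel.lift _ g this, by rw [← Category.assoc, kernel.lift_ι, hg]⟩

lemma zero_of_torsion (P : Butterfly X.arrow Y.arrow) {V : A} (hV : t.T V) (h : V ⟶ P.E)
    (hσ : h ≫ P.σ = 0) (hρ : h ≫ P.ρ = 0) : h = 0 := by
  obtain ⟨g, rfl⟩ := factor_ker P h hσ hρ
  rw [t.hom_eq_zero hV Y.ker_mem g, zero_comp]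

lemma zero_of_free (P : Butterfly X.arrow Y.arrow) {V : A} (hV : t.F V) (h : P.E ⟶ V)
    (hκ : P.κ ≫ h = 0) (hι : P.ι ≫ h = 0) : h = 0 := by
  obtain ⟨g, rfl⟩ := factor_coker P h hκ hι
  rw [t.hom_eq_zero X.coker_mem hV g, comp_zero, comp_zero]

/-- A map between the centres of two butterflies that is killed by all four arrows vanishes. -/
lemma vanish (P : Butterfly X.arrow Y.arrow) (Q : Butterfly Z.arrow W.arrow) (h : P.E ⟶ Q.E)
    (hκ : P.κ ≫ h = 0) (hι : P.ι ≫ h = 0) (hσ : h ≫ Q.σ = 0) (hρ : h ≫ Q.ρ = 0) : h = 0 := by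
  obtain ⟨g, rfl⟩ := factor_coker P h hκ hι
  have : g = 0 := by
    apply zero_of_torsion Q X.coker_mem
    · rw [← cancel_epi (cokernel.π X.arrow.hom), ← cancel_epi P.σ]
      simpa using hσ
    · rw [← cancel_epi (cokernel.π X.arrow.hom), ← cancel_epi P.σ]
      simpa using hρ
  rw [this, comp_zero, comp_zero]

/-- `δ` is a link from `P` to `Q`. -/
structure IsLink (P : Butterfly X.arrow Y.arrow) (Q : Butterfly Y.arrow Z.arrow)
    (δ : P.E ⟶ Q.E) : Prop where
  κ_δ : P.κ ≫ δ = 0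
  ι_δ : P.ι ≫ δ = Q.κ
  δ_σ : δ ≫ Q.σ = P.ρ
  δ_ρ : δ ≫ Q.ρ = 0

lemma exists_link {P : Butterfly X.arrow Y.arrow} {Q : Butterfly Y.arrow Z.arrow}
    (h : toHom P ≫ toHom Q = 0) : ∃ δ, IsLink P Q δ := by
  rw [toHom_comp, zero_def, toHom_eq_iff] at h
  obtain ⟨s, h0, hκ, hι, hσ, hρ⟩ := Butterfly.exists_of_comp_equiv h
  obtain ⟨r, hr⟩ : ∃ r : pullback P.ρ Q.σ ⟶ Z.arrow.left, r = s ≫ biprod.snd := ⟨_, rfl⟩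
  have h0' : Butterfly.compι P Q ≫ r = 0 := by rw [hr, ← Category.assoc, h0, zero_comp]
  have hκ' : pullback.lift P.κ 0 (by simp) ≫ r = 0 := by
    rw [hr, ← Category.assoc, hκ]; simp
  have hι' : pullback.lift 0 Q.ι (by simp) ≫ r = 𝟙 _ := by
    rw [hr, ← Category.assoc, hι]; simp
  have hρ' : r ≫ Z.arrow.hom = pullback.snd _ _ ≫ Q.ρ := by
    rw [← hρ, hr]; simp [biprod.desc_eq]
  let m : pullback P.ρ Q.σ ⟶ Q.E := pullback.snd _ _ - r ≫ Q.ι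
  have hker : kernel.ι (pullback.fst P.ρ Q.σ) ≫ m = 0 := by
    obtain ⟨z, hz⟩ := Q.exists_lift (kernel.ι (pullback.fst P.ρ Q.σ) ≫ pullback.snd _ _) (by
      rw [Category.assoc, ← pullback.condition, ← Category.assoc, kernel.condition, zero_comp])
    have : kernel.ι (pullback.fst P.ρ Q.σ) = z ≫ pullback.lift 0 Q.ι (by simp) := by
      apply pullback.hom_ext
      · simp
      · simp [hz]
    simp only [m]
    rw [this, Category.assoc, Preadditive.comp_sub, ← Category.assoc _ r, hι']
    simp
  have hδ := Abelian.comp_epiDesc (pullback.fst P.ρ Q.σ) m hker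
  set δ := Abelian.epiDesc (pullback.fst P.ρ Q.σ) m hker
  refine ⟨δ, ?_, ?_, ?_, ?_⟩
  · have h1 : P.κ = pullback.lift P.κ 0 (by simp) ≫ pullback.fst P.ρ Q.σ := by simp
    rw [h1, Category.assoc, hδ]
    simp only [m, Preadditive.comp_sub]
    rw [← Category.assoc _ r, hκ']; simp
  · have h1 : P.ι = Butterfly.compι P Q ≫ pullback.fst P.ρ Q.σ := by simp
    rw [h1, Category.assoc, hδ]
    simp only [m, Preadditive.comp_sub]
    rw [← Category.assoc _ r, h0']; simp
  · rw [← cancel_epi (pullback.fst P.ρ Q.σ), ← Category.assoc, hδ]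
    simp [m, pullback.condition]
  · rw [← cancel_epi (pullback.fst P.ρ Q.σ), ← Category.assoc, hδ]
    simp [m, hρ']

lemma IsLink.unique {P : Butterfly X.arrow Y.arrow} {Q : Butterfly Y.arrow Z.arrow}
    {δ δ' : P.E ⟶ Q.E} (h : IsLink P Q δ) (h' : IsLink P Q δ') : δ = δ' := by
  rw [← sub_eq_zero]
  apply vanish P Q
  · simp [h.κ_δ, h'.κ_δ]
  · simp [h.ι_δ, h'.ι_δ]
  · simp [h.δ_σ, h'.δ_σ]
  · simp [h.δ_ρ, h'.δ_ρ]

lemma IsLink.comp {P : Butterfly X.arrow Y.arrow} {Q : Butterfly Y.arrow Z.arrow}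
    {R : Butterfly Z.arrow W.arrow}
    {δ : P.E ⟶ Q.E} {δ' : Q.E ⟶ R.E} (h : IsLink P Q δ) (h' : IsLink Q R δ') : δ ≫ δ' = 0 := by
  apply vanish P R
  · rw [← Category.assoc, h.κ_δ, zero_comp]
  · rw [← Category.assoc, h.ι_δ, h'.κ_δ]
  · rw [Category.assoc, h'.δ_σ, h.δ_ρ]
  · rw [Category.assoc, h'.δ_ρ, comp_zero]

section Kernels

variable (P : Butterfly X.arrow Y.arrow)

/-- The subobject `S` of the centre of a butterfly that lies between `im κ` and `ker ρ`, with
`S / im κ` torsion and `ker ρ / S` torsion-free. -/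
structure Factor where
  S : A
  a : S ⟶ P.E
  k : X.arrow.left ⟶ S
  mono : Mono a
  a_ρ : a ≫ P.ρ = 0
  k_a : k ≫ a = P.κ
  coker_mem : t.T (cokernel k)
  ker_mem : t.F (kernel (cokernel.desc a P.ρ a_ρ))

lemma Factor.nonempty : Nonempty (Factor P) := by
  obtain ⟨S, a, k, h1, h2, h3, h4, h5⟩ := t.exists_factor P.κ P.ρ P.κ_ρ
  exact ⟨⟨S, a, k, h1, h2, h3, h4, h5⟩⟩

variable {P} (τ : Factor P)

namespace Factor

attribute [instance] Factor.mono
attribute [simp] a_ρ k_a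

/-- The map `E / S ⟶ Y⁰` induced by `ρ`. -/
abbrev b : cokernel τ.a ⟶ Y.arrow.right := cokernel.desc τ.a P.ρ τ.a_ρ

lemma κ_π : P.κ ≫ cokernel.π τ.a = 0 := by
  rw [← τ.k_a, Category.assoc, cokernel.condition, comp_zero]

@[simp] lemma k_a_σ : τ.k ≫ τ.a ≫ P.σ = X.arrow.hom := by
  rw [← Category.assoc, τ.k_a, P.κ_σ]

lemma ι_π_b : (P.ι ≫ cokernel.π τ.a) ≫ τ.b = Y.arrow.hom := by simp

/-- The kernel `[X⁻¹ ⟶ S]`. -/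
abbrev ker : Tilt t where
  arrow := Arrow.mk τ.k
  ker_mem := t.F_kernel_of_comp _ _ _ τ.k_a_σ X.ker_mem
  coker_mem := τ.coker_mem

/-- The cokernel `[E / S ⟶ Y⁰]`. -/
abbrev coker : Tilt t where
  arrow := Arrow.mk τ.b
  ker_mem := τ.ker_mem
  coker_mem := t.T_cokernel_of_comp _ _ _ τ.ι_π_b Y.coker_mem

/-- The image `[Y⁻¹ ⟶ E / S]`. -/
abbrev im : Tilt t where
  arrow := Arrow.mk (P.ι ≫ cokernel.π τ.a)
  ker_mem := t.F_kernel_of_comp _ _ _ τ.ι_π_b Y.ker_mem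
  coker_mem := by
    obtain ⟨g, hg⟩ := factor_coker P (cokernel.π τ.a ≫ cokernel.π (P.ι ≫ cokernel.π τ.a))
      (by rw [← Category.assoc, τ.κ_π, zero_comp])
      (by rw [← Category.assoc, cokernel.condition])
    have : Epi g := by
      rw [← Category.assoc] at hg
      exact epi_of_epi_fac hg
    exact t.T_of_epi g X.coker_mem

/-- The coimage `[S ⟶ X⁰]`. -/
abbrev coim : Tilt t where
  arrow := Arrow.mk (τ.a ≫ P.σ)
  ker_mem := by
    obtain ⟨g, hg⟩ := factor_ker P (kernel.ι (τ.a ≫ P.σ) ≫ τ.a)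
      (by rw [Category.assoc, kernel.condition])
      (by rw [Category.assoc, τ.a_ρ, comp_zero])
    have : Mono g := mono_of_mono_fac hg
    exact t.F_of_mono g Y.ker_mem
  coker_mem := t.T_cokernel_of_comp _ _ _ τ.k_a_σ X.coker_mem

/-- The map `ker ⟶ X`. -/
abbrev incl : τ.ker.arrow ⟶ X.arrow :=
  Arrow.homMk (𝟙 X.arrow.left) (τ.a ≫ P.σ) ((Category.id_comp _).trans τ.k_a_σ.symm)

/-- The map `Y ⟶ coker`. -/
abbrev proj : Y.arrow ⟶ τ.coker.arrow :=
  Arrow.homMk (P.ι ≫ cokernel.π τ.a) (𝟙 Y.arrow.right) (τ.ι_π_b.trans (Category.comp_id _).symm)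

/-- The map `im ⟶ Y`. -/
abbrev imι : τ.im.arrow ⟶ Y.arrow :=
  Arrow.homMk (𝟙 Y.arrow.left) τ.b ((Category.id_comp _).trans τ.ι_π_b.symm)

/-- The map `X ⟶ coim`. -/
abbrev coimπ : X.arrow ⟶ τ.coim.arrow :=
  Arrow.homMk τ.k (𝟙 X.arrow.right) (τ.k_a_σ.trans (Category.comp_id _).symm)

lemma incl_comp : strictHom (X := τ.ker) (Y := X) τ.incl ≫ toHom P = 0 := by
  rw [zero_def, strictHom_comp_eq]
  refine ⟨biprod.desc τ.a P.ι, ?_, ?_, ?_, ?_⟩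
  · simp [biprod.lift_desc]
  · simp
  · apply biprod.hom_ext' <;> simp
  · apply biprod.hom_ext' <;> simp

lemma comp_proj : toHom P ≫ strictHom (X := Y) (Y := τ.coker) τ.proj = 0 := by
  rw [zero_def, comp_strictHom_eq]
  refine ⟨biprod.lift P.σ (cokernel.π τ.a), ?_, ?_, ?_, ?_⟩
  · apply biprod.hom_ext <;> simp [τ.κ_π]
  · apply biprod.hom_ext <;> simp
  · simp
  · simp [biprod.lift_desc]

lemma imι_proj : strictHom (X := τ.im) (Y := Y) τ.imι ≫
    strictHom (X := Y) (Y := τ.coker) τ.proj = 0 := by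
  rw [zero_def, show strictHom (X := Y) (Y := τ.coker) τ.proj = toHom _ from rfl,
    strictHom_comp_eq]
  refine ⟨biprod.desc (biprod.lift τ.b (-𝟙 _)) biprod.inr, ?_, ?_, ?_, ?_⟩
  · apply biprod.hom_ext <;> simp [biprod.lift_desc]
  · simp
  · apply biprod.hom_ext' <;> simp
  · apply biprod.hom_ext' <;> simp [biprod.lift_desc]

lemma incl_coimπ : strictHom (X := τ.ker) (Y := X) τ.incl ≫
    strictHom (X := X) (Y := τ.coim) τ.coimπ = 0 := by
  rw [zero_def, show strictHom (X := τ.ker) (Y := X) τ.incl = toHom _ from rfl,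
    comp_strictHom_eq]
  refine ⟨biprod.desc (biprod.lift (𝟙 _) (𝟙 _)) (τ.k ≫ biprod.inr), ?_, ?_, ?_, ?_⟩
  · apply biprod.hom_ext <;> simp [biprod.lift_desc]
  · simp
  · apply biprod.hom_ext' <;> simp
  · apply biprod.hom_ext'
    · simp [biprod.lift_desc]
    · simp


/-- A map to `ker` is determined by its composition with `incl`. -/
lemma incl_cancel {u v : Z ⟶ τ.ker}
    (h : u ≫ strictHom (X := τ.ker) (Y := X) τ.incl =
      v ≫ strictHom (X := τ.ker) (Y := X) τ.incl) : u = v := by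
  obtain ⟨F, rfl⟩ := exists_rep u
  obtain ⟨G, rfl⟩ := exists_rep v
  let R : Butterfly Z.arrow X.arrow :=
    { G with
      ρ := G.ρ ≫ τ.a ≫ P.σ
      ι_ρ := by rw [← Category.assoc, G.ι_ρ]; exact τ.k_a_σ
      κ_ρ := by simp }
  have hR : toHom G ≫ strictHom (X := τ.ker) (Y := X) τ.incl = toHom R :=
    comp_strictHom_eq.2 ⟨𝟙 _, by simp [R], by simp [R], by simp [R], by simp [R]⟩
  rw [hR, comp_strictHom_eq] at h
  obtain ⟨s, h1, h2, h3, h4⟩ := h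
  have h1 : F.κ ≫ s = G.κ := h1
  have h2 : F.ι ≫ s = G.ι := h2.trans (Category.id_comp _)
  have h3 : s ≫ G.σ = F.σ := h3
  have h4 : s ≫ G.ρ ≫ τ.a ≫ P.σ = F.ρ ≫ τ.a ≫ P.σ := h4
  have h0 : (s ≫ G.ρ - F.ρ) ≫ τ.a = 0 := by
    apply vanish F P
    · rw [← Category.assoc, Preadditive.comp_sub, ← Category.assoc, h1]; simp
    · rw [← Category.assoc, Preadditive.comp_sub, ← Category.assoc, h2]; simp
    · simp [h4]
    · simp
  refine toHom_eq_iff.2 (Butterfly.equiv_of_isHom (φ := s) ⟨h1, h2, h3, ?_⟩)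
  rw [← sub_eq_zero, ← cancel_mono τ.a, h0, zero_comp]

lemma exists_lift {q : Z ⟶ X} (h : q ≫ toHom P = 0) :
    ∃ l : Z ⟶ τ.ker, l ≫ strictHom (X := τ.ker) (Y := X) τ.incl = q := by
  obtain ⟨F, rfl⟩ := exists_rep q
  obtain ⟨δ, hδ⟩ := exists_link h
  have h0 : δ ≫ cokernel.π τ.a = 0 := by
    have hb : (δ ≫ cokernel.π τ.a) ≫ τ.b = 0 := by simp [hδ.δ_ρ]
    have : kernel.lift τ.b _ hb = 0 := by
      apply zero_of_free F τ.ker_mem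
      · rw [← cancel_mono (kernel.ι _), Category.assoc, kernel.lift_ι, ← Category.assoc, hδ.κ_δ]
        simp
      · rw [← cancel_mono (kernel.ι _), Category.assoc, kernel.lift_ι, ← Category.assoc, hδ.ι_δ,
          τ.κ_π, zero_comp]
    rw [← kernel.lift_ι τ.b _ hb, this, zero_comp]
  have hl := Abelian.monoLift_comp τ.a δ h0
  let L : Butterfly Z.arrow τ.ker.arrow :=
    { E := F.E
      κ := F.κ
      ι := F.ι
      σ := F.σ
      ρ := Abelian.monoLift τ.a δ h0
      κ_σ := F.κ_σ
      ι_ρ := by rw [← cancel_mono τ.a, Category.assoc, hl, hδ.ι_δ]; exact τ.k_a.symm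
      κ_ρ := by rw [← cancel_mono τ.a, Category.assoc, hl, hδ.κ_δ, zero_comp]
      ι_σ := F.ι_σ
      shortExact := F.shortExact }
  refine ⟨toHom L, comp_strictHom_eq.2 ⟨𝟙 _, by simp [L], by simp [L], by simp [L], ?_⟩⟩
  rw [Category.id_comp]
  change _ = Abelian.monoLift τ.a δ h0 ≫ τ.a ≫ P.σ
  rw [← Category.assoc, hl, hδ.δ_σ]

/-- A map out of `coker` is determined by its composition with `proj`. -/
lemma proj_cancel {u v : τ.coker ⟶ Z}
    (h : strictHom (X := Y) (Y := τ.coker) τ.proj ≫ u =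
      strictHom (X := Y) (Y := τ.coker) τ.proj ≫ v) : u = v := by
  obtain ⟨F, rfl⟩ := exists_rep u
  obtain ⟨G, rfl⟩ := exists_rep v
  let R : Butterfly Y.arrow Z.arrow :=
    { G with
      κ := (P.ι ≫ cokernel.π τ.a) ≫ G.κ
      κ_σ := by rw [Category.assoc, G.κ_σ]; exact τ.ι_π_b
      κ_ρ := by simp }
  have hR : strictHom (X := Y) (Y := τ.coker) τ.proj ≫ toHom G = toHom R :=
    strictHom_comp_eq.2 ⟨𝟙 _, by simp [R], by simp [R], by simp [R], by simp [R]⟩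
  rw [hR, strictHom_comp_eq] at h
  obtain ⟨s, h1, h2, h3, h4⟩ := h
  have h1 : ((P.ι ≫ cokernel.π τ.a) ≫ G.κ) ≫ s = (P.ι ≫ cokernel.π τ.a) ≫ F.κ := h1
  have h2 : G.ι ≫ s = F.ι := h2
  have h3 : s ≫ F.σ = G.σ := h3.trans (Category.comp_id _)
  have h4 : s ≫ F.ρ = G.ρ := h4
  have h0 : cokernel.π τ.a ≫ (G.κ ≫ s - F.κ) = 0 := by
    apply vanish P F
    · rw [← Category.assoc, τ.κ_π, zero_comp]
    · simp only [Preadditive.comp_sub]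
      rw [sub_eq_zero]
      simpa using h1
    · simp [h3]
    · simp [h4]
  refine toHom_eq_iff.2 (Setoid.symm (Butterfly.equiv_of_isHom (φ := s) ⟨?_, h2, h3, h4⟩))
  rw [← sub_eq_zero, ← cancel_epi (cokernel.π τ.a), h0, comp_zero]

lemma exists_desc {q : Y ⟶ Z} (h : toHom P ≫ q = 0) :
    ∃ l : τ.coker ⟶ Z, strictHom (X := Y) (Y := τ.coker) τ.proj ≫ l = q := by
  obtain ⟨F, rfl⟩ := exists_rep q
  obtain ⟨δ, hδ⟩ := exists_link h
  have h0 : τ.a ≫ δ = 0 := by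
    have hk : τ.k ≫ τ.a ≫ δ = 0 := by rw [← Category.assoc, τ.k_a, hδ.κ_δ]
    have : cokernel.desc τ.k _ hk = 0 := by
      apply zero_of_torsion F τ.coker_mem
      · rw [← cancel_epi (cokernel.π _), ← Category.assoc, cokernel.π_desc, Category.assoc, hδ.δ_σ]
        simp
      · rw [← cancel_epi (cokernel.π _), ← Category.assoc, cokernel.π_desc, Category.assoc, hδ.δ_ρ]
        simp
    rw [← cokernel.π_desc τ.k _ hk, this, comp_zero]
  let L : Butterfly τ.coker.arrow Z.arrow :=
    { E := F.E
      κ := cokernel.desc τ.a δ h0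
      ι := F.ι
      σ := F.σ
      ρ := F.ρ
      κ_σ := by
        rw [← cancel_epi (cokernel.π τ.a), ← Category.assoc, cokernel.π_desc, hδ.δ_σ]
        exact (cokernel.π_desc _ _ _).symm
      ι_ρ := F.ι_ρ
      κ_ρ := by
        rw [← cancel_epi (cokernel.π τ.a), ← Category.assoc, cokernel.π_desc, hδ.δ_ρ, comp_zero]
      ι_σ := F.ι_σ
      shortExact := F.shortExact }
  refine ⟨toHom L, strictHom_comp_eq.2 ⟨𝟙 _, ?_, by simp [L], by simp [L], by simp [L]⟩⟩
  rw [Category.comp_id]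
  change F.κ = (P.ι ≫ cokernel.π τ.a) ≫ cokernel.desc τ.a δ h0
  rw [Category.assoc, cokernel.π_desc, hδ.ι_δ]

lemma imι_cancel {u v : Z ⟶ τ.im}
    (h : u ≫ strictHom (X := τ.im) (Y := Y) τ.imι =
      v ≫ strictHom (X := τ.im) (Y := Y) τ.imι) : u = v := by
  obtain ⟨F, rfl⟩ := exists_rep u
  obtain ⟨G, rfl⟩ := exists_rep v
  let R : Butterfly Z.arrow Y.arrow :=
    { G with
      ρ := G.ρ ≫ τ.b
      ι_ρ := by rw [← Category.assoc, G.ι_ρ]; exact τ.ι_π_b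
      κ_ρ := by simp }
  have hR : toHom G ≫ strictHom (X := τ.im) (Y := Y) τ.imι = toHom R :=
    comp_strictHom_eq.2 ⟨𝟙 _, by simp [R], by simp [R], by simp [R], by simp [R]⟩
  rw [hR, comp_strictHom_eq] at h
  obtain ⟨s, h1, h2, h3, h4⟩ := h
  have h1 : F.κ ≫ s = G.κ := h1
  have h2 : F.ι ≫ s = G.ι := h2.trans (Category.id_comp _)
  have h3 : s ≫ G.σ = F.σ := h3
  have h4 : s ≫ G.ρ ≫ τ.b = F.ρ ≫ τ.b := h4
  refine toHom_eq_iff.2 (Butterfly.equiv_of_isHom (φ := s) ⟨h1, h2, h3, ?_⟩)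
  have hb : (s ≫ G.ρ - F.ρ) ≫ τ.b = 0 := by
    rw [Preadditive.sub_comp, Category.assoc, h4, sub_self]
  have h0 : kernel.lift τ.b _ hb = 0 := by
    apply zero_of_free F τ.ker_mem
    · rw [← cancel_mono (kernel.ι _), Category.assoc, kernel.lift_ι, Preadditive.comp_sub,
        ← Category.assoc, h1]; simp
    · rw [← cancel_mono (kernel.ι _), Category.assoc, kernel.lift_ι, Preadditive.comp_sub,
        ← Category.assoc, h2]; simp
  rw [← sub_eq_zero, ← kernel.lift_ι τ.b _ hb, h0, zero_comp]

lemma exists_lift_im {q : Z ⟶ Y} (h : q ≫ strictHom (X := Y) (Y := τ.coker) τ.proj = 0) :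
    ∃ l : Z ⟶ τ.im, l ≫ strictHom (X := τ.im) (Y := Y) τ.imι = q := by
  obtain ⟨F, rfl⟩ := exists_rep q
  rw [zero_def, comp_strictHom_eq] at h
  obtain ⟨s, h1, h2, h3, h4⟩ := h
  have h1 : F.κ ≫ s = biprod.lift Z.arrow.hom (-0) := h1
  have h2 : F.ι ≫ s = (P.ι ≫ cokernel.π τ.a) ≫ biprod.inr := h2
  have h4 : s ≫ biprod.desc 0 τ.b = F.ρ := h4.trans (Category.comp_id _)
  let L : Butterfly Z.arrow τ.im.arrow :=
    { E := F.E
      κ := F.κ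
      ι := F.ι
      σ := F.σ
      ρ := s ≫ biprod.snd
      κ_σ := F.κ_σ
      ι_ρ := by rw [← Category.assoc, h2]; simp
      κ_ρ := by rw [← Category.assoc, h1]; simp
      ι_σ := F.ι_σ
      shortExact := F.shortExact }
  refine ⟨toHom L, comp_strictHom_eq.2 ⟨𝟙 _, by simp [L], by simp [L], by simp [L], ?_⟩⟩
  rw [Category.id_comp, ← h4]
  simp [L, biprod.desc_eq]

lemma coimπ_cancel {u v : τ.coim ⟶ Z}
    (h : strictHom (X := X) (Y := τ.coim) τ.coimπ ≫ u =
      strictHom (X := X) (Y := τ.coim) τ.coimπ ≫ v) : u = v := by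
  obtain ⟨F, rfl⟩ := exists_rep u
  obtain ⟨G, rfl⟩ := exists_rep v
  let R : Butterfly X.arrow Z.arrow :=
    { G with
      κ := τ.k ≫ G.κ
      κ_σ := by rw [Category.assoc, G.κ_σ]; exact τ.k_a_σ
      κ_ρ := by simp }
  have hR : strictHom (X := X) (Y := τ.coim) τ.coimπ ≫ toHom G = toHom R :=
    strictHom_comp_eq.2 ⟨𝟙 _, by simp [R], by simp [R], by simp [R], by simp [R]⟩
  rw [hR, strictHom_comp_eq] at h
  obtain ⟨s, h1, h2, h3, h4⟩ := h
  have h1 : (τ.k ≫ G.κ) ≫ s = τ.k ≫ F.κ := h1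
  have h2 : G.ι ≫ s = F.ι := h2
  have h3 : s ≫ F.σ = G.σ := h3.trans (Category.comp_id _)
  have h4 : s ≫ F.ρ = G.ρ := h4
  have hk : τ.k ≫ (G.κ ≫ s - F.κ) = 0 := by
    rw [Preadditive.comp_sub, ← Category.assoc, h1, sub_self]
  have h0 : cokernel.desc τ.k _ hk = 0 := by
    apply zero_of_torsion F τ.coker_mem
    · rw [← cancel_epi (cokernel.π _), ← Category.assoc, cokernel.π_desc]; simp [h3]
    · rw [← cancel_epi (cokernel.π _), ← Category.assoc, cokernel.π_desc]; simp [h4]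
  refine toHom_eq_iff.2 (Setoid.symm (Butterfly.equiv_of_isHom (φ := s) ⟨?_, h2, h3, h4⟩))
  rw [← sub_eq_zero, ← cokernel.π_desc τ.k _ hk, h0, comp_zero]

lemma exists_desc_coim {q : X ⟶ Z} (h : strictHom (X := τ.ker) (Y := X) τ.incl ≫ q = 0) :
    ∃ l : τ.coim ⟶ Z, strictHom (X := X) (Y := τ.coim) τ.coimπ ≫ l = q := by
  obtain ⟨F, rfl⟩ := exists_rep q
  rw [zero_def, strictHom_comp_eq] at h
  obtain ⟨s, h1, h2, h3, h4⟩ := h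
  have h1 : biprod.lift τ.k (-0) ≫ s = F.κ := h1.trans (Category.id_comp _)
  have h3 : s ≫ F.σ = biprod.fst ≫ τ.a ≫ P.σ := h3
  have h4 : s ≫ F.ρ = biprod.desc 0 Z.arrow.hom := h4
  let L : Butterfly τ.coim.arrow Z.arrow :=
    { E := F.E
      κ := biprod.inl ≫ s
      ι := F.ι
      σ := F.σ
      ρ := F.ρ
      κ_σ := by rw [Category.assoc, h3]; simp
      ι_ρ := F.ι_ρ
      κ_ρ := by rw [Category.assoc, h4]; simp
      ι_σ := F.ι_σ
      shortExact := F.shortExact }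
  refine ⟨toHom L, strictHom_comp_eq.2 ⟨𝟙 _, ?_, by simp [L], by simp [L], by simp [L]⟩⟩
  rw [Category.comp_id, ← h1]
  have : biprod.lift τ.k (-0) = τ.k ≫ (biprod.inl : _ ⟶ τ.S ⊞ Z.arrow.left) := by
    apply biprod.hom_ext <;> simp
  rw [this]
  simp [L]

end Factor

end Kernels

/-- A butterfly whose NW-SE sequence is short exact is an isomorphism. -/
lemma flip_comp (P : Butterfly X.arrow Y.arrow) (Q : Butterfly Y.arrow X.arrow) (e : P.E ≅ Q.E)
    (h1 : P.κ ≫ e.hom = Q.ι) (h2 : P.ι ≫ e.hom = Q.κ) (h3 : e.hom ≫ Q.σ = P.ρ)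
    (h4 : e.hom ≫ Q.ρ = P.σ) : toHom P ≫ toHom Q = 𝟙 X := by
  rw [toHom_comp, ← strictHom_id]
  refine toHom_eq_iff.2 ?_
  obtain ⟨s, hs⟩ := Q.exists_lift (pullback.snd P.ρ Q.σ - pullback.fst _ _ ≫ e.hom) (by
    simp [h3, pullback.condition])
  apply Butterfly.comp_equiv (biprod.lift (pullback.fst _ _ ≫ P.σ) s)
  · apply biprod.hom_ext
    · simp
    · rw [← cancel_mono Q.ι]
      simp [hs, h2]
  · apply biprod.hom_ext
    · simp
    · rw [← cancel_mono Q.ι]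
      simp [hs, h1]
  · apply biprod.hom_ext
    · simp
    · rw [← cancel_mono Q.ι]
      simp [hs]
  · simp
  · have : s ≫ X.arrow.hom = pullback.snd _ _ ≫ Q.ρ - pullback.fst _ _ ≫ P.σ := by
      rw [← Q.ι_ρ, ← Category.assoc, hs, Preadditive.sub_comp, Category.assoc, h4]
    simp [biprod.lift_desc, this]

lemma isIso_toHom (P : Butterfly X.arrow Y.arrow)
    (h : (ShortComplex.mk P.κ P.ρ P.κ_ρ).ShortExact) : IsIso (toHom P) := by
  let Q : Butterfly Y.arrow X.arrow :=
    { E := P.E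
      κ := P.ι
      ι := P.κ
      σ := P.ρ
      ρ := P.σ
      κ_σ := P.ι_ρ
      ι_ρ := P.κ_σ
      κ_ρ := P.ι_σ
      ι_σ := P.κ_ρ
      shortExact := h }
  exact ⟨toHom Q, flip_comp P Q (Iso.refl _) (by simp [Q]) (by simp [Q]) (by simp [Q])
    (by simp [Q]), flip_comp Q P (Iso.refl _) (by simp [Q]) (by simp [Q]) (by simp [Q])
    (by simp [Q])⟩

/-- An object of `B` with zero identity has an invertible differential. -/
lemma isIso_of_id_eq_zero (h : 𝟙 X = 0) : IsIso X.arrow.hom := by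
  rw [← strictHom_id, zero_def] at h
  obtain ⟨e, h1, h2, h3, h4⟩ := toHom_eq_iff.1 h
  have h1 : biprod.lift X.arrow.hom (-𝟙 _) ≫ e.hom = biprod.lift X.arrow.hom (-0) := h1
  have h2 : biprod.inr ≫ e.hom = biprod.inr := h2
  have h3 : e.hom ≫ biprod.fst = biprod.fst := h3
  have h4 : e.hom ≫ biprod.desc 0 X.arrow.hom = biprod.desc (𝟙 _) X.arrow.hom := h4
  refine ⟨biprod.inl ≫ e.hom ≫ biprod.snd, ?_, ?_⟩
  · have := h1 =≫ biprod.snd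
    rw [biprod.lift_eq] at this
    simp only [Preadditive.add_comp, Category.assoc, Preadditive.neg_comp] at this
    rw [← Category.assoc biprod.inr, h2] at this
    simp at this
    rw [add_neg_eq_zero] at this
    exact this
  · have := biprod.inl ≫= h4
    simpa [biprod.desc_eq] using this

section Abelian

lemma ker_biprod_map {X X' Y Y' : A} (f : X ⟶ Y) (g : X' ⟶ Y') (h1 : t.F (kernel f))
    (h2 : t.F (kernel g)) : t.F (kernel (biprod.map f g)) := t.F_of_hom fun {M} hM z => by
  have h0 : z ≫ kernel.ι _ ≫ biprod.map f g = 0 := by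
    rw [kernel.condition, comp_zero]
  have hf : (z ≫ kernel.ι (biprod.map f g) ≫ biprod.fst) ≫ f = 0 := by
    rw [Category.assoc, Category.assoc, ← biprod.map_fst f g, ← Category.assoc _ _ biprod.fst,
      kernel.condition, zero_comp, comp_zero]
  have hs : (z ≫ kernel.ι (biprod.map f g) ≫ biprod.snd) ≫ g = 0 := by
    rw [Category.assoc, Category.assoc, ← biprod.map_snd f g, ← Category.assoc _ _ biprod.snd,
      kernel.condition, zero_comp, comp_zero]
  rw [← cancel_mono (kernel.ι _), zero_comp]
  apply biprod.hom_ext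
  · rw [Category.assoc, ← kernel.lift_ι _ _ hf, t.hom_eq_zero hM h1 (kernel.lift _ _ hf),
      zero_comp, zero_comp]
  · rw [Category.assoc, ← kernel.lift_ι _ _ hs, t.hom_eq_zero hM h2 (kernel.lift _ _ hs),
      zero_comp, zero_comp]

lemma coker_biprod_map {X X' Y Y' : A} (f : X ⟶ Y) (g : X' ⟶ Y') (h1 : t.T (cokernel f))
    (h2 : t.T (cokernel g)) : t.T (cokernel (biprod.map f g)) := t.T_of_hom fun {N} hN z => by
  have hf : f ≫ (biprod.inl ≫ cokernel.π (biprod.map f g) ≫ z) = 0 := by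
    rw [← Category.assoc, ← biprod.inl_map f g, Category.assoc,
      ← Category.assoc (biprod.map f g), cokernel.condition, zero_comp, comp_zero]
  have hs : g ≫ (biprod.inr ≫ cokernel.π (biprod.map f g) ≫ z) = 0 := by
    rw [← Category.assoc, ← biprod.inr_map f g, Category.assoc,
      ← Category.assoc (biprod.map f g), cokernel.condition, zero_comp, comp_zero]
  rw [← cancel_epi (cokernel.π _), comp_zero]
  apply biprod.hom_ext'
  · rw [← cokernel.π_desc _ _ hf, t.hom_eq_zero h1 hN (cokernel.desc _ _ hf),
      comp_zero, comp_zero]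
  · rw [← cokernel.π_desc _ _ hs, t.hom_eq_zero h2 hN (cokernel.desc _ _ hs),
      comp_zero, comp_zero]

/-- The direct sum of two objects of `B`. -/
abbrev sum (X Y : Tilt t) : Tilt t where
  arrow := Arrow.mk (biprod.map X.arrow.hom Y.arrow.hom)
  ker_mem := ker_biprod_map _ _ X.ker_mem Y.ker_mem
  coker_mem := coker_biprod_map _ _ X.coker_mem Y.coker_mem

/-- The projections and injections of the direct sum. -/
abbrev sumFst (X Y : Tilt t) : (sum X Y).arrow ⟶ X.arrow :=
  Arrow.homMk biprod.fst biprod.fst (by simp)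
/-- See `sumFst`. -/
abbrev sumSnd (X Y : Tilt t) : (sum X Y).arrow ⟶ Y.arrow :=
  Arrow.homMk biprod.snd biprod.snd (by simp)
/-- See `sumFst`. -/
abbrev sumInl (X Y : Tilt t) : X.arrow ⟶ (sum X Y).arrow :=
  Arrow.homMk biprod.inl biprod.inl (by simp)
/-- See `sumFst`. -/
abbrev sumInr (X Y : Tilt t) : Y.arrow ⟶ (sum X Y).arrow :=
  Arrow.homMk biprod.inr biprod.inr (by simp)

lemma existsUnique_prod_lift (f : Z ⟶ X) (g : Z ⟶ Y) :
    ∃! l : Z ⟶ sum X Y, l ≫ strictHom (X := sum X Y) (Y := X) (sumFst X Y) = f ∧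
      l ≫ strictHom (X := sum X Y) (Y := Y) (sumSnd X Y) = g := by
  obtain ⟨P, rfl⟩ := exists_rep f
  obtain ⟨Q, rfl⟩ := exists_rep g
  have hι : pullback.lift (biprod.fst ≫ P.ι) (biprod.snd ≫ Q.ι) (by simp) ≫
      pullback.fst P.σ Q.σ ≫ P.σ = 0 := by simp
  let L : Butterfly Z.arrow (sum X Y).arrow :=
    { E := pullback P.σ Q.σ
      κ := pullback.lift P.κ Q.κ (by simp)
      ι := pullback.lift (biprod.fst ≫ P.ι) (biprod.snd ≫ Q.ι) (by simp)
      σ := pullback.fst _ _ ≫ P.σ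
      ρ := biprod.lift (pullback.fst _ _ ≫ P.ρ) (pullback.snd _ _ ≫ Q.ρ)
      κ_σ := by simp
      ι_ρ := by apply biprod.hom_ext <;> simp
      κ_ρ := by apply biprod.hom_ext <;> simp
      ι_σ := hι
      shortExact := by
        have : Mono (pullback.lift (biprod.fst ≫ P.ι) (biprod.snd ≫ Q.ι) (by simp) :
            X.arrow.left ⊞ Y.arrow.left ⟶ pullback P.σ Q.σ) := by
          rw [Preadditive.mono_iff_cancel_zero]
          intro T z hz
          have h1 := hz =≫ pullback.fst _ _
          have h2 := hz =≫ pullback.snd _ _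
          simp only [Category.assoc, pullback.lift_fst, pullback.lift_snd, zero_comp] at h1 h2
          rw [← Category.assoc] at h1 h2
          apply biprod.hom_ext
          · rw [← cancel_mono P.ι, h1]; simp
          · rw [← cancel_mono Q.ι, h2]; simp
        refine ShortComplex.ShortExact.mk' ?_ this
          (inferInstanceAs (Epi (pullback.fst P.σ Q.σ ≫ P.σ)))
        rw [ShortComplex.exact_iff_exact_up_to_refinements]
        intro T x hx
        have hx : x ≫ pullback.fst P.σ Q.σ ≫ P.σ = 0 := hx
        obtain ⟨u, hu⟩ := P.exists_lift (x ≫ pullback.fst P.σ Q.σ) (by simpa using hx)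
        obtain ⟨v, hv⟩ := Q.exists_lift (x ≫ pullback.snd P.σ Q.σ)
          (by rw [Category.assoc, ← pullback.condition, hx])
        refine ⟨T, 𝟙 _, inferInstance, biprod.lift u v, ?_⟩
        rw [Category.id_comp]
        change x = biprod.lift u v ≫ pullback.lift _ _ _
        apply pullback.hom_ext
        · simp [hu]
        · simp [hv] }
  refine ⟨toHom L, ⟨?_, ?_⟩, ?_⟩
  · exact comp_strictHom_eq.2 ⟨pullback.fst _ _, by simp [L], by simp [L], by simp [L], by simp [L]⟩
  · exact comp_strictHom_eq.2 ⟨pullback.snd _ _, by simp [L], by simp [L],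
      by simp [L, pullback.condition], by simp [L]⟩
  · rintro l ⟨h1, h2⟩
    obtain ⟨G, rfl⟩ := exists_rep l
    rw [comp_strictHom_eq] at h1 h2
    obtain ⟨r, h11, h12, h13, h14⟩ := h1
    obtain ⟨s, h21, h22, h23, h24⟩ := h2
    refine toHom_eq_iff.2 (Butterfly.equiv_of_isHom (φ := pullback.lift r s (by rw [h13, h23])) ?_)
    constructor
    · apply pullback.hom_ext <;> simp [L, h11, h21]
    · apply pullback.hom_ext
      · simpa [L] using h12
      · simpa [L] using h22
    · simp [L, h13]
    · apply biprod.hom_ext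
      · simpa [L] using h14
      · simpa [L] using h24

lemma existsUnique_coprod_desc (f : X ⟶ Z) (g : Y ⟶ Z) :
    ∃! l : sum X Y ⟶ Z, strictHom (X := X) (Y := sum X Y) (sumInl X Y) ≫ l = f ∧
      strictHom (X := Y) (Y := sum X Y) (sumInr X Y) ≫ l = g := by
  obtain ⟨P, rfl⟩ := exists_rep f
  obtain ⟨Q, rfl⟩ := exists_rep g
  have h0 : P.ι ≫ P.σ ≫ (biprod.inl : _ ⟶ X.arrow.right ⊞ Y.arrow.right) =
    Q.ι ≫ Q.σ ≫ biprod.inr := by simp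
  have hι : (P.ι ≫ pushout.inl P.ι Q.ι) ≫
      pushout.desc (P.σ ≫ biprod.inl) (Q.σ ≫ biprod.inr) h0 = 0 := by simp
  let L : Butterfly (sum X Y).arrow Z.arrow :=
    { E := pushout P.ι Q.ι
      κ := biprod.desc (P.κ ≫ pushout.inl _ _) (Q.κ ≫ pushout.inr _ _)
      ι := P.ι ≫ pushout.inl _ _
      σ := pushout.desc (P.σ ≫ biprod.inl) (Q.σ ≫ biprod.inr) h0
      ρ := pushout.desc P.ρ Q.ρ (by simp)
      κ_σ := by apply biprod.hom_ext' <;> simp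
      ι_ρ := by simp
      κ_ρ := by apply biprod.hom_ext' <;> simp
      ι_σ := hι
      shortExact := by
        have he : Epi (pushout.desc (P.σ ≫ biprod.inl) (Q.σ ≫ biprod.inr) h0) := by
          rw [Preadditive.epi_iff_cancel_zero]
          intro T z hz
          have h1 := pushout.inl _ _ ≫= hz
          have h2 := pushout.inr _ _ ≫= hz
          rw [← Category.assoc, pushout.inl_desc, comp_zero, Category.assoc] at h1
          rw [← Category.assoc, pushout.inr_desc, comp_zero, Category.assoc] at h2
          apply biprod.hom_ext'
          · rw [← cancel_epi P.σ, h1]; simp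
          · rw [← cancel_epi Q.σ, h2]; simp
        have hm : Mono (P.ι ≫ pushout.inl P.ι Q.ι) := inferInstance
        refine ShortComplex.ShortExact.mk' ?_ hm he
        apply ShortComplex.exact_of_g_is_cokernel
        refine CokernelCofork.IsColimit.ofπ _ _
          (fun {T} z hz => biprod.desc
            (P.shortExact.exact.desc (pushout.inl _ _ ≫ z) ?_)
            (Q.shortExact.exact.desc (pushout.inr _ _ ≫ z) ?_)) ?_ ?_
        · simpa using hz
        · have : (P.ι ≫ pushout.inl P.ι Q.ι) ≫ z = 0 := hz
          rw [pushout.condition] at this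
          simpa using this
        · intro T z hz
          apply pushout.hom_ext
          · simpa using P.shortExact.exact.g_desc _ _
          · simpa using Q.shortExact.exact.g_desc _ _
        · intro T z hz m hm
          have hm : pushout.desc (P.σ ≫ biprod.inl) (Q.σ ≫ biprod.inr) h0 ≫ m = z := hm
          apply biprod.hom_ext'
          · rw [← cancel_epi P.σ, biprod.inl_desc]
            refine Eq.trans ?_ (P.shortExact.exact.g_desc _ _).symm
            rw [← hm]; simp
          · rw [← cancel_epi Q.σ, biprod.inr_desc]
            refine Eq.trans ?_ (Q.shortExact.exact.g_desc _ _).symm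
            rw [← hm]; simp }
  refine ⟨toHom L, ⟨?_, ?_⟩, ?_⟩
  · exact strictHom_comp_eq.2 ⟨pushout.inl _ _, by simp [L], by simp [L], by simp [L], by simp [L]⟩
  · exact strictHom_comp_eq.2 ⟨pushout.inr _ _, by simp [L],
      by simp [L, pushout.condition], by simp [L], by simp [L]⟩
  · rintro l ⟨h1, h2⟩
    obtain ⟨G, rfl⟩ := exists_rep l
    rw [strictHom_comp_eq] at h1 h2
    obtain ⟨r, h11, h12, h13, h14⟩ := h1
    obtain ⟨s, h21, h22, h23, h24⟩ := h2
    refine toHom_eq_iff.2 (Setoid.symm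
      (Butterfly.equiv_of_isHom (φ := pushout.desc r s (by rw [h12, h22])) ?_))
    constructor
    · apply biprod.hom_ext'
      · simpa [L] using h11
      · simpa [L] using h21
    · simp [L, h12]
    · apply pushout.hom_ext
      · simpa [L] using h13
      · simpa [L] using h23
    · apply pushout.hom_ext <;> simp [L, h14, h24]

lemma F_kernel_id (t : TorsionPair A) (X : A) : t.F (kernel (𝟙 X)) := t.F_of_hom fun _ f => by
  rw [← cancel_mono (kernel.ι _), zero_comp, kernel.ι_of_mono, comp_zero]

lemma T_cokernel_id (t : TorsionPair A) (X : A) : t.T (cokernel (𝟙 X)) := t.T_of_hom fun _ f => by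
  rw [← cancel_epi (cokernel.π _), comp_zero, cokernel.π_of_epi, zero_comp]

open scoped ZeroObject in
/-- The zero object `[0 ⟶ 0]`. -/
abbrev zeroObj (t : TorsionPair A) : Tilt t where
  arrow := Arrow.mk (𝟙 (0 : A))
  ker_mem := F_kernel_id t 0
  coker_mem := T_cokernel_id t 0

attribute [local instance] hasZeroMorphisms

lemma hasZeroObject (t : TorsionPair A) : HasZeroObject (Tilt t) := by
  refine ⟨zeroObj t, ?_⟩
  rw [IsZero.iff_id_eq_zero, ← strictHom_id]
  have : 𝟙 (zeroObj t).arrow = Arrow.homMk 0 0 := by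
    apply Arrow.hom_ext
    · exact (isZero_zero A).eq_of_src _ _
    · exact (isZero_zero A).eq_of_src _ _
  rw [this]
  rfl

lemma hasKernels (t : TorsionPair A) : HasKernels (Tilt t) where
  has_limit := by
    intro X Y f
    obtain ⟨P, rfl⟩ := exists_rep f
    obtain ⟨τ⟩ := Factor.nonempty P
    refine HasLimit.mk ⟨KernelFork.ofι _ τ.incl_comp, Fork.IsLimit.ofExistsUnique fun s => ?_⟩
    obtain ⟨l, hl⟩ := τ.exists_lift (q := s.ι) (KernelFork.condition s)
    exact ⟨l, hl, fun m hm => τ.incl_cancel (Eq.trans hm hl.symm)⟩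

lemma hasCokernels (t : TorsionPair A) : HasCokernels (Tilt t) where
  has_colimit := by
    intro X Y f
    obtain ⟨P, rfl⟩ := exists_rep f
    obtain ⟨τ⟩ := Factor.nonempty P
    refine HasColimit.mk ⟨CokernelCofork.ofπ _ τ.comp_proj,
      Cofork.IsColimit.ofExistsUnique fun s => ?_⟩
    obtain ⟨l, hl⟩ := τ.exists_desc (q := s.π) (CokernelCofork.condition s)
    exact ⟨l, hl, fun m hm => τ.proj_cancel (Eq.trans hm hl.symm)⟩

lemma hasBinaryProducts (t : TorsionPair A) : HasBinaryProducts (Tilt t) := by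
  have : ∀ {X Y : Tilt t}, HasLimit (pair X Y) := fun {X Y} =>
    HasLimit.mk ⟨BinaryFan.mk (strictHom (X := sum X Y) (Y := X) (sumFst X Y))
      (strictHom (X := sum X Y) (Y := Y) (sumSnd X Y)),
      BinaryFan.IsLimit.mk _ (fun f g => (existsUnique_prod_lift f g).choose)
        (fun f g => (existsUnique_prod_lift f g).choose_spec.1.1)
        (fun f g => (existsUnique_prod_lift f g).choose_spec.1.2)
        (fun f g m h1 h2 => (existsUnique_prod_lift f g).choose_spec.2 m ⟨h1, h2⟩)⟩
  exact hasBinaryProducts_of_hasLimit_pair _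

lemma hasBinaryCoproducts (t : TorsionPair A) : HasBinaryCoproducts (Tilt t) := by
  have : ∀ {X Y : Tilt t}, HasColimit (pair X Y) := fun {X Y} =>
    HasColimit.mk ⟨BinaryCofan.mk (strictHom (X := X) (Y := sum X Y) (sumInl X Y))
      (strictHom (X := Y) (Y := sum X Y) (sumInr X Y)),
      BinaryCofan.IsColimit.mk _ (fun f g => (existsUnique_coprod_desc f g).choose)
        (fun f g => (existsUnique_coprod_desc f g).choose_spec.1.1)
        (fun f g => (existsUnique_coprod_desc f g).choose_spec.1.2)
        (fun f g m h1 h2 => (existsUnique_coprod_desc f g).choose_spec.2 m ⟨h1, h2⟩)⟩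
  exact hasBinaryCoproducts_of_hasColimit_pair _

lemma isNormalMonoCategory (t : TorsionPair A) : IsNormalMonoCategory (Tilt t) where
  normalMonoOfMono := by
    intro X Y f hf
    obtain ⟨P, rfl⟩ := exists_rep f
    obtain ⟨τ⟩ := Factor.nonempty P
    have hi : strictHom (X := τ.ker) (Y := X) τ.incl = 0 := by
      rw [← cancel_mono (toHom P), τ.incl_comp, zero_comp]
    have hK : 𝟙 τ.ker = 0 := τ.incl_cancel (by rw [hi, comp_zero, comp_zero])
    have hk : IsIso τ.k := isIso_of_id_eq_zero hK
    let Q : Butterfly X.arrow τ.im.arrow :=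
      { E := P.E
        κ := P.κ
        ι := P.ι
        σ := P.σ
        ρ := cokernel.π τ.a
        κ_σ := P.κ_σ
        ι_ρ := rfl
        κ_ρ := τ.κ_π
        ι_σ := P.ι_σ
        shortExact := P.shortExact }
    have hQ : IsIso (toHom Q) := by
      apply isIso_toHom
      have h1 : (ShortComplex.mk τ.a (cokernel.π τ.a) (cokernel.condition _)).ShortExact :=
        { exact := ShortComplex.exact_cokernel τ.a
          mono_f := τ.mono
          epi_g := inferInstanceAs (Epi (cokernel.π τ.a)) }
      have e : ShortComplex.mk τ.a (cokernel.π τ.a) (cokernel.condition _) ≅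
          ShortComplex.mk Q.κ Q.ρ Q.κ_ρ :=
        ShortComplex.isoMk (asIso τ.k).symm (Iso.refl _) (Iso.refl _)
          (by
            change inv τ.k ≫ P.κ = τ.a ≫ 𝟙 _
            rw [Category.comp_id, IsIso.inv_comp_eq, τ.k_a])
          (by
            change 𝟙 _ ≫ cokernel.π τ.a = cokernel.π τ.a ≫ 𝟙 _
            rw [Category.comp_id, Category.id_comp])
      exact ShortComplex.shortExact_of_iso e h1
    have hfac : toHom Q ≫ strictHom (X := τ.im) (Y := Y) τ.imι = toHom P :=
      comp_strictHom_eq.2 ⟨𝟙 _, by simp [Q], by simp [Q], by simp [Q], by simp [Q]⟩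
    refine ⟨⟨τ.coker, strictHom (X := Y) (Y := τ.coker) τ.proj, τ.comp_proj,
      Fork.IsLimit.ofExistsUnique fun s => ?_⟩⟩
    obtain ⟨l, hl⟩ := τ.exists_lift_im (q := s.ι) (KernelFork.condition s)
    have h2 : (l ≫ inv (toHom Q)) ≫ toHom P = s.ι := by
      rw [← hfac]; simp [hl]
    refine ⟨l ≫ inv (toHom Q), h2, fun m hm => ?_⟩
    rw [← cancel_mono (toHom P), h2]
    exact hm

lemma isNormalEpiCategory (t : TorsionPair A) : IsNormalEpiCategory (Tilt t) where
  normalEpiOfEpi := by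
    intro X Y f hf
    obtain ⟨P, rfl⟩ := exists_rep f
    obtain ⟨τ⟩ := Factor.nonempty P
    have hp : strictHom (X := Y) (Y := τ.coker) τ.proj = 0 := by
      rw [← cancel_epi (toHom P), τ.comp_proj, comp_zero]
    have hC : 𝟙 τ.coker = 0 := τ.proj_cancel (by rw [hp, zero_comp, zero_comp])
    have hb : IsIso τ.b := isIso_of_id_eq_zero hC
    let Q : Butterfly τ.coim.arrow Y.arrow :=
      { E := P.E
        κ := τ.a
        ι := P.ι
        σ := P.σ
        ρ := P.ρ
        κ_σ := rfl
        ι_ρ := P.ι_ρ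
        κ_ρ := τ.a_ρ
        ι_σ := P.ι_σ
        shortExact := P.shortExact }
    have hQ : IsIso (toHom Q) := by
      apply isIso_toHom
      have h1 : (ShortComplex.mk τ.a (cokernel.π τ.a) (cokernel.condition _)).ShortExact :=
        { exact := ShortComplex.exact_cokernel τ.a
          mono_f := τ.mono
          epi_g := inferInstanceAs (Epi (cokernel.π τ.a)) }
      have e : ShortComplex.mk τ.a (cokernel.π τ.a) (cokernel.condition _) ≅
          ShortComplex.mk Q.κ Q.ρ Q.κ_ρ :=
        ShortComplex.isoMk (Iso.refl _) (Iso.refl _) (asIso τ.b)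
          (by
            change 𝟙 _ ≫ τ.a = τ.a ≫ 𝟙 _
            rw [Category.comp_id, Category.id_comp])
          (by
            change 𝟙 _ ≫ P.ρ = cokernel.π τ.a ≫ τ.b
            rw [Category.id_comp, cokernel.π_desc])
      exact ShortComplex.shortExact_of_iso e h1
    have hfac : strictHom (X := X) (Y := τ.coim) τ.coimπ ≫ toHom Q = toHom P :=
      strictHom_comp_eq.2 ⟨𝟙 _, by simp [Q], by simp [Q], by simp [Q], by simp [Q]⟩
    refine ⟨⟨τ.ker, strictHom (X := τ.ker) (Y := X) τ.incl, τ.incl_comp,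
      Cofork.IsColimit.ofExistsUnique fun s => ?_⟩⟩
    obtain ⟨l, hl⟩ := τ.exists_desc_coim (q := s.π) (CokernelCofork.condition s)
    have h2 : toHom P ≫ inv (toHom Q) ≫ l = s.π := by
      rw [← hfac]; simp [hl]
    refine ⟨inv (toHom Q) ≫ l, h2, fun m hm => ?_⟩
    rw [← cancel_epi (toHom P), h2]
    exact hm

/-- `B` has kernels, cokernels and direct sums, and its monomorphisms and epimorphisms are
normal. -/
abbrev nonPreadditiveAbelian (t : TorsionPair A) : NonPreadditiveAbelian (Tilt t) := by
  have := hasZeroObject t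
  have := hasKernels t
  have := hasCokernels t
  have := hasBinaryProducts t
  have := hasBinaryCoproducts t
  have := isNormalMonoCategory t
  have := isNormalEpiCategory t
  have : HasFiniteProducts (Tilt t) := hasFiniteProducts_of_has_binary_and_terminal
  have : HasFiniteCoproducts (Tilt t) := hasFiniteCoproducts_of_has_binary_and_initial
  exact { hasZeroMorphisms t, isNormalMonoCategory t, isNormalEpiCategory t with }

/-- `B` is abelian. Its addition of morphisms is the one determined by its direct sums (there is
only one addition of morphisms making a category with direct sums preadditive). -/
instance (t : TorsionPair A) : Abelian (Tilt t) :=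
  @NonPreadditiveAbelian.abelian (Tilt t) _ (nonPreadditiveAbelian t)

end Abelian

/-- The zero morphisms of the abelian category `B` are the classes of the zero butterflies. -/
lemma zero_eq (X Y : Tilt t) :
    @OfNat.ofNat (X ⟶ Y) 0 (@Zero.toOfNat0 _ (HasZeroMorphisms.zero X Y)) =
      toHom (zeroB X Y) := rfl

end Tilt

/-- `s` is a map between the centres of the butterflies `P` and `Q` that lies over the morphisms
of two-term complexes `f` and `g`. -/
structure Tilt.IsMap {t : TorsionPair A} {X Y X' Y' : Tilt t} (P : Butterfly X.arrow Y.arrow)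
    (Q : Butterfly X'.arrow Y'.arrow) (f : X.arrow ⟶ X'.arrow) (g : Y.arrow ⟶ Y'.arrow)
    (s : P.E ⟶ Q.E) : Prop where
  κ_s : P.κ ≫ s = f.left ≫ Q.κ
  ι_s : P.ι ≫ s = g.left ≫ Q.ι
  s_σ : s ≫ Q.σ = P.σ ≫ f.right
  s_ρ : s ≫ Q.ρ = P.ρ ≫ g.right

namespace Tilt

variable {t : TorsionPair A} {X Y Z X' Y' Z' X'' Y'' : Tilt t}

lemma exists_isMap {P : Butterfly X.arrow Y.arrow} {Q : Butterfly X'.arrow Y'.arrow}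
    {f : X.arrow ⟶ X'.arrow} {g : Y.arrow ⟶ Y'.arrow}
    (h : (strictHom f : X ⟶ X') ≫ toHom Q = toHom P ≫ (strictHom g : Y ⟶ Y')) :
    ∃ s, IsMap P Q f g s := by
  obtain ⟨R, hR⟩ := exists_rep (toHom P ≫ (strictHom g : Y ⟶ Y'))
  obtain ⟨r, r1, r2, r3, r4⟩ := comp_strictHom_eq.1 hR.symm
  obtain ⟨q, q1, q2, q3, q4⟩ := strictHom_comp_eq.1 (h.trans hR.symm)
  refine ⟨r ≫ q, ?_, ?_, ?_, ?_⟩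
  · rw [← Category.assoc, r1, q1]
  · rw [← Category.assoc, r2, Category.assoc, q2]
  · rw [Category.assoc, q3, ← Category.assoc, r3]
  · rw [Category.assoc, q4, r4]

lemma IsMap.unique {P : Butterfly X.arrow Y.arrow} {Q : Butterfly X'.arrow Y'.arrow}
    {f : X.arrow ⟶ X'.arrow} {g : Y.arrow ⟶ Y'.arrow} {s s' : P.E ⟶ Q.E}
    (h : IsMap P Q f g s) (h' : IsMap P Q f g s') : s = s' := by
  rw [← sub_eq_zero]
  apply vanish P Q
  · rw [Preadditive.comp_sub, h.κ_s, h'.κ_s, sub_self]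
  · rw [Preadditive.comp_sub, h.ι_s, h'.ι_s, sub_self]
  · rw [Preadditive.sub_comp, h.s_σ, h'.s_σ, sub_self]
  · rw [Preadditive.sub_comp, h.s_ρ, h'.s_ρ, sub_self]

lemma IsMap.id (P : Butterfly X.arrow Y.arrow) : IsMap P P (𝟙 _) (𝟙 _) (𝟙 _) := by
  constructor <;> simp

lemma IsMap.comp {P : Butterfly X.arrow Y.arrow} {Q : Butterfly X'.arrow Y'.arrow}
    {R : Butterfly X''.arrow Y''.arrow}
    {f : X.arrow ⟶ X'.arrow} {g : Y.arrow ⟶ Y'.arrow} {s : P.E ⟶ Q.E}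
    {f' : X'.arrow ⟶ X''.arrow} {g' : Y'.arrow ⟶ Y''.arrow} {s' : Q.E ⟶ R.E}
    (h : IsMap P Q f g s) (h' : IsMap Q R f' g' s') :
    IsMap P R (f ≫ f') (g ≫ g') (s ≫ s') where
  κ_s := by rw [← Category.assoc, h.κ_s, Category.assoc, h'.κ_s, ← Category.assoc]; rfl
  ι_s := by rw [← Category.assoc, h.ι_s, Category.assoc, h'.ι_s, ← Category.assoc]; rfl
  s_σ := by rw [Category.assoc, h'.s_σ, ← Category.assoc, h.s_σ, Category.assoc]; rfl
  s_ρ := by rw [Category.assoc, h'.s_ρ, ← Category.assoc, h.s_ρ, Category.assoc]; rfl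

lemma IsMap.link_comm {P : Butterfly X.arrow Y.arrow} {Q : Butterfly Y.arrow Z.arrow}
    {P' : Butterfly X'.arrow Y'.arrow} {Q' : Butterfly Y'.arrow Z'.arrow}
    {f : X.arrow ⟶ X'.arrow} {g : Y.arrow ⟶ Y'.arrow} {h : Z.arrow ⟶ Z'.arrow}
    {s : P.E ⟶ P'.E} {s' : Q.E ⟶ Q'.E} {δ : P.E ⟶ Q.E} {δ' : P'.E ⟶ Q'.E}
    (hs : IsMap P P' f g s) (hs' : IsMap Q Q' g h s') (hδ : IsLink P Q δ)
    (hδ' : IsLink P' Q' δ') : s ≫ δ' = δ ≫ s' := by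
  rw [← sub_eq_zero]
  apply vanish P Q'
  · rw [Preadditive.comp_sub, ← Category.assoc, hs.κ_s, Category.assoc, hδ'.κ_δ,
      ← Category.assoc P.κ, hδ.κ_δ, comp_zero, zero_comp, sub_self]
  · rw [Preadditive.comp_sub, ← Category.assoc, hs.ι_s, Category.assoc, hδ'.ι_δ,
      ← Category.assoc P.ι, hδ.ι_δ, hs'.κ_s, sub_self]
  · rw [Preadditive.sub_comp, Category.assoc, hδ'.δ_σ, hs.s_ρ, Category.assoc, hs'.s_σ,
      ← Category.assoc, hδ.δ_σ, sub_self]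
  · rw [Preadditive.sub_comp, Category.assoc, hδ'.δ_ρ, Category.assoc, hs'.s_ρ,
      ← Category.assoc, hδ.δ_ρ, comp_zero, zero_comp, sub_self]

end Tilt

/-- The objects of `Chˢᵗ(B)`: the complexes in `B`. -/
structure StrictComplex (t : TorsionPair A) where
  cx : CochainComplex (Tilt t) ℤ

namespace StrictComplex

/-- The morphisms of `Chˢᵗ(B)`: families of morphisms of two-term complexes whose classes in `B`
commute with the differentials. -/
@[ext]
structure Hom {t : TorsionPair A} (X Y : StrictComplex t) where
  f : ∀ n : ℤ, (X.cx.X n).arrow ⟶ (Y.cx.X n).arrow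
  comm : ∀ i j : ℤ, Tilt.strictHom (f i) ≫ Y.cx.d i j = X.cx.d i j ≫ Tilt.strictHom (f j)

instance (t : TorsionPair A) : Category (StrictComplex t) where
  Hom := Hom
  id X := ⟨fun n => 𝟙 _, fun i j => by
    rw [Tilt.strictHom_id, Tilt.strictHom_id, Category.id_comp, Category.comp_id]⟩
  comp {X Y Z} φ ψ := ⟨fun n => φ.f n ≫ ψ.f n, fun i j => by
    rw [← Tilt.strictHom_comp (φ.f i) (ψ.f i), ← Tilt.strictHom_comp (φ.f j) (ψ.f j),
      Category.assoc, ψ.comm, ← Category.assoc, φ.comm, Category.assoc]⟩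
  id_comp φ := Hom.ext (funext fun n => Category.id_comp (φ.f n))
  comp_id φ := Hom.ext (funext fun n => Category.comp_id (φ.f n))
  assoc φ ψ χ := Hom.ext (funext fun n => Category.assoc (φ.f n) (ψ.f n) (χ.f n))

/-- The functor `Chˢᵗ(B) ⥤ Ch(B)`, the identity on objects. -/
def incl (t : TorsionPair A) : StrictComplex t ⥤ CochainComplex (Tilt t) ℤ where
  obj X := X.cx
  map φ := { f := fun n => Tilt.strictHom (φ.f n), comm' := fun i j _ => φ.comm i j }
  map_id X := by
    apply HomologicalComplex.hom_ext
    intro n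
    exact Tilt.strictHom_id _
  map_comp φ ψ := by
    apply HomologicalComplex.hom_ext
    intro n
    exact (Tilt.strictHom_comp (φ.f n) (ψ.f n)).symm

end StrictComplex

/-- A decorated complex in `A`: a complex together with a subobject of each of its terms. -/
structure Decorated (A : Type u) [Category.{v} A] [Abelian A] where
  cx : CochainComplex A ℤ
  sub : ∀ n : ℤ, Subobject (cx.X n)

namespace Decorated

/-- A morphism of decorated complexes: a chain map that carries the subobjects into each other. -/
@[ext]
structure Hom (E F : Decorated A) where
  map : E.cx ⟶ F.cx
  factors : ∀ n : ℤ, (F.sub n).Factors ((E.sub n).arrow ≫ map.f n)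

instance : Category (Decorated A) where
  Hom := Hom
  id E := ⟨𝟙 _, fun n => by
    rw [HomologicalComplex.id_f, Category.comp_id]
    exact Subobject.factors_self _⟩
  comp {E F G} φ ψ := ⟨φ.map ≫ ψ.map, fun n => by
    rw [HomologicalComplex.comp_f, ← Category.assoc, ← Subobject.factorThru_arrow _ _ (φ.factors n),
      Category.assoc]
    exact Subobject.factors_of_factors_right _ (ψ.factors n)⟩
  id_comp φ := Hom.ext (Category.id_comp φ.map)
  comp_id φ := Hom.ext (Category.comp_id φ.map)
  assoc φ ψ χ := Hom.ext (Category.assoc φ.map ψ.map χ.map)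

/-- The morphism `Mⁿ ⟶ Eⁿ⁺¹ / Mⁿ⁺¹` induced by the differential of a decorated complex. Its kernel
and its cokernel are the cohomologies `H^{-1,n}` and `H^{0,n}`. -/
def two (E : Decorated A) (n : ℤ) : (E.sub n : A) ⟶ cokernel (E.sub (n + 1)).arrow :=
  (E.sub n).arrow ≫ E.cx.d n (n + 1) ≫ cokernel.π (E.sub (n + 1)).arrow

variable {E F : Decorated A}

/-- The map on `Mⁿ` induced by a morphism of decorated complexes. -/
def subMap (φ : E ⟶ F) (n : ℤ) : (E.sub n : A) ⟶ (F.sub n : A) :=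
  (F.sub n).factorThru ((E.sub n).arrow ≫ φ.map.f n) (φ.factors n)

lemma subMap_arrow (φ : E ⟶ F) (n : ℤ) :
    subMap φ n ≫ (F.sub n).arrow = (E.sub n).arrow ≫ φ.map.f n :=
  Subobject.factorThru_arrow _ _ _

/-- The map on `Eⁿ / Mⁿ` induced by a morphism of decorated complexes. -/
def quotMap (φ : E ⟶ F) (n : ℤ) :
    cokernel (E.sub n).arrow ⟶ cokernel (F.sub n).arrow :=
  cokernel.map _ _ (subMap φ n) (φ.map.f n) (subMap_arrow φ n).symm

lemma two_comm (φ : E ⟶ F) (n : ℤ) :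
    E.two n ≫ quotMap φ (n + 1) = subMap φ n ≫ F.two n := by
  simp only [two, quotMap, Category.assoc, cokernel.π_desc]
  rw [← Category.assoc (subMap φ n), subMap_arrow, Category.assoc,
    ← Category.assoc _ _ (cokernel.π _), ← φ.map.comm, Category.assoc]

/-- The map induced on `H^{-1,n}`. -/
def kerMap (φ : E ⟶ F) (n : ℤ) : kernel (E.two n) ⟶ kernel (F.two n) :=
  kernel.map _ _ (subMap φ n) (quotMap φ (n + 1)) (two_comm φ n)

/-- The map induced on `H^{0,n}`. -/
def cokerMap (φ : E ⟶ F) (n : ℤ) : cokernel (E.two n) ⟶ cokernel (F.two n) :=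
  cokernel.map _ _ (subMap φ n) (quotMap φ (n + 1)) (two_comm φ n)

end Decorated

/-- The decorated complexes whose decoration is compatible with the torsion pair. -/
def compatible (t : TorsionPair A) : ObjectProperty (Decorated A) := fun E =>
  ∀ n : ℤ, t.F (kernel (E.two n)) ∧ t.T (cokernel (E.two n))

/-- The category `Ch(A, T, F)` of complexes decorated compatibly with the torsion pair, a full
subcategory of the category of decorated complexes. -/
abbrev CompatibleComplex (t : TorsionPair A) := (compatible t).FullSubcategory

/-- The morphisms of `Ch(A, T, F)` that induce isomorphisms on all `H^{-1,n}` and `H^{0,n}`. -/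
def sis (t : TorsionPair A) : MorphismProperty (CompatibleComplex t) := fun _ _ φ =>
  ∀ n : ℤ, IsIso (Decorated.kerMap φ.hom n) ∧ IsIso (Decorated.cokerMap φ.hom n)

/-- The morphisms of `Ch(A, T, F)` that are quasi-isomorphisms of complexes in `A`. -/
def qis (t : TorsionPair A) : MorphismProperty (CompatibleComplex t) := fun _ _ φ =>
  QuasiIso φ.hom.map

namespace Tot

variable {t : TorsionPair A} (X : StrictComplex t)

/-- A butterfly representing the differential `ᵏX ⟶ ᵏ⁺¹X`. -/
abbrev wing (k : ℤ) : Butterfly (X.cx.X k).arrow (X.cx.X (k + 1)).arrow :=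
  Tilt.out (X.cx.d k (k + 1))

lemma exists_link (k : ℤ) : ∃ δ, Tilt.IsLink (wing X k) (wing X (k + 1)) δ :=
  Tilt.exists_link (by
    rw [Tilt.toHom_out, Tilt.toHom_out]
    exact X.cx.d_comp_d _ _ _)

/-- The link between the butterflies of two successive differentials; it is unique. -/
def δ (k : ℤ) : (wing X k).E ⟶ (wing X (k + 1)).E := (exists_link X k).choose

lemma isLink (k : ℤ) : Tilt.IsLink (wing X k) (wing X (k + 1)) (δ X k) :=
  (exists_link X k).choose_spec

/-- The complex of the centres of the butterflies, the one of `ᵏX ⟶ ᵏ⁺¹X` being in degree `k`. -/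
abbrev aux : CochainComplex A ℤ :=
  CochainComplex.of (fun k => (wing X k).E) (δ X) fun k => (isLink X k).comp (isLink X (k + 1))

lemma aux_d (k : ℤ) : (aux X).d k (k + 1) = δ X k :=
  CochainComplex.of_d (fun k => (wing X k).E) (δ X) k

/-- The decorated complex `(E, M)` of a complex `X` in `B`: `Eⁿ` is the centre of the butterfly
of the differential `ⁿ⁻¹X ⟶ ⁿX`, and `Mⁿ` is the image of `(ⁿX)⁻¹` in it. -/
abbrev decorated : Decorated A where
  cx :=
    { X := fun n => (aux X).X (n - 1)
      d := fun i j => (aux X).d (i - 1) (j - 1)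
      shape := fun i j h => (aux X).shape _ _ (by
        intro h'
        apply h
        have h' : i - 1 + 1 = j - 1 := h'
        change i + 1 = j
        omega)
      d_comp_d' := fun i j k _ _ => (aux X).d_comp_d _ _ _ }
  sub := fun n => Subobject.mk (wing X (n - 1)).ι

lemma F_kernel_conj {X' Y' Z' W' : A} (a : X' ⟶ Y') (d : Y' ⟶ Z') (b : Z' ⟶ W') [Mono a] [Mono b]
    (h : t.F (kernel d)) : t.F (kernel (a ≫ d ≫ b)) := by
  have w : (kernel.ι (a ≫ d ≫ b) ≫ a) ≫ d = 0 := by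
    rw [← cancel_mono b, zero_comp, Category.assoc, Category.assoc, kernel.condition]
  have : Mono (kernel.lift d _ w) := mono_of_mono_fac (kernel.lift_ι _ _ w)
  exact t.F_of_mono (kernel.lift d _ w) h

lemma T_cokernel_conj {X' Y' Z' W' : A} (a : X' ⟶ Y') (d : Y' ⟶ Z') (b : Z' ⟶ W') [Epi a] [Epi b]
    (h : t.T (cokernel d)) : t.T (cokernel (a ≫ d ≫ b)) := by
  have w : d ≫ b ≫ cokernel.π (a ≫ d ≫ b) = 0 := by
    rw [← cancel_epi a, comp_zero]
    simpa only [Category.assoc] using cokernel.condition (a ≫ d ≫ b)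
  have : Epi (cokernel.desc d _ w) := epi_of_epi_fac (cokernel.π_desc _ _ w)
  exact t.T_of_epi (cokernel.desc d _ w) h

lemma compat_aux (k l : ℤ) (h : k + 1 = l) :
    t.F (kernel ((Subobject.mk (wing X k).ι).arrow ≫ (aux X).d k l ≫
      cokernel.π (Subobject.mk (wing X l).ι).arrow)) ∧
    t.T (cokernel ((Subobject.mk (wing X k).ι).arrow ≫ (aux X).d k l ≫
      cokernel.π (Subobject.mk (wing X l).ι).arrow)) := by
  subst h
  rw [aux_d]
  obtain ⟨b, hb⟩ := (wing X (k + 1)).exists_desc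
    (cokernel.π (Subobject.mk (wing X (k + 1)).ι).arrow) (by
      rw [← cancel_epi (Subobject.underlyingIso (wing X (k + 1)).ι).hom, ← Category.assoc,
        Subobject.underlyingIso_hom_comp_eq_mk, cokernel.condition, comp_zero])
  have : Epi b := by
    have : Epi ((wing X (k + 1)).σ ≫ b) := by rw [hb]; infer_instance
    exact epi_of_epi (wing X (k + 1)).σ b
  have w : (Subobject.mk (wing X (k + 1)).ι).arrow ≫ (wing X (k + 1)).σ = 0 := by
    rw [← Subobject.underlyingIso_hom_comp_eq_mk, Category.assoc, Butterfly.ι_σ, comp_zero]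
  have hm : b ≫ cokernel.desc _ _ w = 𝟙 _ := by
    rw [← cancel_epi (wing X (k + 1)).σ, ← Category.assoc, hb, cokernel.π_desc, Category.comp_id]
  have : Mono b := by
    have : Mono (b ≫ cokernel.desc _ _ w) := by rw [hm]; infer_instance
    exact mono_of_mono b (cokernel.desc _ _ w)
  have key : (Subobject.mk (wing X k).ι).arrow ≫ δ X k ≫
      cokernel.π (Subobject.mk (wing X (k + 1)).ι).arrow =
      (Subobject.underlyingIso (wing X k).ι).hom ≫ (X.cx.X (k + 1)).arrow.hom ≫ b := by
    rw [← Subobject.underlyingIso_hom_comp_eq_mk (wing X k).ι, ← hb, Category.assoc,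
      ← Category.assoc (wing X k).ι, (isLink X k).ι_δ, ← Category.assoc (wing X (k + 1)).κ,
      Butterfly.κ_σ]
  rw [key]
  exact ⟨F_kernel_conj _ _ _ (X.cx.X (k + 1)).ker_mem,
    T_cokernel_conj _ _ _ (X.cx.X (k + 1)).coker_mem⟩

lemma compatible_decorated : compatible t (decorated X) := fun n =>
  compat_aux X (n - 1) (n + 1 - 1) (by omega)

variable {X} {Y Z : StrictComplex t}

lemma exists_map (φ : X ⟶ Y) (k : ℤ) :
    ∃ s, Tilt.IsMap (wing X k) (wing Y k) (φ.f k) (φ.f (k + 1)) s :=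
  Tilt.exists_isMap (by
    rw [Tilt.toHom_out, Tilt.toHom_out]
    exact φ.comm k (k + 1))

/-- The map between the centres of the butterflies that is given by a strict morphism; it is
the only one compatible with the four arrows of the butterflies. -/
def mapE (φ : X ⟶ Y) (k : ℤ) : (wing X k).E ⟶ (wing Y k).E := (exists_map φ k).choose

lemma isMap (φ : X ⟶ Y) (k : ℤ) :
    Tilt.IsMap (wing X k) (wing Y k) (φ.f k) (φ.f (k + 1)) (mapE φ k) :=
  (exists_map φ k).choose_spec

lemma mapE_id (k : ℤ) : mapE (𝟙 X) k = 𝟙 _ := (isMap (𝟙 X) k).unique (Tilt.IsMap.id _)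

lemma mapE_comp (φ : X ⟶ Y) (ψ : Y ⟶ Z) (k : ℤ) : mapE (φ ≫ ψ) k = mapE φ k ≫ mapE ψ k :=
  (isMap (φ ≫ ψ) k).unique ((isMap φ k).comp (isMap ψ k))

lemma mapE_comm (φ : X ⟶ Y) (k l : ℤ) (h : k + 1 = l) :
    mapE φ k ≫ (aux Y).d k l = (aux X).d k l ≫ mapE φ l := by
  subst h
  rw [aux_d, aux_d]
  exact (isMap φ k).link_comm (isMap φ (k + 1)) (isLink X k) (isLink Y k)

/-- The morphism of decorated complexes given by a strict morphism. -/
def decoratedMap (φ : X ⟶ Y) : decorated X ⟶ decorated Y where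
  map :=
    { f := fun n => mapE φ (n - 1)
      comm' := fun i j h => mapE_comm φ (i - 1) (j - 1) (by
        have h : i + 1 = j := h
        omega) }
  factors n := by
    change (Subobject.mk (wing Y (n - 1)).ι).Factors
      ((Subobject.mk (wing X (n - 1)).ι).arrow ≫ mapE φ (n - 1))
    rw [← Subobject.underlyingIso_hom_comp_eq_mk, Category.assoc, (isMap φ (n - 1)).ι_s,
      ← Category.assoc]
    exact Subobject.factors_of_factors_right _ ⟨𝟙 _, Category.id_comp _⟩

lemma decoratedMap_id (X : StrictComplex t) : decoratedMap (𝟙 X) = 𝟙 (decorated X) := by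
  apply Decorated.Hom.ext
  apply HomologicalComplex.hom_ext
  intro n
  exact mapE_id (n - 1)

lemma decoratedMap_comp (φ : X ⟶ Y) (ψ : Y ⟶ Z) :
    decoratedMap (φ ≫ ψ) = decoratedMap φ ≫ decoratedMap ψ := by
  apply Decorated.Hom.ext
  apply HomologicalComplex.hom_ext
  intro n
  exact mapE_comp φ ψ (n - 1)

end Tot

/-- The functor `Tot` from `Chˢᵗ(B)` to `Ch(A, T, F)`. -/
def Tot (t : TorsionPair A) : StrictComplex t ⥤ CompatibleComplex t where
  obj X := ⟨Tot.decorated X, Tot.compatible_decorated X⟩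
  map φ := ObjectProperty.homMk (Tot.decoratedMap φ)
  map_id X := by rw [Tot.decoratedMap_id]; rfl
  map_comp φ ψ := by rw [Tot.decoratedMap_comp]; rfl

end
end HRS

/-
A morphism of `B` represented by a butterfly with centre `E` is the fraction
`X ⟵ [X⁻¹ ⊞ Y⁻¹ ⟶ E] ⟶ Y` of strict morphisms, and strict morphisms with the same class are
homotopic. Since strict morphisms of complexes only have to commute with the differentials in `B`,
roofs and homotopies may be chosen degree by degree. Hence `Ch(B)` is the localization of `Chˢᵗ(B)`
at the degreewise quasi-isomorphisms of two-term complexes, and `D(B)` is its localization at the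
morphisms that are quasi-isomorphisms in `Ch(B)`.

`Tot` is an equivalence: the complex in `B` of a pair `(E, M)` has the terms `Mⁿ ⟶ Eⁿ⁺¹ / Mⁿ⁺¹`,
and `Eⁿ` is the centre of a butterfly between two consecutive ones. It remains to compare the
classes of morphisms. For `sis` this is immediate. For `qis`, choose for each butterfly a subobject
`S` of `E` with `im κ ⊆ S ⊆ ker ρ` such that `S / im κ` is torsion and `ker ρ / S` is torsion-free.
Two consecutive differentials have the homology `[E / S ⟶ S']` in `B`. Its cokernel is the torsion
part, and the kernel of the next one, `[E' / S' ⟶ S'']`, is the torsion-free part of the homology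
of `E ⟶ E' ⟶ E''`. A map between extensions of torsion-free by torsion objects is an isomorphism if
and only if it is one on both parts, because both parts are functorial.
-/

namespace HRS

section Localization

open HomotopicalAlgebra

variable {C D : Type*} [Category C] [Category D] {L : C ⥤ D}

/-- The class of morphisms that become invertible under `L`. -/
abbrev invertedBy (L : C ⥤ D) : MorphismProperty C :=
  (MorphismProperty.isomorphisms D).inverseImage L

/-- The condition that every morphism between objects in the image of `L` is a right fraction. -/
def HasRoofs (L : C ⥤ D) : Prop :=
  ∀ ⦃X Y : C⦄ (φ : L.obj X ⟶ L.obj Y), ∃ (R : C) (s : R ⟶ X) (f : R ⟶ Y),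
    IsIso (L.map s) ∧ L.map s ≫ φ = L.map f

/-- The condition that morphisms with the same image under `L` are right homotopic, through a path
object whose constant paths become invertible under `L`. -/
def HasPaths (L : C ⥤ D) : Prop :=
  ∀ ⦃X Y : C⦄ (f g : X ⟶ Y), L.map f = L.map g →
    ∃ (P : PrepathObject Y) (_ : P.RightHomotopy f g), IsIso (L.map P.ι)

namespace HasRoofs

lemma hasRightCalculusOfFractions [L.Faithful] (hr : HasRoofs L) :
    (invertedBy L).HasRightCalculusOfFractions where
  exists_rightFraction _ _ φ := by
    have : IsIso (L.map φ.s) := φ.hs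
    obtain ⟨R, s, f, hs, e⟩ := hr (L.map φ.f ≫ inv (L.map φ.s))
    exact ⟨⟨s, hs, f⟩, L.map_injective (by simp [← e])⟩
  ext X _ _ f g s (hs : IsIso (L.map s)) e := by
    have hfg : f = g :=
      L.map_injective ((cancel_mono (L.map s)).1 (by simp only [← L.map_comp, e]))
    exact ⟨X, 𝟙 X, (invertedBy L).id_mem X, by rw [hfg]⟩

section

variable {E : Type*} [Category E] {Q : C ⥤ E} {G : E ⥤ D}
  [Q.IsLocalization (invertedBy (Q ⋙ G))]

lemma full (hr : HasRoofs (Q ⋙ G)) : G.Full := by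
  have := Localization.essSurj Q (invertedBy (Q ⋙ G))
  refine G.full_of_comp_essSurj Q fun X Y φ => ?_
  obtain ⟨R, s, f, hs, e⟩ := hr φ
  have := Localization.inverts Q (invertedBy (Q ⋙ G)) s hs
  exact ⟨inv (Q.map s) ≫ Q.map f, by rw [G.map_comp, G.map_inv, IsIso.inv_comp_eq]; exact e.symm⟩

lemma faithful [(Q ⋙ G).Faithful] (hr : HasRoofs (Q ⋙ G)) : G.Faithful := by
  have := hr.hasRightCalculusOfFractions
  have : G.op.Faithful :=
    G.op.faithful_of_comp_of_hasLeftCalculusOfFractions (L := Q.op) (W := (invertedBy (Q ⋙ G)).op)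
      fun _ _ f g h => by
        rw [Quiver.Hom.unop_inj ((Q ⋙ G).map_injective (Quiver.Hom.op_inj h))]
  exact ⟨fun h => Quiver.Hom.op_inj (G.op.map_injective (congrArg Quiver.Hom.op h))⟩

end

theorem isLocalization_of_faithful [L.Faithful] [L.EssSurj] (hr : HasRoofs L) :
    L.IsLocalization (invertedBy L) := by
  let Q := (invertedBy L).Q
  have hL : (invertedBy L).IsInvertedBy L := fun _ _ _ h => h
  let G := Localization.Construction.lift L hL
  have hG : Q ⋙ G = L := Localization.Construction.fac L hL
  have : (Q ⋙ G).Faithful := by rwa [hG]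
  have : Q.IsLocalization (invertedBy (Q ⋙ G)) := by rw [hG]; infer_instance
  have : G.EssSurj := ⟨fun Y => ⟨Q.obj (L.objPreimage Y), ⟨L.objObjPreimageIso Y⟩⟩⟩
  have hr' : HasRoofs (Q ⋙ G) := by rwa [hG]
  exact
    { inverts := hL
      isEquivalence := { full := hr'.full, faithful := hr'.faithful, essSurj := ‹_› } }

lemma le_map_inverseImage [L.EssSurj] (hr : HasRoofs L) (W : MorphismProperty D) [W.RespectsIso] :
    W ≤ (W.inverseImage L).map L := by
  intro X Y φ hφ
  obtain ⟨R, s, f, hs, e⟩ :=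
    hr ((L.objObjPreimageIso X).hom ≫ φ ≫ (L.objObjPreimageIso Y).inv)
  let a : Arrow.mk (L.map f) ≅ Arrow.mk φ :=
    Arrow.isoMk (asIso (L.map s) ≪≫ L.objObjPreimageIso X) (L.objObjPreimageIso Y) (by
      simp [← e])
  exact ⟨_, _, f, (W.arrow_mk_iso_iff a).2 hφ, ⟨a⟩⟩

end HasRoofs

theorem isLocalization_of_hasRoofs_of_hasPaths [L.EssSurj] (hr : HasRoofs L) (hp : HasPaths L) :
    L.IsLocalization (invertedBy L) := by
  let Q := CategoryTheory.Quotient.functor L.homRel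
  let F : CategoryTheory.Quotient L.homRel ⥤ D :=
    CategoryTheory.Quotient.lift L.homRel L (by simp)
  have : F.EssSurj := ⟨fun Y => ⟨Q.obj (L.objPreimage Y), ⟨L.objObjPreimageIso Y⟩⟩⟩
  have hF : HasRoofs F := by
    rintro ⟨X⟩ ⟨Y⟩ φ
    obtain ⟨R, s, f, hs, e⟩ := hr φ
    exact ⟨Q.obj R, Q.map s, Q.map f, hs, e⟩
  have := hF.isLocalization_of_faithful
  have hQF : (invertedBy Q).IsInvertedBy (Q ⋙ F) := fun X Y f (_ : IsIso (Q.map f)) =>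
    inferInstanceAs (IsIso (F.map (Q.map f)))
  have : Q.IsLocalization (invertedBy Q) := by
    refine CategoryTheory.Quotient.isLocalization_functor' _ _ (fun _ _ _ h => h)
      fun X Y f g h => ?_
    obtain ⟨P, H, hι⟩ := hp f g h
    refine ⟨P, H, ⟨Q.map P.p₀, ?_, ?_⟩⟩
    · rw [← Q.map_comp, P.ι_p₀, Q.map_id]
    · rw [← Q.map_comp, ← Q.map_id, CategoryTheory.Quotient.functor_map_eq_iff]
      rw [Functor.homRel_iff, ← cancel_epi (L.map P.ι), ← L.map_comp, P.ι_p₀_assoc,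
        L.map_id, Category.comp_id]
  refine Functor.IsLocalization.comp Q F (invertedBy Q) (invertedBy F) _ (fun _ _ _ h => h) hQF ?_
  rintro ⟨X⟩ ⟨Y⟩ φ hφ
  obtain ⟨f, rfl⟩ := Q.map_surjective φ
  exact MorphismProperty.map_mem_map _ _ _ hφ

end Localization

noncomputable section

variable {A : Type u} [Category.{v} A] [Abelian A]

attribute [local simp] pullback.lift_fst pullback.lift_snd pullback.lift_fst_assoc
  pullback.lift_snd_assoc pushout.inl_desc pushout.inr_desc pushout.inl_desc_assoc
  pushout.inr_desc_assoc

section TwoTerm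

/-- The other diagonal of a butterfly. For `strict f` it is the mapping cone of `f`. -/
abbrev Butterfly.diagonal {X Y : Arrow A} (P : Butterfly X Y) : ShortComplex A :=
  ShortComplex.mk P.κ P.ρ P.κ_ρ

/-- The class of quasi-isomorphisms of two-term complexes. -/
def arrowQis (A : Type u) [Category.{v} A] [Abelian A] : MorphismProperty (Arrow A) :=
  (MorphismProperty.isomorphisms A).inverseImage (ker A) ⊓
    (MorphismProperty.isomorphisms A).inverseImage (coker A)

instance : (arrowQis A).RespectsIso := by
  unfold arrowQis; infer_instance

variable {X Y : Arrow A}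

/-- The map on kernels induced by a morphism of two-term complexes, that is `(ker A).map f`. -/
def arrowKer (f : X ⟶ Y) : kernel X.hom ⟶ kernel Y.hom := (ker A).map f

/-- The map on cokernels induced by a morphism of two-term complexes, that is `(coker A).map f`. -/
def arrowCoker (f : X ⟶ Y) : cokernel X.hom ⟶ cokernel Y.hom := (coker A).map f

lemma arrowKer_ι (f : X ⟶ Y) : arrowKer f ≫ kernel.ι Y.hom = kernel.ι X.hom ≫ f.left :=
  kernel.lift_ι _ _ _

lemma π_arrowCoker (f : X ⟶ Y) :
    cokernel.π X.hom ≫ arrowCoker f = f.right ≫ cokernel.π Y.hom :=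
  cokernel.π_desc _ _ _

variable {f : X ⟶ Y}

lemma mono_arrowKer_iff : Mono (arrowKer f) ↔ Mono (Butterfly.strict f).κ := by
  change _ ↔ Mono (biprod.lift X.hom (-f.left))
  simp only [Preadditive.mono_iff_cancel_zero]
  constructor
  · intro h T x hx
    have hl := hx =≫ biprod.fst
    have hr := hx =≫ biprod.snd
    simp only [Category.assoc, biprod.lift_fst, biprod.lift_snd, zero_comp,
      Preadditive.comp_neg, neg_eq_zero] at hl hr
    have hx : kernel.lift X.hom x hl = 0 := h _ _ <| by
      rw [← cancel_mono (kernel.ι Y.hom), Category.assoc, arrowKer_ι, kernel.lift_ι_assoc, hr,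
        zero_comp]
    rw [← kernel.lift_ι X.hom x hl, hx, zero_comp]
  · intro h T x hx
    rw [← cancel_mono (kernel.ι X.hom), zero_comp]
    refine h _ _ ?_
    apply biprod.hom_ext
    · simp
    · simp [← arrowKer_ι, reassoc_of% hx]

lemma epi_arrowCoker_iff : Epi (arrowCoker f) ↔ Epi (Butterfly.strict f).ρ := by
  change _ ↔ Epi (biprod.desc f.right Y.hom)
  simp only [Preadditive.epi_iff_cancel_zero]
  constructor
  · intro h T x hx
    have hl := biprod.inl ≫= hx
    have hr := biprod.inr ≫= hx
    simp only [biprod.inl_desc_assoc, biprod.inr_desc_assoc, comp_zero] at hl hr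
    have hx : cokernel.desc Y.hom x hr = 0 := h _ _ <| by
      rw [← cancel_epi (cokernel.π X.hom), reassoc_of% π_arrowCoker f, cokernel.π_desc, hl,
        comp_zero]
    rw [← cokernel.π_desc Y.hom x hr, hx, comp_zero]
  · intro h T x hx
    rw [← cancel_epi (cokernel.π Y.hom), comp_zero]
    refine h _ _ ?_
    apply biprod.hom_ext'
    · simp [← reassoc_of% π_arrowCoker f, hx]
    · simp

lemma exact_diagonal_strict [Epi (arrowKer f)] [Mono (arrowCoker f)] :
    (Butterfly.strict f).diagonal.Exact := by
  rw [ShortComplex.exact_iff_exact_up_to_refinements]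
  intro T z (hz : z ≫ biprod.desc f.right Y.hom = 0)
  obtain ⟨a, b, rfl⟩ : ∃ a b, z = biprod.lift a b :=
    ⟨z ≫ biprod.fst, z ≫ biprod.snd, by apply biprod.hom_ext <;> simp⟩
  rw [biprod.lift_desc] at hz
  have ha : a ≫ cokernel.π X.hom = 0 := by
    rw [← cancel_mono (arrowCoker f), zero_comp, Category.assoc, π_arrowCoker, ← Category.assoc,
      eq_neg_of_add_eq_zero_left hz]
    simp
  obtain ⟨T', p, hp, x, hx⟩ := (CokernelCofork.IsColimit.comp_π_eq_zero_iff_up_to_refinements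
    (cokernelIsCokernel X.hom) a).1 ha
  have hb : (p ≫ b + x ≫ f.left) ≫ Y.hom = 0 := by
    rw [Preadditive.add_comp, Category.assoc, Category.assoc, Arrow.w, ← reassoc_of% hx,
      ← Preadditive.comp_add, add_comm, hz, comp_zero]
  obtain ⟨T'', q, hq, y, hy⟩ := surjective_up_to_refinements_of_epi (arrowKer f)
    (kernel.lift Y.hom _ hb)
  refine ⟨T'', q ≫ p, inferInstance, q ≫ x - y ≫ kernel.ι X.hom, ?_⟩
  have hy' := hy =≫ kernel.ι Y.hom
  simp only [Category.assoc, kernel.lift_ι, arrowKer_ι, Preadditive.comp_add] at hy'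
  change (q ≫ p) ≫ biprod.lift a b = _ ≫ biprod.lift X.hom (-f.left)
  apply biprod.hom_ext
  · simp [hx]
  · simp [← hy']

lemma arrowQis_iff_shortExact : arrowQis A f ↔ (Butterfly.strict f).diagonal.ShortExact := by
  constructor
  · rintro ⟨hk : IsIso (arrowKer f), hc : IsIso (arrowCoker f)⟩
    exact
      { exact := exact_diagonal_strict
        mono_f := mono_arrowKer_iff.1 inferInstance
        epi_g := epi_arrowCoker_iff.1 inferInstance }
  · intro h
    have sq : CommSq X.hom f.left f.right Y.hom := ⟨(Arrow.w f).symm⟩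
    have : Epi (Butterfly.strict f).diagonal.g := h.epi_g
    have hp : IsPushout X.hom f.left f.right Y.hom :=
      ⟨sq, ⟨sq.isColimitEquivIsColimitCokernelCofork.symm h.exact.gIsCokernel⟩⟩
    have : Epi (arrowKer f) := Abelian.epi_kernel_map_of_isPushout hp
    have : Mono (arrowKer f) := mono_arrowKer_iff.2 h.mono_f
    exact ⟨isIso_of_mono_of_epi (arrowKer f), isIso_cokernel_map_of_isPushout hp⟩

end TwoTerm

lemma Butterfly.exists_homotopy {X Y : Arrow A} {f g : X ⟶ Y} (h : strict f ≈ strict g) :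
    ∃ k : X.right ⟶ Y.left, X.hom ≫ k = g.left - f.left ∧ k ≫ Y.hom = g.right - f.right := by
  obtain ⟨e, hκ, hι, hσ, hρ⟩ := Setoid.symm h
  change biprod.lift X.hom (-g.left) ≫ e.hom = biprod.lift X.hom (-f.left) at hκ
  change biprod.inr ≫ e.hom = biprod.inr at hι
  change e.hom ≫ biprod.fst = biprod.fst at hσ
  change e.hom ≫ biprod.desc f.right Y.hom = biprod.desc g.right Y.hom at hρ
  refine ⟨biprod.inl ≫ e.hom ≫ biprod.snd, ?_, ?_⟩
  · have := hκ =≫ biprod.snd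
    rw [biprod.lift_snd, biprod.lift_eq] at this
    simp only [Preadditive.add_comp, Preadditive.neg_comp, Category.assoc, reassoc_of% hι,
      biprod.inr_snd, Category.comp_id] at this
    rw [← sub_eq_add_neg, sub_eq_iff_eq_add] at this
    rw [this, sub_eq_add_neg, add_comm]
  · have := biprod.inl ≫= hρ
    rw [biprod.inl_desc, biprod.desc_eq] at this
    simp only [Preadditive.comp_add, reassoc_of% hσ, biprod.inl_fst_assoc] at this
    rw [← this, add_sub_cancel_left, Category.assoc, Category.assoc]

namespace Tilt

variable {t : TorsionPair A} {X Y Z X' Y' : Tilt t}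

lemma shortExact_of_isIso (P : Butterfly X.arrow Y.arrow) [IsIso (toHom P)] :
    P.diagonal.ShortExact := by
  obtain ⟨τ⟩ := Factor.nonempty P
  have hincl : strictHom (X := τ.ker) (Y := X) τ.incl = 0 :=
    zero_of_comp_mono (toHom P) τ.incl_comp
  have hproj : strictHom (X := Y) (Y := τ.coker) τ.proj = 0 :=
    zero_of_epi_comp (toHom P) τ.comp_proj
  have hk : IsIso τ.k :=
    isIso_of_id_eq_zero (X := τ.ker) (τ.incl_cancel (by rw [hincl, comp_zero, comp_zero]))
  have hb : IsIso τ.b :=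
    isIso_of_id_eq_zero (X := τ.coker) (τ.proj_cancel (by rw [hproj, zero_comp, zero_comp]))
  have hS : (ShortComplex.mk τ.a (cokernel.π τ.a) (cokernel.condition _)).ShortExact :=
    { exact := ShortComplex.exact_cokernel τ.a }
  have e : ShortComplex.mk τ.a (cokernel.π τ.a) (cokernel.condition _) ≅ P.diagonal :=
    ShortComplex.isoMk (asIso τ.k).symm (Iso.refl _) (asIso τ.b) (by simp) (by simp)
  exact ShortComplex.shortExact_of_iso e hS

lemma isIso_strictHom_iff (f : X.arrow ⟶ Y.arrow) :
    IsIso (strictHom f : X ⟶ Y) ↔ arrowQis A f := by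
  rw [arrowQis_iff_shortExact]
  refine ⟨fun h => ?_, isIso_toHom _⟩
  have : IsIso (toHom (X := X) (Y := Y) (Butterfly.strict f)) := h
  exact shortExact_of_isIso _

lemma IsLink.comp_eq_zero {P : Butterfly X.arrow Y.arrow} {Q : Butterfly Y.arrow Z.arrow}
    {δ : P.E ⟶ Q.E} (h : IsLink P Q δ) : toHom P ≫ toHom Q = 0 := by
  obtain ⟨r, hr⟩ := Q.exists_lift (pullback.snd P.ρ Q.σ - pullback.fst _ _ ≫ δ) (by
    rw [Preadditive.sub_comp, Category.assoc, h.δ_σ, pullback.condition, sub_self])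
  have hrρ : r ≫ Z.arrow.hom = pullback.snd _ _ ≫ Q.ρ := by
    rw [← Q.ι_ρ, ← Category.assoc, hr, Preadditive.sub_comp, Category.assoc,
      h.δ_ρ, comp_zero, sub_zero]
  refine (toHom_comp P Q).trans (toHom_eq_iff.2
    (Butterfly.comp_equiv (biprod.lift (pullback.fst _ _ ≫ P.σ) r) ?_ ?_ ?_ ?_ ?_))
  · apply biprod.hom_ext
    · simp
    · simp [← cancel_mono Q.ι, hr, h.ι_δ]
  · apply biprod.hom_ext
    · simp
    · simp [← cancel_mono Q.ι, hr, h.κ_δ]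
  · apply biprod.hom_ext
    · simp
    · simp [← cancel_mono Q.ι, hr]
  · simp
  · simp [biprod.lift_desc, hrρ]

lemma IsMap.comm {P : Butterfly X.arrow Y.arrow} {Q : Butterfly X'.arrow Y'.arrow}
    {f : X.arrow ⟶ X'.arrow} {g : Y.arrow ⟶ Y'.arrow} {s : P.E ⟶ Q.E} (h : IsMap P Q f g s) :
    (strictHom f : X ⟶ X') ≫ toHom Q = toHom P ≫ (strictHom g : Y ⟶ Y') := by
  have hw : (P.σ ≫ biprod.inl) ≫ (Butterfly.strict f).ρ = s ≫ Q.σ := by simp [h.s_σ]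
  have hκ : P.κ ≫ pullback.lift (P.σ ≫ biprod.inl) s hw =
      pullback.lift (Butterfly.strict f).κ 0 (by simp) +
        f.left ≫ Butterfly.compι (Butterfly.strict f) Q := by
    apply pullback.hom_ext
    · apply biprod.hom_ext <;> simp
    · simp [h.κ_s]
  refine (comp_strictHom_eq (R := (Butterfly.strict f).comp Q)).2
    ⟨pullback.lift (P.σ ≫ biprod.inl) s hw ≫ cokernel.π _, ?_, ?_, ?_, ?_⟩ |>.symm
  · rw [← Category.assoc, hκ]
    simp
  · simp only [← Category.assoc]
    congr 1
    apply pullback.hom_ext <;> simp [h.ι_s]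
  · simp
  · simp [h.s_ρ]

end Tilt

section RoofPath

variable {X Y : Arrow A}

namespace Butterfly

variable (P : Butterfly X Y)

/-- The two-term complex `X⁻¹ ⊞ Y⁻¹ ⟶ E` of a butterfly from `X` to `Y` with centre `E`. It
turns the butterfly into a roof of morphisms of two-term complexes. -/
abbrev roof : Arrow A := Arrow.mk (biprod.desc P.κ P.ι)

/-- The first leg of the roof of a butterfly. -/
abbrev roofFst : P.roof ⟶ X :=
  Arrow.homMk biprod.fst P.σ (by apply biprod.hom_ext' <;> simp)

/-- The second leg of the roof of a butterfly. -/
abbrev roofSnd : P.roof ⟶ Y :=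
  Arrow.homMk biprod.snd P.ρ (by apply biprod.hom_ext' <;> simp)

lemma arrowQis_roofFst : arrowQis A P.roofFst := by
  rw [arrowQis_iff_shortExact]
  refine ShortComplex.ShortExact.mk' ?_ ?_ ?_
  · rw [ShortComplex.exact_iff_exact_up_to_refinements]
    intro T z (hz : z ≫ biprod.desc P.σ X.hom = 0)
    obtain ⟨a, b, rfl⟩ : ∃ (a : T ⟶ P.E) (b : T ⟶ X.left), z = biprod.lift a b :=
      ⟨z ≫ biprod.fst, z ≫ biprod.snd, by apply biprod.hom_ext <;> simp⟩
    rw [biprod.lift_desc] at hz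
    obtain ⟨y, hy⟩ := P.exists_lift (a + b ≫ P.κ) (by simpa using hz)
    refine ⟨T, 𝟙 _, inferInstance, biprod.lift (-b) y, ?_⟩
    change 𝟙 T ≫ biprod.lift a b =
      biprod.lift (-b) y ≫ biprod.lift (biprod.desc P.κ P.ι) (-biprod.fst)
    apply biprod.hom_ext <;> simp [biprod.lift_desc, hy]
  · change Mono (biprod.lift (biprod.desc P.κ P.ι) (-biprod.fst))
    rw [Preadditive.mono_iff_cancel_zero]
    intro T z hz
    obtain ⟨a, b, rfl⟩ : ∃ (a : T ⟶ X.left) (b : T ⟶ Y.left), z = biprod.lift a b :=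
      ⟨z ≫ biprod.fst, z ≫ biprod.snd, by apply biprod.hom_ext <;> simp⟩
    have ha : a = 0 := by simpa using hz =≫ biprod.snd
    have hb : b ≫ P.ι = 0 := by simpa [biprod.lift_desc, ha] using hz =≫ biprod.fst
    rw [ha, zero_of_comp_mono P.ι hb]
    apply biprod.hom_ext <;> simp
  · exact epi_of_epi_fac (biprod.inl_desc P.σ X.hom)

lemma strict_roofFst_comp : (strict P.roofFst).comp P ≈ strict P.roofSnd := by
  refine strict_comp_iff.2 ⟨biprod.desc (𝟙 _) P.ι, ?_, ?_, ?_, ?_⟩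
  · apply biprod.hom_ext' <;> simp [biprod.lift_desc]
  · simp
  · apply biprod.hom_ext' <;> simp
  · apply biprod.hom_ext' <;> simp

end Butterfly

variable (Y) in
/-- The path object `Y⁻¹ ⊞ Y⁻¹ ⟶ Y⁰ ⊞ Y⁻¹` of a two-term complex: a point of it in degree `0` is
a starting point together with a step. -/
abbrev arrowPath : Arrow A :=
  Arrow.mk (biprod.lift (biprod.fst ≫ Y.hom) (biprod.snd - biprod.fst) :
    Y.left ⊞ Y.left ⟶ Y.right ⊞ Y.left)

namespace arrowPath

variable (Y) in
/-- The inclusion of the constant paths. -/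
abbrev const : Y ⟶ arrowPath Y :=
  Arrow.homMk (biprod.lift (𝟙 _) (𝟙 _)) biprod.inl (by apply biprod.hom_ext <;> simp)

variable (Y) in
/-- The starting point of a path. -/
abbrev source : arrowPath Y ⟶ Y :=
  Arrow.homMk biprod.fst biprod.fst (by simp)

variable (Y) in
/-- The end point of a path. -/
abbrev target : arrowPath Y ⟶ Y :=
  Arrow.homMk biprod.snd (biprod.desc (𝟙 _) Y.hom) (by simp [biprod.lift_desc])

lemma const_source : const Y ≫ source Y = 𝟙 Y := by
  apply Arrow.hom_ext <;> simp

lemma const_target : const Y ≫ target Y = 𝟙 Y := by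
  apply Arrow.hom_ext <;> simp

variable (Y) in
lemma arrowQis_const : arrowQis A (const Y) := by
  rw [arrowQis_iff_shortExact]
  refine ShortComplex.Splitting.shortExact
    { r := -(biprod.snd ≫ biprod.fst)
      s := biprod.desc biprod.inl (biprod.inr ≫ biprod.inr)
      f_r := by simp
      s_g := by apply biprod.hom_ext' <;> apply biprod.hom_ext <;> simp
      id := ?_ }
  change (-(biprod.snd ≫ biprod.fst)) ≫
    biprod.lift Y.hom (-biprod.lift (𝟙 Y.left) (𝟙 Y.left)) +
    biprod.desc biprod.inl (biprod.lift (biprod.fst ≫ Y.hom) (biprod.snd - biprod.fst)) ≫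
      biprod.desc biprod.inl (biprod.inr ≫ biprod.inr) = 𝟙 _
  refine biprod.hom_ext' _ _ ?_ (biprod.hom_ext' _ _ ?_ ?_) <;>
    exact biprod.hom_ext _ _ (by simp) (biprod.hom_ext _ _ (by simp) (by simp))

variable {f g : X ⟶ Y} (k : X.right ⟶ Y.left)

/-- The map to the path object given by a homotopy. -/
abbrev ofHomotopy (h : X.hom ≫ k = g.left - f.left) : X ⟶ arrowPath Y :=
  Arrow.homMk (biprod.lift f.left g.left) (biprod.lift f.right k)
    (by apply biprod.hom_ext <;> simp [h])

lemma ofHomotopy_source (h : X.hom ≫ k = g.left - f.left) : ofHomotopy k h ≫ source Y = f := by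
  apply Arrow.hom_ext <;> simp

lemma ofHomotopy_target (h : X.hom ≫ k = g.left - f.left)
    (h' : k ≫ Y.hom = g.right - f.right) : ofHomotopy k h ≫ target Y = g := by
  apply Arrow.hom_ext <;> simp [biprod.lift_desc, h']

end arrowPath

end RoofPath

namespace Tilt

variable {t : TorsionPair A} {X Y : Tilt t}

/-- The object of `B` given by a two-term complex with a quasi-isomorphism to an object of `B`. -/
def ofQisTo {Z : Arrow A} (f : Z ⟶ Y.arrow) (hf : arrowQis A f) : Tilt t where
  arrow := Z
  ker_mem :=
    have : IsIso (arrowKer f) := hf.1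
    t.F_iso (asIso (arrowKer f)).symm Y.ker_mem
  coker_mem :=
    have : IsIso (arrowCoker f) := hf.2
    t.T_iso (asIso (arrowCoker f)).symm Y.coker_mem

/-- The object of `B` given by a two-term complex with a quasi-isomorphism from an object of `B`. -/
def ofQisFrom {Z : Arrow A} (f : X.arrow ⟶ Z) (hf : arrowQis A f) : Tilt t where
  arrow := Z
  ker_mem :=
    have : IsIso (arrowKer f) := hf.1
    t.F_iso (asIso (arrowKer f)) X.ker_mem
  coker_mem :=
    have : IsIso (arrowCoker f) := hf.2
    t.T_iso (asIso (arrowCoker f)) X.coker_mem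

/-- The roof of a butterfly as an object of `B`. -/
def roof (P : Butterfly X.arrow Y.arrow) : Tilt t := ofQisTo P.roofFst P.arrowQis_roofFst

/-- The first leg of the roof of a butterfly as an isomorphism of `B`. -/
def roofIso (P : Butterfly X.arrow Y.arrow) : roof P ≅ X :=
  haveI := (isIso_strictHom_iff (X := roof P) P.roofFst).2 P.arrowQis_roofFst
  asIso (strictHom P.roofFst)

lemma roofIso_hom_comp (P : Butterfly X.arrow Y.arrow) :
    (roofIso P).hom ≫ toHom P = strictHom P.roofSnd :=
  toHom_eq_iff.2 P.strict_roofFst_comp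

/-- The path object of an object of `B`. -/
def path (Y : Tilt t) : Tilt t := ofQisFrom _ (arrowPath.arrowQis_const Y.arrow)

/-- The inclusion of the constant paths as an isomorphism of `B`. -/
def pathIso (Y : Tilt t) : Y ≅ path Y :=
  haveI := (isIso_strictHom_iff (Y := path Y) _).2 (arrowPath.arrowQis_const Y.arrow)
  asIso (strictHom (arrowPath.const Y.arrow))

lemma strictHom_eq_pathIso_inv {q : (path Y).arrow ⟶ Y.arrow}
    (hq : arrowPath.const Y.arrow ≫ q = 𝟙 _) : strictHom q = (pathIso Y).inv := by
  rw [← cancel_epi (pathIso Y).hom, Iso.hom_inv_id, ← strictHom_id, ← hq]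
  exact strictHom_comp _ _

lemma strictHom_ofHomotopy {f g : X.arrow ⟶ Y.arrow} (k : X.arrow.right ⟶ Y.arrow.left)
    (h : X.arrow.hom ≫ k = g.left - f.left) :
    strictHom (arrowPath.ofHomotopy k h) = strictHom f ≫ (pathIso Y).hom := by
  rw [← Iso.comp_inv_eq, ← strictHom_eq_pathIso_inv arrowPath.const_source]
  exact (strictHom_comp _ _).trans (congrArg strictHom (arrowPath.ofHomotopy_source k h))

end Tilt

section Transport

variable {C : Type*} [Category C] [HasZeroMorphisms C] {ι : Type*} {c : ComplexShape ι}
  (K : HomologicalComplex C c) (Z : ι → C) (e : ∀ n, Z n ≅ K.X n)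

/-- The complex structure transported along isomorphisms to the terms of a complex. -/
def transport : HomologicalComplex C c where
  X := Z
  d i j := (e i).hom ≫ K.d i j ≫ (e j).inv
  shape i j h := by rw [K.shape i j h, zero_comp, comp_zero]

/-- The given isomorphisms as an isomorphism of complexes. -/
def transportIso : transport K Z e ≅ K :=
  HomologicalComplex.Hom.isoOfComponents e fun _ _ _ => by
    dsimp only [transport]
    simp

end Transport

namespace StrictComplex

open HRS.Tilt

variable {t : TorsionPair A} {X Y : StrictComplex t}

/-- A morphism of complexes in `B` with chosen strict representatives of its components. -/
def homMk (ψ : X.cx ⟶ Y.cx) (f : ∀ n, (X.cx.X n).arrow ⟶ (Y.cx.X n).arrow)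
    (h : ∀ n, strictHom (f n) = ψ.f n) : X ⟶ Y where
  f := f
  comm i j := by rw [h, h, ψ.comm]

lemma incl_map_homMk (ψ : X.cx ⟶ Y.cx) (f : ∀ n, (X.cx.X n).arrow ⟶ (Y.cx.X n).arrow)
    (h : ∀ n, strictHom (f n) = ψ.f n) : (incl t).map (homMk ψ f h) = ψ :=
  HomologicalComplex.hom_ext _ _ h

instance : (incl t).EssSurj := ⟨fun K => ⟨⟨K⟩, ⟨Iso.refl _⟩⟩⟩

lemma isIso_incl_map_iff (φ : X ⟶ Y) :
    IsIso ((incl t).map φ) ↔ ∀ n, arrowQis A (φ.f n) := by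
  simp only [← isIso_strictHom_iff]
  refine ⟨fun _ n => inferInstanceAs (IsIso (((incl t).map φ).f n)), fun h => ?_⟩
  have (n : ℤ) : IsIso (((incl t).map φ).f n) := h n
  exact HomologicalComplex.Hom.isIso_of_components _

variable (t) in
lemma hasRoofs_incl : HasRoofs (incl t) := by
  intro X Y (φ : X.cx ⟶ Y.cx)
  let P n : Butterfly (X.cx.X n).arrow (Y.cx.X n).arrow := out (φ.f n)
  let e := transportIso X.cx (fun n => roof (P n)) fun n => roofIso (P n)
  let R : StrictComplex t := ⟨transport X.cx _ fun n => roofIso (P n)⟩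
  let s : R ⟶ X := homMk e.hom (fun n => (P n).roofFst) fun n => rfl
  let f : R ⟶ Y := homMk (e.hom ≫ φ) (fun n => (P n).roofSnd) fun n =>
    (roofIso_hom_comp (P n)).symm.trans (congrArg ((roofIso (P n)).hom ≫ ·) (toHom_out _))
  have hs : (incl t).map s = e.hom := incl_map_homMk _ _ _
  have hf : (incl t).map f = e.hom ≫ φ := incl_map_homMk _ _ _
  exact ⟨R, s, f, hs ▸ e.isIso_hom, (congrArg (· ≫ φ) hs).trans hf.symm⟩

variable (t) in
lemma hasPaths_incl : HasPaths (incl t) := by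
  intro X Y f g hfg
  choose k hk hk' using fun n => Butterfly.exists_homotopy
    (toHom_eq_iff.1 (HomologicalComplex.congr_hom hfg n))
  let e := transportIso Y.cx (fun n => path (Y.cx.X n)) fun n => (pathIso (Y.cx.X n)).symm
  let P : StrictComplex t := ⟨transport Y.cx _ fun n => (pathIso (Y.cx.X n)).symm⟩
  let path : HomotopicalAlgebra.PrepathObject Y :=
    { P := P
      ι := homMk e.inv (fun n => arrowPath.const _) fun n => rfl
      p₀ := homMk e.hom (fun n => arrowPath.source _) fun n =>
        strictHom_eq_pathIso_inv arrowPath.const_source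
      p₁ := homMk e.hom (fun n => arrowPath.target _) fun n =>
        strictHom_eq_pathIso_inv arrowPath.const_target
      ι_p₀ := Hom.ext (funext fun n => arrowPath.const_source)
      ι_p₁ := Hom.ext (funext fun n => arrowPath.const_target) }
  refine ⟨path,
    { h := homMk ((incl t).map f ≫ e.inv) (fun n => arrowPath.ofHomotopy (k n) (hk n))
        fun n => strictHom_ofHomotopy (k n) (hk n)
      h₀ := Hom.ext (funext fun n => arrowPath.ofHomotopy_source (k n) (hk n))
      h₁ := Hom.ext (funext fun n => arrowPath.ofHomotopy_target (k n) (hk n) (hk' n)) }, ?_⟩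
  have hι : (incl t).map path.ι = e.inv := incl_map_homMk _ _ fun _ => rfl
  exact hι ▸ e.isIso_inv

instance isLocalization_incl : (incl t).IsLocalization (invertedBy (incl t)) :=
  isLocalization_of_hasRoofs_of_hasPaths (hasRoofs_incl t) (hasPaths_incl t)

end StrictComplex

lemma factors_mk_arrow_comp_iff {C : Type*} [Category C] {U M N : C} {i : U ⟶ M} [Mono i]
    {g : M ⟶ N} {S : Subobject N} :
    S.Factors ((Subobject.mk i).arrow ≫ g) ↔ S.Factors (i ≫ g) := by
  refine ⟨fun h => ?_, fun h => ?_⟩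
  · simpa only [Subobject.underlyingIso_arrow_assoc] using
      Subobject.factors_of_factors_right (Subobject.underlyingIso i).inv h
  · simpa only [← Category.assoc, Subobject.underlyingIso_hom_comp_eq_mk] using
      Subobject.factors_of_factors_right (Subobject.underlyingIso i).hom h

lemma Tilt.isMap_of_isHom {t : TorsionPair A} {X Y : Tilt t} {P Q : Butterfly X.arrow Y.arrow}
    {e : P.E ⟶ Q.E} (he : Butterfly.IsHom P Q e) : IsMap P Q (𝟙 _) (𝟙 _) e where
  κ_s := he.κ.trans (Category.id_comp _).symm
  ι_s := he.ι.trans (Category.id_comp _).symm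
  s_σ := he.σ.trans (Category.comp_id _).symm
  s_ρ := he.ρ.trans (Category.comp_id _).symm

namespace Tot

section FullyFaithful

variable {t : TorsionPair A} {X Y : StrictComplex t}

instance : (Tot t).Faithful where
  map_injective {X Y φ ψ} h := by
    have hE (k : ℤ) : mapE φ k = mapE ψ k := by
      obtain ⟨n, rfl⟩ : ∃ n, k = n - 1 := ⟨k + 1, by lia⟩
      exact HomologicalComplex.congr_hom (congrArg (fun f => f.hom.map) h) n
    refine StrictComplex.Hom.ext (funext fun n => Arrow.hom_ext _ _ ?_ ?_)
    · obtain ⟨k, rfl⟩ : ∃ k, n = k + 1 := ⟨n - 1, by lia⟩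
      rw [← cancel_mono (wing Y k).ι, ← (isMap φ k).ι_s, ← (isMap ψ k).ι_s, hE]
    · rw [← cancel_epi (wing X n).σ, ← (isMap φ n).s_σ, ← (isMap ψ n).s_σ, hE]

lemma exists_isMap_of_comm (s : ∀ k, (wing X k).E ⟶ (wing Y k).E)
    (hδ : ∀ k, s k ≫ δ Y k = δ X k ≫ s (k + 1))
    (hι : ∀ k, ∃ l, l ≫ (wing Y k).ι = (wing X k).ι ≫ s k) :
    ∃ f : ∀ k, (X.cx.X k).arrow ⟶ (Y.cx.X k).arrow,
      ∀ k, Tilt.IsMap (wing X k) (wing Y k) (f k) (f (k + 1)) (s k) := by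
  choose l hl using hι
  choose r hr using fun k => (wing X k).exists_desc (s k ≫ (wing Y k).σ)
    (by rw [← reassoc_of% hl, Butterfly.ι_σ, comp_zero])
  let L := Equiv.piCongrLeft (fun n => (X.cx.X n).arrow.left ⟶ (Y.cx.X n).arrow.left)
    (Equiv.addRight 1) l
  have hL (k : ℤ) : L (k + 1) = l k := Equiv.piCongrLeft_apply_apply _ _ _ k
  have hκ (k : ℤ) : (wing X k).κ ≫ s k = L k ≫ (wing Y k).κ := by
    obtain ⟨m, rfl⟩ : ∃ m, k = m + 1 := ⟨k - 1, by lia⟩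
    rw [← (isLink X m).ι_δ, ← (isLink Y m).ι_δ, Category.assoc, ← hδ, hL, reassoc_of% hl]
  have hw (k : ℤ) : L k ≫ (Y.cx.X k).arrow.hom = (X.cx.X k).arrow.hom ≫ r k := by
    rw [← (wing Y k).κ_σ, ← (wing X k).κ_σ, Category.assoc, hr, ← reassoc_of% hκ]
  refine ⟨fun k => Arrow.homMk (L k) (r k) (hw k), fun k => ⟨hκ k, ?_, (hr k).symm, ?_⟩⟩
  · exact (hl k).symm.trans (congrArg (· ≫ _) (hL k).symm)
  · change _ = _ ≫ r (k + 1)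
    rw [← (isLink X k).δ_σ, ← (isLink Y k).δ_σ, Category.assoc, hr, reassoc_of% hδ]

lemma exists_mapE_eq (s : ∀ k, (wing X k).E ⟶ (wing Y k).E)
    (hδ : ∀ k, s k ≫ δ Y k = δ X k ≫ s (k + 1))
    (hι : ∀ k, ∃ l, l ≫ (wing Y k).ι = (wing X k).ι ≫ s k) :
    ∃ φ : X ⟶ Y, ∀ k, mapE φ k = s k := by
  obtain ⟨f, hf⟩ := exists_isMap_of_comm s hδ hι
  have comm (i j : ℤ) : Tilt.strictHom (f i) ≫ Y.cx.d i j = X.cx.d i j ≫ Tilt.strictHom (f j) := by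
    by_cases h : i + 1 = j
    · subst h
      simpa only [Tilt.toHom_out] using (hf i).comm
    · rw [X.cx.shape i j h, Y.cx.shape i j h, zero_comp, comp_zero]
  exact ⟨⟨f, comm⟩, fun k => (isMap _ k).unique (hf k)⟩

instance : (Tot t).Full where
  map_surjective {X Y} g := by
    let s := Equiv.piCongrLeft (fun k => (wing X k).E ⟶ (wing Y k).E) (Equiv.subRight 1)
      fun n => g.hom.map.f n
    have hs (n : ℤ) : s (n - 1) = g.hom.map.f n := Equiv.piCongrLeft_apply_apply _ _ _ n
    have hd (k l : ℤ) : s k ≫ (aux Y).d k l = (aux X).d k l ≫ s l := by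
      obtain ⟨n, rfl⟩ : ∃ n, k = n - 1 := ⟨k + 1, by lia⟩
      obtain ⟨m, rfl⟩ : ∃ m, l = m - 1 := ⟨l + 1, by lia⟩
      rw [hs, hs]
      exact g.hom.map.comm n m
    have hι (k : ℤ) : ∃ l, l ≫ (wing Y k).ι = (wing X k).ι ≫ s k := by
      obtain ⟨n, rfl⟩ : ∃ n, k = n - 1 := ⟨k + 1, by lia⟩
      rw [hs]
      exact (Subobject.mk_factors_iff _ _).1 (factors_mk_arrow_comp_iff.1 (g.hom.factors n))
    obtain ⟨φ, hφ⟩ := exists_mapE_eq s (fun k => by simpa only [← aux_d] using hd k (k + 1)) hι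
    exact ⟨φ, ObjectProperty.hom_ext _ (Decorated.Hom.ext (HomologicalComplex.hom_ext _ _
      fun n => (hφ (n - 1)).trans (hs n)))⟩

end FullyFaithful

section EssSurj

variable {t : TorsionPair A} (E : CompatibleComplex t)

/-- The two-term complex `Mᵏ ⟶ Eᵏ⁺¹ / Mᵏ⁺¹` of a compatibly decorated complex, as an object
of `B`. -/
abbrev term (k : ℤ) : Tilt t where
  arrow := Arrow.mk (E.obj.two k)
  ker_mem := (E.property k).1
  coker_mem := (E.property k).2

/-- The butterfly with centre `Eᵏ⁺¹` between the successive terms of a compatibly decorated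
complex. -/
abbrev termWing (k : ℤ) : Butterfly (term E k).arrow (term E (k + 1)).arrow where
  E := E.obj.cx.X (k + 1)
  κ := (E.obj.sub k).arrow ≫ E.obj.cx.d k (k + 1)
  ι := (E.obj.sub (k + 1)).arrow
  σ := cokernel.π (E.obj.sub (k + 1)).arrow
  ρ := E.obj.cx.d (k + 1) (k + 1 + 1) ≫ cokernel.π (E.obj.sub (k + 1 + 1)).arrow
  κ_σ := Category.assoc _ _ _
  ι_ρ := rfl
  κ_ρ := by simp
  ι_σ := cokernel.condition _
  shortExact :=
    { exact := ShortComplex.exact_cokernel _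
      mono_f := inferInstanceAs (Mono (E.obj.sub (k + 1)).arrow)
      epi_g := inferInstanceAs (Epi (cokernel.π _)) }

lemma termWing_isLink (k : ℤ) :
    Tilt.IsLink (termWing E k) (termWing E (k + 1)) (E.obj.cx.d (k + 1) (k + 1 + 1)) where
  κ_δ := by simp
  ι_δ := rfl
  δ_σ := rfl
  δ_ρ := by simp

/-- The complex in `B` of a compatibly decorated complex: a preimage under `Tot`, up to
isomorphism. -/
abbrev ofDecorated : StrictComplex t where
  cx := CochainComplex.of (term E) (fun k => Tilt.toHom (termWing E k))
    fun k => (termWing_isLink E k).comp_eq_zero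

lemma wing_ofDecorated_equiv (k : ℤ) : wing (ofDecorated E) k ≈ termWing E k :=
  Tilt.toHom_eq_iff.1 ((Tilt.toHom_out _).trans
    (CochainComplex.of_d (term E) (fun k => Tilt.toHom (termWing E k)) k))

/-- The centre of the butterfly of the differential of `ofDecorated E` out of degree `k` is
`Eᵏ⁺¹`; the index `l` stands for `k + 1`. -/
def centreIso (k l : ℤ) (h : k + 1 = l) : (wing (ofDecorated E) k).E ≅ E.obj.cx.X l :=
  (wing_ofDecorated_equiv E k).choose ≪≫ E.obj.cx.XIsoOfEq h

lemma isHom_centreIso (k : ℤ) :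
    Butterfly.IsHom (wing (ofDecorated E) k) (termWing E k) (centreIso E k _ rfl).hom := by
  rw [centreIso, HomologicalComplex.XIsoOfEq_rfl, Iso.trans_refl]
  exact (wing_ofDecorated_equiv E k).choose_spec

lemma centreIso_hom_comp_d (k l m n : ℤ) (hk : k + 1 = m) (hl : l + 1 = n) (hkl : k + 1 = l) :
    (centreIso E k m hk).hom ≫ E.obj.cx.d m n =
      (aux (ofDecorated E)).d k l ≫ (centreIso E l n hl).hom := by
  subst hk hkl hl
  rw [aux_d]
  exact (Tilt.isMap_of_isHom (isHom_centreIso E k)).link_comm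
    (Tilt.isMap_of_isHom (isHom_centreIso E (k + 1))) (isLink (ofDecorated E) k)
    (termWing_isLink E k)

lemma factors_centreIso_hom (k l : ℤ) (h : k + 1 = l) : (E.obj.sub l).Factors
    ((Subobject.mk (wing (ofDecorated E) k).ι).arrow ≫ (centreIso E k l h).hom) := by
  subst h
  rw [factors_mk_arrow_comp_iff, (isHom_centreIso E k).ι]
  exact Subobject.factors_self _

lemma factors_centreIso_inv (k l : ℤ) (h : k + 1 = l) :
    (Subobject.mk (wing (ofDecorated E) k).ι).Factors
      ((E.obj.sub l).arrow ≫ (centreIso E k l h).inv) := by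
  subst h
  refine (Subobject.mk_factors_iff _ _).2 ⟨𝟙 _, ?_⟩
  exact (Category.id_comp _).trans ((Iso.eq_comp_inv _).2 (isHom_centreIso E k).ι)

/-- A compatibly decorated complex is recovered from its complex in `B`. -/
def totOfDecoratedIso : (Tot t).obj (ofDecorated E) ≅ E :=
  let i : (decorated (ofDecorated E)).cx ≅ E.obj.cx :=
    HomologicalComplex.Hom.isoOfComponents
      (fun n => centreIso E (n - 1) n (sub_add_cancel n 1))
      fun n m (h : n + 1 = m) => centreIso_hom_comp_d E (n - 1) (m - 1) n m _ _ (by lia)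
  (compatible t).isoMk
    { hom := ⟨i.hom, fun n => factors_centreIso_hom E (n - 1) n _⟩
      inv := ⟨i.inv, fun n => factors_centreIso_inv E (n - 1) n _⟩
      hom_inv_id := Decorated.Hom.ext i.hom_inv_id
      inv_hom_id := Decorated.Hom.ext i.inv_hom_id }

instance : (Tot t).EssSurj := ⟨fun E => ⟨ofDecorated E, ⟨totOfDecoratedIso E⟩⟩⟩

instance isEquivalence : (Tot t).IsEquivalence where

end EssSurj

end Tot

namespace Decorated

/-- The two-term complex `Mⁿ ⟶ Eⁿ⁺¹ / Mⁿ⁺¹` as a functor. -/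
def twoFunctor (n : ℤ) : Decorated A ⥤ Arrow A where
  obj E := Arrow.mk (E.two n)
  map φ := Arrow.homMk (subMap φ n) (quotMap φ (n + 1)) (two_comm φ n).symm
  map_id E := by
    apply Arrow.hom_ext
    · refine (cancel_mono (E.sub n).arrow).1 ((subMap_arrow (𝟙 E) n).trans ?_)
      exact (Category.comp_id _).trans (Category.id_comp _).symm
    · refine (cancel_epi (cokernel.π (E.sub (n + 1)).arrow)).1 ((cokernel.π_desc _ _ _).trans ?_)
      exact (Category.id_comp _).trans (Category.comp_id _).symm
  map_comp {E F G} φ ψ := by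
    apply Arrow.hom_ext
    · refine (cancel_mono (G.sub n).arrow).1 ((subMap_arrow (φ ≫ ψ) n).trans ?_)
      change _ ≫ φ.map.f n ≫ ψ.map.f n = (subMap φ n ≫ subMap ψ n) ≫ _
      rw [Category.assoc, subMap_arrow, ← Category.assoc, ← Category.assoc, subMap_arrow]
    · refine (cancel_epi (cokernel.π (E.sub (n + 1)).arrow)).1 ((cokernel.π_desc _ _ _).trans ?_)
      change (φ.map.f (n + 1) ≫ ψ.map.f (n + 1)) ≫ _ =
        _ ≫ quotMap φ (n + 1) ≫ quotMap ψ (n + 1)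
      rw [quotMap, quotMap, cokernel.π_desc_assoc, Category.assoc, Category.assoc, cokernel.π_desc]

/-- The underlying complex of a decorated complex. -/
def forget : Decorated A ⥤ CochainComplex A ℤ where
  obj E := E.cx
  map φ := φ.map

end Decorated

section RespectsIso

variable {t : TorsionPair A}

instance : (sis t).RespectsIso :=
  MorphismProperty.RespectsIso.of_respects_arrow_iso _ fun _ _ e h n =>
    ((arrowQis A).arrow_mk_iso_iff
      (((compatible t).ι ⋙ Decorated.twoFunctor n).mapArrow.mapIso e)).1 (h n)

instance : (qis t).RespectsIso :=
  MorphismProperty.RespectsIso.of_respects_arrow_iso _ fun _ _ e h =>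
    ((HomologicalComplex.quasiIso A (ComplexShape.up ℤ)).arrow_mk_iso_iff
      (((compatible t).ι ⋙ Decorated.forget).mapArrow.mapIso e)).1 h

end RespectsIso

namespace Butterfly

variable {X Y : Arrow A} (P : Butterfly X Y)

/-- The quotient of the centre of a butterfly by the subobject given by `ι`. -/
def quotIso : cokernel (Subobject.mk P.ι).arrow ≅ X.right :=
  (cokernelIsCokernel _).coconePointUniqueUpToIso
    (isCokernelEpiComp P.shortExact.gIsCokernel (Subobject.underlyingIso P.ι).hom
      (Subobject.underlyingIso_hom_comp_eq_mk P.ι).symm)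

lemma π_quotIso_hom : cokernel.π _ ≫ P.quotIso.hom = P.σ :=
  cokernel.π_desc _ _ _

end Butterfly

namespace Tot

section Sis

variable {t : TorsionPair A} {X Y : StrictComplex t}

variable (X) in
/-- The two-term complex `Mⁿ ⟶ Eⁿ⁺¹ / Mⁿ⁺¹` of the decorated complex of `X`, with the indices
`k = n - 1` and `l = n` of the butterflies involved kept separate. -/
abbrev twoArrow (k l : ℤ) : Arrow A :=
  Arrow.mk ((Subobject.mk (wing X k).ι).arrow ≫ (aux X).d k l ≫
    cokernel.π (Subobject.mk (wing X l).ι).arrow)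

variable (X) in
/-- The two-term complexes of the decorated complex of `X` are the terms of `X`. -/
def twoIso (k : ℤ) : twoArrow X k (k + 1) ≅ (X.cx.X (k + 1)).arrow :=
  Arrow.isoMk (Subobject.underlyingIso (wing X k).ι) (wing X (k + 1)).quotIso (by
    change _ = (_ ≫ (aux X).d k (k + 1) ≫ _) ≫ _
    rw [aux_d, Category.assoc, Category.assoc, Butterfly.π_quotIso_hom,
      (isLink X k).δ_σ, ← Subobject.underlyingIso_hom_comp_eq_mk, Category.assoc, Butterfly.ι_ρ])

lemma arrowQis_twoArrow_iff (φ : X ⟶ Y) {k l : ℤ} (h : k + 1 = l)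
    (f : twoArrow X k l ⟶ twoArrow Y k l)
    (hl : f.left ≫ (Subobject.mk (wing Y k).ι).arrow =
      (Subobject.mk (wing X k).ι).arrow ≫ mapE φ k)
    (hr : cokernel.π _ ≫ f.right = mapE φ l ≫ cokernel.π _) :
    arrowQis A f ↔ arrowQis A (φ.f l) := by
  subst h
  refine (arrowQis A).arrow_mk_iso_iff
    (Arrow.isoMk (twoIso X k) (twoIso Y k) (Arrow.hom_ext _ _ ?_ ?_))
  · change (Subobject.underlyingIso (wing X k).ι).hom ≫ (φ.f (k + 1)).left =
      f.left ≫ (Subobject.underlyingIso (wing Y k).ι).hom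
    rw [← cancel_mono (wing Y k).ι, Category.assoc, Category.assoc,
      Subobject.underlyingIso_hom_comp_eq_mk, hl, ← (isMap φ k).ι_s,
      ← Subobject.underlyingIso_hom_comp_eq_mk, Category.assoc]
  · change (wing X (k + 1)).quotIso.hom ≫ (φ.f (k + 1)).right =
      f.right ≫ (wing Y (k + 1)).quotIso.hom
    rw [← cancel_epi (cokernel.π _), reassoc_of% hr, Butterfly.π_quotIso_hom, ← Category.assoc,
      Butterfly.π_quotIso_hom, (isMap φ (k + 1)).s_σ]

lemma sis_map_iff (φ : X ⟶ Y) : sis t ((Tot t).map φ) ↔ ∀ n, arrowQis A (φ.f n) := by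
  have two_iff (n : ℤ) : arrowQis A ((Decorated.twoFunctor n).map (decoratedMap φ)) ↔
      arrowQis A (φ.f (n + 1 - 1)) :=
    arrowQis_twoArrow_iff φ (by lia) _ (Decorated.subMap_arrow (decoratedMap φ) n)
      (cokernel.π_desc _ _ _)
  refine (forall_congr' two_iff).trans (forall_congr' fun n => ?_)
  rw [add_sub_cancel_right]

variable (t) in
lemma sis_inverseImage : (sis t).inverseImage (Tot t) = invertedBy (StrictComplex.incl t) := by
  ext X Y φ
  exact (sis_map_iff φ).trans (StrictComplex.isIso_incl_map_iff φ).symm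

end Sis

end Tot

lemma TorsionPair.isIso_τ₂_iff (t : TorsionPair A) {S S' : ShortComplex A} (φ : S ⟶ S')
    (hS : S.ShortExact) (hS' : S'.ShortExact) (hF : t.F S.X₃) (hT' : t.T S'.X₁) :
    IsIso φ.τ₂ ↔ IsIso φ.τ₁ ∧ IsIso φ.τ₃ := by
  constructor
  · intro _
    have := hS.mono_f
    have := hS'.mono_f
    have := hS.epi_g
    have := hS'.epi_g
    have h0 : (S'.f ≫ inv φ.τ₂) ≫ S.g = 0 := t.hom_eq_zero hT' hF _
    obtain ⟨u, hu⟩ : ∃ u, u ≫ S.f = S'.f ≫ inv φ.τ₂ := ⟨_, hS.exact.lift_f _ h0⟩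
    obtain ⟨v, hv⟩ : ∃ v, S'.g ≫ v = inv φ.τ₂ ≫ S.g :=
      ⟨_, hS'.exact.g_desc _ ((Category.assoc _ _ _).symm.trans h0)⟩
    refine ⟨⟨u, ?_, ?_⟩, ⟨v, ?_, ?_⟩⟩
    · rw [← cancel_mono S.f, Category.assoc, hu, φ.comm₁₂_assoc, IsIso.hom_inv_id,
        Category.comp_id, Category.id_comp]
    · rw [← cancel_mono S'.f, Category.assoc, φ.comm₁₂, reassoc_of% hu, IsIso.inv_hom_id,
        Category.comp_id, Category.id_comp]
    · rw [← cancel_epi S.g, ← φ.comm₂₃_assoc, hv, IsIso.hom_inv_id_assoc, Category.comp_id]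
    · rw [← cancel_epi S'.g, reassoc_of% hv, ← φ.comm₂₃, IsIso.inv_hom_id_assoc,
        Category.comp_id]
  · rintro ⟨_, _⟩
    exact ShortComplex.isIso₂_of_shortExact_of_isIso₁₃ φ hS hS'

/-- A factorization of the maps of a short complex `X₁ ⟶ X₂ ⟶ X₃` through a subobject `S₂` of `X₂`
with `im f ⊆ S₂ ⊆ ker g`, a quotient `Q` of `X₁` and a subobject `S₃` of `X₃`. It presents the
homology as an extension of `ker (r : X₂ / S₂ ⟶ S₃)` by `coker (l : Q ⟶ S₂)`. -/
structure Interpolation (S : ShortComplex A) where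
  (Q S₂ S₃ : A)
  π : S.X₁ ⟶ Q
  a : S₂ ⟶ S.X₂
  a₃ : S₃ ⟶ S.X₃
  l : Q ⟶ S₂
  r : cokernel a ⟶ S₃
  [epi_π : Epi π]
  [mono_a : Mono a]
  [mono_a₃ : Mono a₃]
  fac_f : π ≫ l ≫ a = S.f
  fac_g : cokernel.π a ≫ r ≫ a₃ = S.g

namespace Interpolation

attribute [instance] epi_π mono_a mono_a₃

variable {S S' : ShortComplex A} (I : Interpolation S) {I' : Interpolation S'}

/-- The inclusion of `S₂` in the cycles. -/
def toCycles : I.S₂ ⟶ S.cycles :=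
  S.liftCycles I.a (by rw [← I.fac_g, ← Category.assoc, cokernel.condition, zero_comp])

lemma toCycles_i : I.toCycles ≫ S.iCycles = I.a := S.liftCycles_i _ _

instance : Mono I.toCycles := mono_of_mono_fac I.toCycles_i

lemma π_l_toCycles : I.π ≫ I.l ≫ I.toCycles = S.toCycles := by
  rw [← cancel_mono S.iCycles, S.toCycles_i, Category.assoc, Category.assoc, toCycles_i, I.fac_f]

/-- The map from `S₂ / im f` to the homology. -/
def fromCoker : cokernel I.l ⟶ S.homology :=
  cokernel.desc _ (I.toCycles ≫ S.homologyπ) (by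
    rw [← cancel_epi I.π, reassoc_of% I.π_l_toCycles, S.toCycles_comp_homologyπ, comp_zero])

lemma π_fromCoker : cokernel.π I.l ≫ I.fromCoker = I.toCycles ≫ S.homologyπ :=
  cokernel.π_desc _ _ _

/-- The map from the cycles to `ker g / S₂`. -/
def cyclesToKer : S.cycles ⟶ kernel I.r :=
  kernel.lift _ (S.iCycles ≫ cokernel.π I.a) (by
    rw [← cancel_mono I.a₃, zero_comp, Category.assoc, Category.assoc, I.fac_g, S.iCycles_g])

lemma cyclesToKer_ι : I.cyclesToKer ≫ kernel.ι _ = S.iCycles ≫ cokernel.π I.a :=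
  kernel.lift_ι _ _ _

lemma toCycles_cyclesToKer : I.toCycles ≫ I.cyclesToKer = 0 := by
  rw [← cancel_mono (kernel.ι _), Category.assoc, cyclesToKer_ι, ← Category.assoc, toCycles_i,
    cokernel.condition, zero_comp]

/-- The map from the homology to `ker g / S₂`. -/
def toKer : S.homology ⟶ kernel I.r :=
  S.descHomology I.cyclesToKer (by
    rw [← I.π_l_toCycles, Category.assoc, Category.assoc, toCycles_cyclesToKer, comp_zero,
      comp_zero])

lemma homologyπ_toKer : S.homologyπ ≫ I.toKer = I.cyclesToKer := S.π_descHomology _ _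

lemma fromCoker_toKer : I.fromCoker ≫ I.toKer = 0 := by
  rw [← cancel_epi (cokernel.π _), reassoc_of% I.π_fromCoker, homologyπ_toKer,
    toCycles_cyclesToKer, comp_zero]

/-- The homology as an extension of `ker g / S₂` by `S₂ / im f`. -/
abbrev sequence : ShortComplex A := ShortComplex.mk I.fromCoker I.toKer I.fromCoker_toKer

instance : Mono I.fromCoker := by
  rw [Preadditive.mono_iff_cancel_zero]
  intro T x hx
  obtain ⟨T', p, hp, y, hy⟩ := surjective_up_to_refinements_of_epi (cokernel.π I.l) x
  have hy0 : (y ≫ I.toCycles) ≫ S.homologyπ = 0 := by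
    rw [Category.assoc, ← π_fromCoker, ← reassoc_of% hy, hx, comp_zero]
  obtain ⟨T'', q, hq, z, hz⟩ :=
    (CokernelCofork.IsColimit.comp_π_eq_zero_iff_up_to_refinements S.homologyIsCokernel _).1 hy0
  have hyz : q ≫ y = (z ≫ I.π) ≫ I.l := by
    rw [← cancel_mono I.toCycles, Category.assoc, Category.assoc, Category.assoc, hz,
      π_l_toCycles]
  rw [← cancel_epi p, ← cancel_epi q, hy, reassoc_of% hyz, cokernel.condition, comp_zero,
    comp_zero, comp_zero, comp_zero]

instance : Epi I.cyclesToKer := by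
  rw [epi_iff_surjective_up_to_refinements]
  intro T x
  obtain ⟨T', p, hp, y, hy⟩ := surjective_up_to_refinements_of_epi (cokernel.π I.a)
    (x ≫ kernel.ι _)
  have hyg : y ≫ S.g = 0 := by
    rw [← I.fac_g, ← reassoc_of% hy, kernel.condition_assoc, zero_comp, comp_zero, comp_zero]
  refine ⟨T', p, hp, S.liftCycles y hyg, ?_⟩
  rw [← cancel_mono (kernel.ι _), Category.assoc, Category.assoc, cyclesToKer_ι, hy,
    S.liftCycles_i_assoc]

instance : Epi I.toKer := epi_of_epi_fac I.homologyπ_toKer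

lemma exact_sequence : I.sequence.Exact := by
  rw [ShortComplex.exact_iff_exact_up_to_refinements]
  intro T x (hx : x ≫ I.toKer = 0)
  obtain ⟨T', p, hp, z, hz⟩ := surjective_up_to_refinements_of_epi S.homologyπ x
  have hz0 : (z ≫ S.iCycles) ≫ cokernel.π I.a = 0 := by
    rw [Category.assoc, ← cyclesToKer_ι, ← homologyπ_toKer, Category.assoc, ← reassoc_of% hz,
      reassoc_of% hx, zero_comp, comp_zero]
  have hlift : Abelian.monoLift I.a _ hz0 ≫ I.toCycles = z := by
    rw [← cancel_mono S.iCycles, Category.assoc, toCycles_i, Abelian.monoLift_comp]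
  refine ⟨T', p, hp, Abelian.monoLift I.a _ hz0 ≫ cokernel.π _, ?_⟩
  change p ≫ x = (_ ≫ cokernel.π I.l) ≫ I.fromCoker
  rw [Category.assoc, π_fromCoker, reassoc_of% hlift, hz]

lemma shortExact_sequence : I.sequence.ShortExact where
  exact := I.exact_sequence
  mono_f := inferInstanceAs (Mono I.fromCoker)
  epi_g := inferInstanceAs (Epi I.toKer)

variable {I}

/-- The map of extensions induced by a map of short complexes compatible with interpolations. -/
abbrev mapSequence (φ : S ⟶ S') (u : Arrow.mk I.l ⟶ Arrow.mk I'.l)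
    (v : Arrow.mk I.r ⟶ Arrow.mk I'.r) (hu : u.right ≫ I'.a = I.a ≫ φ.τ₂)
    (hv : cokernel.π I.a ≫ v.left = φ.τ₂ ≫ cokernel.π I'.a) : I.sequence ⟶ I'.sequence where
  τ₁ := arrowCoker u
  τ₂ := ShortComplex.homologyMap φ
  τ₃ := arrowKer v
  comm₁₂ := by
    have hcycles : u.right ≫ I'.toCycles = I.toCycles ≫ ShortComplex.cyclesMap φ := by
      rw [← cancel_mono S'.iCycles, Category.assoc, toCycles_i, hu, Category.assoc,
        ShortComplex.cyclesMap_i, ← Category.assoc, toCycles_i]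
    have hπ : cokernel.π I.l ≫ arrowCoker u = u.right ≫ cokernel.π I'.l := π_arrowCoker u
    refine (cancel_epi (cokernel.π I.l)).1 ?_
    change cokernel.π I.l ≫ arrowCoker u ≫ I'.fromCoker = _ ≫ I.fromCoker ≫ _
    rw [reassoc_of% hπ, π_fromCoker, reassoc_of% I.π_fromCoker,
      ShortComplex.homologyπ_naturality, reassoc_of% hcycles]
  comm₂₃ := by
    have hι : arrowKer v ≫ kernel.ι I'.r = kernel.ι I.r ≫ v.left := arrowKer_ι v
    refine (cancel_epi S.homologyπ).1 ((cancel_mono (kernel.ι I'.r)).1 ?_)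
    change (_ ≫ _ ≫ I'.toKer) ≫ _ = (_ ≫ I.toKer ≫ arrowKer v) ≫ _
    rw [ShortComplex.homologyπ_naturality_assoc, homologyπ_toKer, Category.assoc, cyclesToKer_ι,
      reassoc_of% I.homologyπ_toKer, Category.assoc, hι, reassoc_of% I.cyclesToKer_ι, hv,
      ShortComplex.cyclesMap_i_assoc]

lemma quasiIso_iff {t : TorsionPair A} (φ : S ⟶ S') (hF : t.F (kernel I.r))
    (hT' : t.T (cokernel I'.l)) (u : Arrow.mk I.l ⟶ Arrow.mk I'.l)
    (v : Arrow.mk I.r ⟶ Arrow.mk I'.r) (hu : u.right ≫ I'.a = I.a ≫ φ.τ₂)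
    (hv : cokernel.π I.a ≫ v.left = φ.τ₂ ≫ cokernel.π I'.a) :
    ShortComplex.QuasiIso φ ↔ IsIso (arrowCoker u) ∧ IsIso (arrowKer v) := by
  rw [ShortComplex.quasiIso_iff]
  exact t.isIso_τ₂_iff (mapSequence φ u v hu hv) I.shortExact_sequence I'.shortExact_sequence
    hF hT'

end Interpolation

lemma f'_comp_eq_of_comp_i_eq {C : Type*} [Category* C] [HasZeroMorphisms C]
    {S S₁ : ShortComplex C} {φ : S ⟶ S₁} {D : S.LeftHomologyData} {D₁ : S₁.LeftHomologyData}
    {φK : D.K ⟶ D₁.K} (h : φK ≫ D₁.i = D.i ≫ φ.τ₂) : D.f' ≫ φK = φ.τ₁ ≫ D₁.f' := by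
  rw [← cancel_mono D₁.i, Category.assoc, h, D.f'_i_assoc, Category.assoc, D₁.f'_i, φ.comm₁₂]

namespace Tilt

variable {t : TorsionPair A}

section

variable {X Y Z : Tilt t} {P : Butterfly X.arrow Y.arrow} {Q : Butterfly Y.arrow Z.arrow}
  {δ : P.E ⟶ Q.E}

namespace IsLink

lemma a_δ (h : IsLink P Q δ) (τ : Factor P) : τ.a ≫ δ = 0 := by
  have hk : τ.k ≫ τ.a ≫ δ = 0 := by rw [← Category.assoc, τ.k_a, h.κ_δ]
  have : cokernel.desc τ.k _ hk = 0 := by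
    apply zero_of_torsion Q τ.coker_mem
    · rw [← cancel_epi (cokernel.π _), ← Category.assoc, cokernel.π_desc, Category.assoc, h.δ_σ]
      simp
    · rw [← cancel_epi (cokernel.π _), ← Category.assoc, cokernel.π_desc, Category.assoc, h.δ_ρ]
      simp
  rw [← cokernel.π_desc τ.k _ hk, this, comp_zero]

lemma δ_π (h : IsLink P Q δ) (τ' : Factor Q) : δ ≫ cokernel.π τ'.a = 0 := by
  have hb : (δ ≫ cokernel.π τ'.a) ≫ τ'.b = 0 := by simp [h.δ_ρ]
  have : kernel.lift τ'.b _ hb = 0 := by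
    apply zero_of_free P τ'.ker_mem
    · rw [← cancel_mono (kernel.ι _), Category.assoc, kernel.lift_ι, ← Category.assoc, h.κ_δ]
      simp
    · rw [← cancel_mono (kernel.ι _), Category.assoc, kernel.lift_ι, ← Category.assoc, h.ι_δ,
        τ'.κ_π, zero_comp]
  rw [← kernel.lift_ι τ'.b _ hb, this, zero_comp]

/-- A link factors through the subobject `S` of its target. -/
def lift (h : IsLink P Q δ) (τ' : Factor Q) : P.E ⟶ τ'.S := Abelian.monoLift τ'.a δ (h.δ_π τ')

lemma lift_a (h : IsLink P Q δ) (τ' : Factor Q) : h.lift τ' ≫ τ'.a = δ :=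
  Abelian.monoLift_comp τ'.a δ (h.δ_π τ')

lemma a_lift (h : IsLink P Q δ) (τ : Factor P) (τ' : Factor Q) : τ.a ≫ h.lift τ' = 0 := by
  rw [← cancel_mono τ'.a, Category.assoc, h.lift_a, h.a_δ, zero_comp]

/-- The butterfly from `X` to the kernel of `Q`. -/
abbrev toKer (h : IsLink P Q δ) (τ' : Factor Q) : Butterfly X.arrow τ'.ker.arrow where
  E := P.E
  κ := P.κ
  ι := P.ι
  σ := P.σ
  ρ := h.lift τ'
  κ_σ := P.κ_σ
  ι_ρ := by
    rw [← cancel_mono τ'.a, Category.assoc, h.lift_a, h.ι_δ]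
    exact τ'.k_a.symm
  κ_ρ := by rw [← cancel_mono τ'.a, Category.assoc, h.lift_a, h.κ_δ, zero_comp]
  ι_σ := P.ι_σ
  shortExact := P.shortExact

lemma toKer_incl (h : IsLink P Q δ) (τ' : Factor Q) :
    toHom (Y := τ'.ker) (h.toKer τ') ≫ strictHom (X := τ'.ker) (Y := Y) τ'.incl = toHom P := by
  refine comp_strictHom_eq.2 ⟨𝟙 _, by simp, by simp, by simp, ?_⟩
  change 𝟙 _ ≫ P.ρ = h.lift τ' ≫ τ'.a ≫ Q.σ
  rw [Category.id_comp, ← Category.assoc, h.lift_a, h.δ_σ]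

/-- The factor of `P` is also one of the butterfly to the kernel of `Q`. -/
abbrev factor (h : IsLink P Q δ) (τ : Factor P) (τ' : Factor Q) :
    Factor (X := X) (Y := τ'.ker) (h.toKer τ') where
  S := τ.S
  a := τ.a
  k := τ.k
  mono := τ.mono
  a_ρ := h.a_lift τ τ'
  k_a := τ.k_a
  coker_mem := τ.coker_mem
  ker_mem := t.F_kernel_of_comp _ (τ'.a ≫ Q.σ) τ.b (by
    rw [← cancel_epi (cokernel.π τ.a), cokernel.π_desc_assoc, cokernel.π_desc, ← Category.assoc]
    change (h.lift τ' ≫ τ'.a) ≫ Q.σ = P.ρ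
    rw [h.lift_a, h.δ_σ]) τ.ker_mem

/-- The homology `[E / S ⟶ S']` of two consecutive butterflies with subobjects `S ⊆ E` and
`S' ⊆ E'`. -/
abbrev homology (h : IsLink P Q δ) (τ : Factor P) (τ' : Factor Q) : Tilt t := (h.factor τ τ').coker

lemma π_homology_hom_a (h : IsLink P Q δ) (τ : Factor P) (τ' : Factor Q) :
    cokernel.π τ.a ≫ (h.homology τ τ').arrow.hom ≫ τ'.a = δ := by
  change cokernel.π τ.a ≫ cokernel.desc τ.a (h.lift τ') (h.a_lift τ τ') ≫ τ'.a = δ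
  rw [cokernel.π_desc_assoc, h.lift_a]

end IsLink

/-- The kernel of the morphism represented by a butterfly is `[X⁻¹ ⟶ S]`. -/
def Factor.isLimit (τ : Factor P) {f : X ⟶ Y} (hf : toHom P = f)
    (w : strictHom (X := τ.ker) (Y := X) τ.incl ≫ f = 0) :
    IsLimit (KernelFork.ofι (strictHom (X := τ.ker) (Y := X) τ.incl) w) :=
  Fork.IsLimit.ofExistsUnique fun s => by
    obtain ⟨l, hl⟩ := τ.exists_lift (q := s.ι) (by rw [hf]; exact KernelFork.condition s)
    exact ⟨l, hl, fun m hm => τ.incl_cancel (Eq.trans hm hl.symm)⟩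

/-- The cokernel of the morphism represented by a butterfly is `[E / S ⟶ Y⁰]`. -/
def Factor.isColimit (τ : Factor P) {f : X ⟶ Y} (hf : toHom P = f)
    (w : f ≫ strictHom (X := Y) (Y := τ.coker) τ.proj = 0) :
    IsColimit (CokernelCofork.ofπ (strictHom (X := Y) (Y := τ.coker) τ.proj) w) :=
  Cofork.IsColimit.ofExistsUnique fun s => by
    obtain ⟨l, hl⟩ := τ.exists_desc (q := s.π) (by rw [hf]; exact CokernelCofork.condition s)
    exact ⟨l, hl, fun m hm => τ.proj_cancel (Eq.trans hm hl.symm)⟩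

end

/-- The homology of a short complex in `Tilt t`, computed from butterflies that represent its two
maps. -/
def leftHomologyData (S : ShortComplex (Tilt t)) {P : Butterfly S.X₁.arrow S.X₂.arrow}
    {Q : Butterfly S.X₂.arrow S.X₃.arrow} (hP : toHom P = S.f) (hQ : toHom Q = S.g)
    {δ : P.E ⟶ Q.E} (h : IsLink P Q δ) (τ : Factor P) (τ' : Factor Q) : S.LeftHomologyData :=
  have wi : strictHom (X := τ'.ker) (Y := S.X₂) τ'.incl ≫ S.g = 0 := by
    rw [← hQ]; exact τ'.incl_comp
  have hf' : toHom (Y := τ'.ker) (h.toKer τ') =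
      (τ'.isLimit hQ wi).lift (KernelFork.ofι S.f S.zero) :=
    Fork.IsLimit.hom_ext (τ'.isLimit hQ wi)
      ((h.toKer_incl τ').trans (hP.trans
        ((τ'.isLimit hQ wi).fac (KernelFork.ofι S.f S.zero) WalkingParallelPair.zero).symm))
  have wπ : (τ'.isLimit hQ wi).lift (KernelFork.ofι S.f S.zero) ≫
      strictHom (X := τ'.ker) (Y := h.homology τ τ') (h.factor τ τ').proj = 0 := by
    rw [← hf']; exact (h.factor τ τ').comp_proj
  { K := τ'.ker
    H := h.homology τ τ'
    i := strictHom (X := τ'.ker) (Y := S.X₂) τ'.incl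
    π := strictHom (X := τ'.ker) (Y := h.homology τ τ') (h.factor τ τ').proj
    wi := wi
    hi := τ'.isLimit hQ wi
    wπ := wπ
    hπ := (h.factor τ τ').isColimit hf' wπ }

section

variable {X Y Z X₁ Y₁ Z₁ : Tilt t} {P : Butterfly X.arrow Y.arrow} {Q : Butterfly Y.arrow Z.arrow}
  {δ : P.E ⟶ Q.E} {P₁ : Butterfly X₁.arrow Y₁.arrow} {Q₁ : Butterfly Y₁.arrow Z₁.arrow}
  {δ₁ : P₁.E ⟶ Q₁.E} {f : X.arrow ⟶ X₁.arrow} {g : Y.arrow ⟶ Y₁.arrow} {l : Z.arrow ⟶ Z₁.arrow}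
  {s : P.E ⟶ P₁.E} {r : Q.E ⟶ Q₁.E}

namespace IsMap

lemma a_s_π (hs : IsMap P P₁ f g s) (τ : Factor P) (τ₁ : Factor P₁) :
    (τ.a ≫ s) ≫ cokernel.π τ₁.a = 0 := by
  have hb : ((τ.a ≫ s) ≫ cokernel.π τ₁.a) ≫ τ₁.b = 0 := by
    rw [Category.assoc, cokernel.π_desc, Category.assoc, hs.s_ρ, ← Category.assoc, τ.a_ρ,
      zero_comp]
  have hk : τ.k ≫ kernel.lift τ₁.b _ hb = 0 := by
    rw [← cancel_mono (kernel.ι _), Category.assoc, kernel.lift_ι, ← Category.assoc,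
      ← Category.assoc, τ.k_a, hs.κ_s, Category.assoc, τ₁.κ_π, comp_zero, zero_comp]
  have h0 : kernel.lift τ₁.b _ hb = 0 := by
    rw [← cokernel.π_desc τ.k _ hk, t.hom_eq_zero τ.coker_mem τ₁.ker_mem (cokernel.desc τ.k _ hk),
      comp_zero]
  rw [← kernel.lift_ι τ₁.b _ hb, h0, zero_comp]

/-- The map induced on the subobjects `S`. -/
def mapS (hs : IsMap P P₁ f g s) (τ : Factor P) (τ₁ : Factor P₁) : τ.S ⟶ τ₁.S :=
  Abelian.monoLift τ₁.a _ (hs.a_s_π τ τ₁)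

lemma mapS_a (hs : IsMap P P₁ f g s) (τ : Factor P) (τ₁ : Factor P₁) :
    hs.mapS τ τ₁ ≫ τ₁.a = τ.a ≫ s := Abelian.monoLift_comp _ _ _

/-- The map induced on the kernels `[X⁻¹ ⟶ S]`. -/
abbrev mapKer (hs : IsMap P P₁ f g s) (τ : Factor P) (τ₁ : Factor P₁) :
    τ.ker.arrow ⟶ τ₁.ker.arrow :=
  Arrow.homMk f.left (hs.mapS τ τ₁) (by
    change f.left ≫ τ₁.k = τ.k ≫ _
    rw [← cancel_mono τ₁.a, Category.assoc, τ₁.k_a, Category.assoc, mapS_a, ← Category.assoc,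
      τ.k_a, hs.κ_s])

/-- The map induced on the homology `[E / S ⟶ S']`. -/
abbrev mapHomology (hs : IsMap P P₁ f g s) (hr : IsMap Q Q₁ g l r) (h : IsLink P Q δ)
    (h₁ : IsLink P₁ Q₁ δ₁) (τ : Factor P) (τ₁ : Factor P₁) (τ' : Factor Q) (τ'₁ : Factor Q₁) :
    (h.homology τ τ').arrow ⟶ (h₁.homology τ₁ τ'₁).arrow :=
  Arrow.homMk (cokernel.map τ.a τ₁.a (hs.mapS τ τ₁) s (hs.mapS_a τ τ₁).symm) (hr.mapS τ' τ'₁) (by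
    change cokernel.map τ.a τ₁.a _ s _ ≫ cokernel.desc τ₁.a (h₁.lift τ'₁) _ =
      cokernel.desc τ.a (h.lift τ') _ ≫ hr.mapS τ' τ'₁
    rw [← cancel_epi (cokernel.π τ.a), cokernel.π_desc_assoc, cokernel.π_desc_assoc,
      Category.assoc, cokernel.π_desc, ← cancel_mono τ'₁.a, Category.assoc, h₁.lift_a,
      Category.assoc, mapS_a, ← Category.assoc, h.lift_a]
    exact hs.link_comm hr h h₁)

lemma mapKer_comp_incl (hs : IsMap P P₁ f g s) (τ : Factor P) (τ₁ : Factor P₁) :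
    hs.mapKer τ τ₁ ≫ τ₁.incl = τ.incl ≫ f := by
  apply Arrow.hom_ext
  · change f.left ≫ 𝟙 _ = 𝟙 _ ≫ f.left
    rw [Category.id_comp, Category.comp_id]
  · change hs.mapS τ τ₁ ≫ τ₁.a ≫ P₁.σ = (τ.a ≫ P.σ) ≫ f.right
    rw [← Category.assoc, mapS_a, Category.assoc, hs.s_σ, Category.assoc]

lemma proj_comp_mapHomology (hs : IsMap P P₁ f g s) (hr : IsMap Q Q₁ g l r) (h : IsLink P Q δ)
    (h₁ : IsLink P₁ Q₁ δ₁) (τ : Factor P) (τ₁ : Factor P₁) (τ' : Factor Q) (τ'₁ : Factor Q₁) :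
    (h.factor τ τ').proj ≫ hs.mapHomology hr h h₁ τ τ₁ τ' τ'₁ =
      hr.mapKer τ' τ'₁ ≫ (h₁.factor τ₁ τ'₁).proj := by
  apply Arrow.hom_ext
  · change (P.ι ≫ cokernel.π τ.a) ≫ cokernel.map τ.a τ₁.a (hs.mapS τ τ₁) s
        (hs.mapS_a τ τ₁).symm = g.left ≫ P₁.ι ≫ cokernel.π τ₁.a
    rw [Category.assoc, cokernel.π_desc, ← Category.assoc, hs.ι_s, Category.assoc]
  · change 𝟙 _ ≫ hr.mapS τ' τ'₁ = hr.mapS τ' τ'₁ ≫ 𝟙 _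
    rw [Category.id_comp, Category.comp_id]

end IsMap

end

section

variable {S S₁ : ShortComplex (Tilt t)} {P : Butterfly S.X₁.arrow S.X₂.arrow}
  {Q : Butterfly S.X₂.arrow S.X₃.arrow} {P₁ : Butterfly S₁.X₁.arrow S₁.X₂.arrow}
  {Q₁ : Butterfly S₁.X₂.arrow S₁.X₃.arrow} {δ : P.E ⟶ Q.E} {δ₁ : P₁.E ⟶ Q₁.E}
  {f : S.X₁.arrow ⟶ S₁.X₁.arrow} {g : S.X₂.arrow ⟶ S₁.X₂.arrow} {l : S.X₃.arrow ⟶ S₁.X₃.arrow}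
  {s : P.E ⟶ P₁.E} {r : Q.E ⟶ Q₁.E}

/-- The map on homology induced by a strict morphism of short complexes in `Tilt t`. -/
def leftHomologyMapData (φ : S ⟶ S₁) (hP : toHom P = S.f) (hQ : toHom Q = S.g)
    (hP₁ : toHom P₁ = S₁.f) (hQ₁ : toHom Q₁ = S₁.g) (h : IsLink P Q δ) (h₁ : IsLink P₁ Q₁ δ₁)
    (hs : IsMap P P₁ f g s) (hr : IsMap Q Q₁ g l r) (hg : φ.τ₂ = strictHom g)
    (τ : Factor P) (τ₁ : Factor P₁) (τ' : Factor Q) (τ'₁ : Factor Q₁) :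
    ShortComplex.LeftHomologyMapData φ (leftHomologyData S hP hQ h τ τ')
      (leftHomologyData S₁ hP₁ hQ₁ h₁ τ₁ τ'₁) :=
  have commi : strictHom (X := τ'.ker) (Y := τ'₁.ker) (hr.mapKer τ' τ'₁) ≫
      (leftHomologyData S₁ hP₁ hQ₁ h₁ τ₁ τ'₁).i =
        (leftHomologyData S hP hQ h τ τ').i ≫ φ.τ₂ := by
    rw [hg]
    exact (strictHom_comp _ _).trans
      ((congrArg strictHom (hr.mapKer_comp_incl τ' τ'₁)).trans (strictHom_comp _ _).symm)
  { φK := strictHom (X := τ'.ker) (Y := τ'₁.ker) (hr.mapKer τ' τ'₁)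
    φH := strictHom (X := h.homology τ τ') (Y := h₁.homology τ₁ τ'₁)
      (hs.mapHomology hr h h₁ τ τ₁ τ' τ'₁)
    commi := commi
    commf' := f'_comp_eq_of_comp_i_eq (D := leftHomologyData S hP hQ h τ τ')
      (D₁ := leftHomologyData S₁ hP₁ hQ₁ h₁ τ₁ τ'₁) commi
    commπ := (strictHom_comp _ _).trans
      ((congrArg strictHom (hs.proj_comp_mapHomology hr h h₁ τ τ₁ τ' τ'₁)).trans
        (strictHom_comp _ _).symm) }

lemma quasiIso_iff (φ : S ⟶ S₁) (hP : toHom P = S.f) (hQ : toHom Q = S.g)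
    (hP₁ : toHom P₁ = S₁.f) (hQ₁ : toHom Q₁ = S₁.g) (h : IsLink P Q δ) (h₁ : IsLink P₁ Q₁ δ₁)
    (hs : IsMap P P₁ f g s) (hr : IsMap Q Q₁ g l r) (hg : φ.τ₂ = strictHom g)
    (τ : Factor P) (τ₁ : Factor P₁) (τ' : Factor Q) (τ'₁ : Factor Q₁) :
    ShortComplex.QuasiIso φ ↔ arrowQis A (hs.mapHomology hr h h₁ τ τ₁ τ' τ'₁) := by
  rw [(leftHomologyMapData φ hP hQ hP₁ hQ₁ h h₁ hs hr hg τ τ₁ τ' τ'₁).quasiIso_iff]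
  exact isIso_strictHom_iff (X := h.homology τ τ') (Y := h₁.homology τ₁ τ'₁) _

end

end Tilt

namespace Tot

open _root_.HRS.Tilt

variable {t : TorsionPair A} {X Y : StrictComplex t}

/-- A chosen factor of the butterfly of a differential. -/
def factor (X : StrictComplex t) (k : ℤ) : Factor (wing X k) := (Factor.nonempty _).some

/-- The map induced by `φ` on the homology of the complexes in `Tilt t`. -/
abbrev mapHomology (φ : X ⟶ Y) (k : ℤ) :
    ((isLink X k).homology (factor X k) (factor X (k + 1))).arrow ⟶
      ((isLink Y k).homology (factor Y k) (factor Y (k + 1))).arrow :=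
  (isMap φ k).mapHomology (isMap φ (k + 1)) (isLink X k) (isLink Y k) _ _ _ _

lemma quasiIsoAt_incl_iff (φ : X ⟶ Y) (k : ℤ) :
    QuasiIsoAt ((StrictComplex.incl t).map φ) (k + 1) ↔ arrowQis A (mapHomology φ k) := by
  rw [quasiIsoAt_iff' _ k (k + 1) (k + 1 + 1) (by simp) (by simp)]
  exact Tilt.quasiIso_iff _ (toHom_out _) (toHom_out _) (toHom_out _) (toHom_out _)
    (isLink X k) (isLink Y k) (isMap φ k) (isMap φ (k + 1)) rfl _ _ _ _

lemma quasiIso_incl_iff (φ : X ⟶ Y) :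
    QuasiIso ((StrictComplex.incl t).map φ) ↔ ∀ k, arrowQis A (mapHomology φ k) := by
  rw [_root_.quasiIso_iff]
  refine ⟨fun h k => (quasiIsoAt_incl_iff φ k).1 (h _), fun h n => ?_⟩
  obtain ⟨k, rfl⟩ : ∃ k, n = k + 1 := ⟨n - 1, by lia⟩
  exact (quasiIsoAt_incl_iff φ k).2 (h k)

/-- The subobjects `S` interpolate the complex of centres. -/
abbrev interpolation (X : StrictComplex t) (k : ℤ) :
    Interpolation ((aux X).sc' k (k + 1) (k + 1 + 1)) where
  Q := cokernel (factor X k).a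
  S₂ := (factor X (k + 1)).S
  S₃ := (factor X (k + 1 + 1)).S
  π := cokernel.π (factor X k).a
  a := (factor X (k + 1)).a
  a₃ := (factor X (k + 1 + 1)).a
  l := ((isLink X k).homology (factor X k) (factor X (k + 1))).arrow.hom
  r := ((isLink X (k + 1)).homology (factor X (k + 1)) (factor X (k + 1 + 1))).arrow.hom
  epi_π := inferInstanceAs (Epi (cokernel.π (factor X k).a))
  mono_a := (factor X (k + 1)).mono
  mono_a₃ := (factor X (k + 1 + 1)).mono
  fac_f := ((isLink X k).π_homology_hom_a _ _).trans (aux_d X k).symm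
  fac_g := ((isLink X (k + 1)).π_homology_hom_a _ _).trans (aux_d X (k + 1)).symm

/-- The chain map between the complexes of centres. -/
abbrev auxMap (φ : X ⟶ Y) : aux X ⟶ aux Y where
  f k := mapE φ k
  comm' k l h := mapE_comm φ k l h

lemma quasiIsoAt_auxMap_iff (φ : X ⟶ Y) (k : ℤ) :
    QuasiIsoAt (auxMap φ) (k + 1) ↔
      IsIso (arrowCoker (mapHomology φ k)) ∧ IsIso (arrowKer (mapHomology φ (k + 1))) := by
  rw [quasiIsoAt_iff' _ k (k + 1) (k + 1 + 1) (by simp) (by simp)]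
  exact Interpolation.quasiIso_iff (t := t) (I := interpolation X k) (I' := interpolation Y k) _
    ((isLink X (k + 1)).homology (factor X (k + 1)) (factor X (k + 1 + 1))).ker_mem
    ((isLink Y k).homology (factor Y k) (factor Y (k + 1))).coker_mem
    (mapHomology φ k) (mapHomology φ (k + 1)) ((isMap φ (k + 1)).mapS_a _ _) (cokernel.π_desc _ _ _)

lemma quasiIso_auxMap_iff (φ : X ⟶ Y) :
    QuasiIso (auxMap φ) ↔ ∀ k, arrowQis A (mapHomology φ k) := by
  rw [_root_.quasiIso_iff]
  constructor
  · intro h k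
    refine ⟨?_, ((quasiIsoAt_auxMap_iff φ k).1 (h _)).1⟩
    obtain ⟨m, rfl⟩ : ∃ m, k = m + 1 := ⟨k - 1, by lia⟩
    exact ((quasiIsoAt_auxMap_iff φ m).1 (h _)).2
  · intro h n
    obtain ⟨k, rfl⟩ : ∃ k, n = k + 1 := ⟨n - 1, by lia⟩
    exact (quasiIsoAt_auxMap_iff φ k).2 ⟨(h k).2, (h (k + 1)).1⟩

lemma quasiIsoAt_decoratedMap_iff (φ : X ⟶ Y) (n : ℤ) :
    QuasiIsoAt (decoratedMap φ).map n ↔ QuasiIsoAt (auxMap φ) (n - 1) := by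
  rw [quasiIsoAt_iff' _ (n - 1) n (n + 1) (by simp) (by simp),
    quasiIsoAt_iff' _ (n - 1 - 1) (n - 1) (n + 1 - 1) (by simp) (by simp)]
  rfl

lemma qis_map_iff (φ : X ⟶ Y) :
    qis t ((Tot t).map φ) ↔ QuasiIso ((StrictComplex.incl t).map φ) := by
  rw [quasiIso_incl_iff, ← quasiIso_auxMap_iff, _root_.quasiIso_iff]
  refine (_root_.quasiIso_iff (decoratedMap φ).map).trans ⟨fun h k => ?_, fun h n =>
    (quasiIsoAt_decoratedMap_iff φ n).2 (h _)⟩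
  obtain ⟨n, rfl⟩ : ∃ n, k = n - 1 := ⟨k + 1, by lia⟩
  exact (quasiIsoAt_decoratedMap_iff φ n).1 (h n)

variable (t) in
lemma qis_inverseImage : (qis t).inverseImage (Tot t) =
    (HomologicalComplex.quasiIso (Tilt t) (ComplexShape.up ℤ)).inverseImage
      (StrictComplex.incl t) := by
  ext X Y φ
  exact qis_map_iff φ

end Tot

variable (t : TorsionPair A)

instance StrictComplex.isLocalization_incl_comp_Q [HasDerivedCategory.{w} (Tilt t)] :
    (incl t ⋙ DerivedCategory.Q).IsLocalization
      ((HomologicalComplex.quasiIso (Tilt t) (ComplexShape.up ℤ)).inverseImage (incl t)) :=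
  let W := HomologicalComplex.quasiIso (Tilt t) (ComplexShape.up ℤ)
  Functor.IsLocalization.comp _ _ (invertedBy (incl t)) W _
    (fun _ _ _ h => Localization.inverts DerivedCategory.Q W _ h)
    (fun _ _ f (_ : IsIso ((incl t).map f)) => inferInstanceAs (QuasiIso ((incl t).map f)))
    ((hasRoofs_incl t).le_map_inverseImage W)

lemma Tot.isLocalization_comp_Q (W : MorphismProperty (CompatibleComplex t)) [W.RespectsIso] :
    (Tot t ⋙ W.Q).IsLocalization (W.inverseImage (Tot t)) := by
  let Φ : LocalizerMorphism (W.inverseImage (Tot t)) W := { functor := Tot t, map := le_rfl }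
  have : Φ.IsInduced := ⟨rfl⟩
  have : Φ.functor.IsEquivalence := inferInstanceAs (Tot t).IsEquivalence
  have : Φ.IsLocalizedEquivalence := Φ.isLocalizedEquivalence_of_isInduced
  exact LocalizerMorphism.IsLocalizedEquivalence.isLocalization Φ W.Q

end

end HRS

theorem corollaryC {A : Type u} [Category.{v} A] [Abelian A] (t : HRS.TorsionPair A)
    [HasDerivedCategory.{w} (HRS.Tilt t)] :
    (∃ Φ : CochainComplex (HRS.Tilt t) ℤ ⥤ (HRS.sis t).Localization,
      Φ.IsEquivalence ∧
        Nonempty (HRS.StrictComplex.incl t ⋙ Φ ≅ HRS.Tot t ⋙ (HRS.sis t).Q)) ∧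
    (∃ Ψ : DerivedCategory (HRS.Tilt t) ⥤ (HRS.qis t).Localization,
      Ψ.IsEquivalence ∧
        Nonempty (HRS.StrictComplex.incl t ⋙ DerivedCategory.Q ⋙ Ψ ≅
          HRS.Tot t ⋙ (HRS.qis t).Q)) := by
  have hsis := HRS.Tot.isLocalization_comp_Q t (HRS.sis t)
  have hqis := HRS.Tot.isLocalization_comp_Q t (HRS.qis t)
  rw [HRS.Tot.sis_inverseImage] at hsis
  rw [HRS.Tot.qis_inverseImage] at hqis
  let I := HRS.StrictComplex.incl t
  let W := (HomologicalComplex.quasiIso (HRS.Tilt t) (ComplexShape.up ℤ)).inverseImage I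
  exact
    ⟨⟨(Localization.uniq I (HRS.Tot t ⋙ (HRS.sis t).Q) (HRS.invertedBy I)).functor,
      inferInstance, ⟨Localization.compUniqFunctor _ _ _⟩⟩,
    ⟨(Localization.uniq (I ⋙ DerivedCategory.Q) (HRS.Tot t ⋙ (HRS.qis t).Q) W).functor,
      inferInstance, ⟨(Functor.associator _ _ _).symm ≪≫ Localization.compUniqFunctor _ _ _⟩⟩⟩
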